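/- Let $K$ be a field of characteristic $0$ and let $I$ be a finite nonempty set. **Systems.** $\mathcal H_I$ is the Connes–Kreimer Hopf algebra of rooted trees decorated by $I$: the polynomial algebra generated by these trees, with coproduct given on a tree by $\Delta(t)=\sum_c P^c(t)\otimes R^c(t)$ over all admissible cuts (including the empty and the total cut), graded by the number of vertices; $B^+_i$ is the operator grafting the trees of a forest on a common root decorated by $i$. An SDSE $(S)$ is a family $F_i\in K[[h_j,\ j\in I]]$, $i\in I$, of non-constant formal series, normalised by $F_i(0)=1$. There is a unique family $(X_i)_{i\in I}$ in the completion of $\mathcal H_I$, without constant terms, with $X_i=B^+_i(F_i(X_j,\ j\in I))$ for all $i$. $\mathcal H_{(S)}$ is the subalgebra of $\mathcal H_I$ generated by the homogeneous components $X_i(n)$, $n\ge 1$, of the $X_i$; $(S)$ is *Hopf* if $\mathcal H_{(S)}$ is a Hopf subalgebra of $\mathcal H_I$, and then $\mathfrak g_{(S)}$ is the Lie algebra of the primitive elements of the graded dual of $\mathcal H_{(S)}$. There is an edge $i\to j$ if $\partial F_i/\partial h_j\ne 0$; the descendants of $i$ are the ends of the oriented paths of length $\geq 1$ starting from $i$.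 The restriction of $(S)$ to $B\subseteq I$ is obtained by keeping the $F_i$, $i\in B$, and putting $h_j=0$ for $j\notin B$. A system is an *extension*, at the vertex $x$, of its restriction to the other vertices if these other series do not depend on $h_x$ and $F_x=1+\sum_{i\neq x}a_ih_i$ with $F_i=F_j$ whenever $a_i,a_j\neq 0$. A vertex $i$ is an *extension vertex* if, $J$ being the set of its descendants, the restriction of $(S)$ to $J\cup\{i\}$ is an extension at $i$ of the restriction to $J$. A change of variables replaces $F_i$ by $\mu_iF_i(\lambda_jh_j,\ j\in I)$, with $\lambda_j,\mu_i\in K\setminus\{0\}$. For a partition $I=\bigsqcup_{j\in I'} J_j$ into nonempty parts, the dilatation of a system $(F'_j)_{j\in I'}$ is the system given by $F_x=F'_i\big(\sum_{y\in J_j}h_y,\ j\in I'\big)$ for $x\in J_i$. **Fundamental systems.** Put $f_\beta(h)=\sum_{k\ge 0}\frac{(1+\beta)\cdots(1+(k-1)\beta)}{k!}h^k$, with the convention $f_{\beta/\lambda}(\lambda h)=1$ if $\lambda=0$. A *basic* system has a finite set of vertices partitioned as $I_0\sqcup J_0\sqcup K_0\sqcup I_1\sqcup J_1$, with $I_0\cup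 J_0\neq\emptyset$, and the following series, for scalars $\beta_j$ ($j\in I_0$), $\nu_i$ ($i\in I_1\cup J_1$), $a^{(i)}_j$: - $i\in I_0$: $F_i=f_{\beta_i}(h_i)\prod_{j\in I_0\setminus\{i\}}f_{\frac{\beta_j}{1+\beta_j}}((1+\beta_j)h_j)\prod_{j\in J_0}f_1(h_j)$; - $i\in J_0$: $F_i=\prod_{j\in I_0}f_{\frac{\beta_j}{1+\beta_j}}((1+\beta_j)h_j)\prod_{j\in J_0\setminus\{i\}}f_1(h_j)$; - $i\in K_0$: $F_i=\prod_{j\in I_0}f_{\frac{\beta_j}{1+\beta_j}}((1+\beta_j)h_j)\prod_{j\in J_0}f_1(h_j)$; - $i\in I_1$: one has $\nu_i\ne1$, or $a^{(i)}_j\neq 1+\beta_j$ for some $j\in I_0$, or $a^{(i)}_j\ne 1$ for some $j\in J_0$, or $a_j^{(i)}\neq0$ for some $j\in K_0$; if $\nu_i\neq 0$, $$F_i=\tfrac1{\nu_i}\prod_{j\in I_0}f_{\frac{\beta_j}{\nu_ia^{(i)}_j}}(\nu_ia^{(i)}_jh_j)\prod_{j\in J_0}f_{\frac1{\nu_ia^{(i)}_j}}(\nu_ia^{(i)}_jh_j)\prod_{j\in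 K_0}f_0(\nu_ia^{(i)}_jh_j)+1-\tfrac1{\nu_i},$$ and if $\nu_i=0$, $$F_i=-\sum_{j\in I_0}\tfrac{a^{(i)}_j}{\beta_j}\ln(1-\beta_jh_j)-\sum_{j\in J_0}a^{(i)}_j\ln(1-h_j)+\sum_{j\in K_0}a^{(i)}_jh_j+1$$ (where $-\frac1{\beta_j}\ln(1-\beta_jh_j)$ means $h_j$ if $\beta_j=0$); - $i\in J_1$: $\nu_i\neq0$, the set $I_1^{(i)}=\{j\in I_1: a^{(i)}_j\ne0\}$ is nonempty, $\nu_j=1$ and $F_j=F_k$ for all $j,k\in I_1^{(i)}$; put $b^{(i)}_t=a^{(j)}_t$ for $j\in I_1^{(i)}$, $t\in I_0\cup J_0\cup K_0$; then $$F_i=\tfrac1{\nu_i}\prod_{j\in I_0}f_{\frac{\beta_j}{b^{(i)}_j-1-\beta_j}}\big((b^{(i)}_j-1-\beta_j)h_j\big)\prod_{j\in J_0}f_{\frac1{b^{(i)}_j-1}}\big((b^{(i)}_j-1)h_j\big)\prod_{j\in K_0}f_0(b^{(i)}_jh_j)+\sum_{j\in I_1^{(i)}}a^{(i)}_jh_j+1-\tfrac1{\nu_i}.$$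 Put $b_j=1+\beta_j$ if $j\in I_0$, $b_j=1$ if $j\in J_0$, and $b_j=0$ otherwise. A system is *fundamental* if, up to a change of variables, it is a dilatation of a basic system; it is moreover *abelian* if all $b_j$ are zero (that is, $J_0=\emptyset$ and $\beta_j=-1$ for all $j\in I_0$). A system is of *abelian fundamental type* if it is obtained from an abelian fundamental one by a finite (possibly empty) sequence of extensions. **Lie algebras and modules.** For $M\geq 1$, $\mathfrak g_{ab}$ is the abelian Lie algebra with basis $(e^{(i)}(k))_{1\le i\le M,\ k\ge1}$. For $\upsilon\in K^M$, $V_\upsilon$ is the $\mathfrak g_{ab}$-module with basis $(f(k))_{k\ge1}$ and $e^{(i)}(k).f(l)=\upsilon_if(k+l)$. Given $\upsilon^{(1)},\dots,\upsilon^{(N)}\in K^M$, let $\mathfrak g=\big(V_{\upsilon^{(1)}}\oplus\cdots\oplus V_{\upsilon^{(N)}}\big)\rtimes\mathfrak g_{ab}$, with basis formed by the $e^{(i)}(k)$ and the $f^{(j)}(k)$. For $\nu\in K^M$, $W_\nu$ is the $\mathfrak g$-module with basis $(g(k))_{k\ge1}$ and $e^{(i)}(k).g(1)=\nu_ig(k+1)$,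 $e^{(i)}(k).g(l)=0$ if $l\ge2$, $f^{(j)}(k).g(l)=0$. For $\nu\in K^M$ and $\mu\in K^N$ such that $\mu_j(\nu_i-\upsilon^{(j)}_i)=0$ for all $i,j$, $W'_{\nu,\mu}$ is the $\mathfrak g$-module with basis $(g(k))_{k\ge1}$ and $e^{(i)}(k).g(l)=\nu_ig(k+l)$, $f^{(j)}(k).g(1)=\mu_jg(k+1)$, $f^{(j)}(k).g(l)=0$ if $l\ge2$. In a semi-direct product $U\rtimes\mathfrak h$ of a Lie algebra and a module, $U$ is an abelian ideal. **Theorem.** Let $(S)$ be a Hopf SDSE of abelian fundamental type with no extension vertex. Then there are $M\geq 1$, $N\ge0$, $\upsilon^{(1)},\dots,\upsilon^{(N)}\in K^M$, and a finite (possibly empty) direct sum $W$ of modules of the form $W_\nu$ and $W'_{\nu,\mu}$, such that $$\mathfrak g_{(S)}\cong W\rtimes\Big(\big(V_{\upsilon^{(1)}}\oplus\cdots\oplus V_{\upsilon^{(N)}}\big)\rtimes\mathfrak g_{ab}\Big).$$ -/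

import Mathlib

open scoped TensorProduct

namespace HopfSDSE

universe u v

/-- Planar (i.e. ordered) forests of rooted trees decorated by `D`: either empty, or a first tree
(whose root is decorated by `d` and carries the planar forest `children`) followed by `rest`. -/
inductive PForest (D : Type v) : Type v
  | nil : PForest D
  | cons (d : D) (children rest : PForest D) : PForest D

/-- Two planar forests represent the same forest when they differ by the order of the trees, at the
top level or among the children of any vertex. -/
inductive PForest.Rel {D : Type v} : PForest D → PForest D → Prop
  | refl (a) : Rel a a
  | symm {a b} : Rel a b → Rel b a
  | trans {a b c} : Rel a b → Rel b c → Rel a c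
  | cons (d : D) {a a' b b'} : Rel a a' → Rel b b' → Rel (.cons d a b) (.cons d a' b')
  | swap (d e : D) (a b c) : Rel (.cons d a (.cons e b c)) (.cons e b (.cons d a c))

instance PForest.setoid (D : Type v) : Setoid (PForest D) where
  r := PForest.Rel
  iseqv := ⟨.refl, .symm, .trans⟩

/-- Rooted forests decorated by `D` (no order on the trees). -/
def Forest (D : Type v) : Type v := Quotient (PForest.setoid D)

/-- Rooted trees decorated by `D`: the decoration of the root and the forest of the subtrees hanging
from the root. -/
structure RTree (D : Type v) : Type v where
  /-- The decoration of the root. -/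
  root : D
  /-- The forest obtained by deleting the root. -/
  children : Forest D

variable {D : Type v}

namespace Forest

/-- The forest underlying a planar forest. -/
def mk (a : PForest D) : Forest D := Quotient.mk _ a

theorem mk_eq {a b : PForest D} (h : PForest.Rel a b) : mk a = mk b := Quotient.sound h

theorem ind {p : Forest D → Prop} (h : ∀ a, p (mk a)) (f : Forest D) : p f :=
  Quotient.inductionOn f h

/-- Functions on forests are functions on planar forests that do not see the order. -/
def lift {A : Type*} (φ : PForest D → A) (h : ∀ a b, PForest.Rel a b → φ a = φ b) (f : Forest D) :
    A :=
  Quotient.lift φ h f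

/-- The empty forest. -/
def nil : Forest D := mk .nil

/-- Adding a tree to a forest. -/
def cons (t : RTree D) (f : Forest D) : Forest D :=
  Quotient.map₂ (PForest.cons t.root) (fun _ _ h _ _ h' => PForest.Rel.cons _ h h') t.children f

theorem cons_mk (d : D) (a b : PForest D) : cons ⟨d, mk a⟩ (mk b) = mk (.cons d a b) := rfl

instance : LeftCommutative (cons : RTree D → Forest D → Forest D) where
  left_comm := by
    rintro ⟨d, a⟩ ⟨e, b⟩ c
    induction a using ind with | h a => ?_
    induction b using ind with | h b => ?_
    induction c using ind with | h c => ?_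
    exact mk_eq (PForest.Rel.swap _ _ _ _ _)

/-- The forest consisting of a finite multiset of trees. -/
def ofTrees (s : Multiset (RTree D)) : Forest D := s.foldr cons nil

theorem ofTrees_cons (t : RTree D) (s : Multiset (RTree D)) :
    ofTrees (t ::ₘ s) = cons t (ofTrees s) := Multiset.foldr_cons _ _ _ _

theorem exists_ofTrees (f : Forest D) : ∃ s, ofTrees s = f := by
  induction f using ind with | h a => ?_
  induction a with
  | nil => exact ⟨0, rfl⟩
  | cons d c r _ ih =>
    obtain ⟨s, hs⟩ := ih
    exact ⟨⟨d, mk c⟩ ::ₘ s, by rw [ofTrees_cons, hs, cons_mk]⟩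

end Forest

/-- `B⁺_d`, at the level of forests: grafting the trees of a forest on a root decorated by `d`. -/
def RTree.graft (d : D) (s : Multiset (RTree D)) : RTree D := ⟨d, Forest.ofTrees s⟩

/-- The number of vertices. -/
def PForest.weight : PForest D → ℕ
  | .nil => 0
  | .cons _ c r => 1 + c.weight + r.weight

theorem PForest.Rel.weight_eq {a b : PForest D} (h : PForest.Rel a b) : a.weight = b.weight := by
  induction h <;> (simp_all [PForest.weight]; try omega)

/-- The weight of a tree: its number of vertices. -/
def RTree.weight (t : RTree D) : ℕ :=
  1 + t.children.lift PForest.weight (fun _ _ h => h.weight_eq)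

/-- The admissible cuts of the tree `t` whose root is decorated by `d` and has a forest of children
whose cuts (tree by tree) are `s`; a cut `c` is recorded as the pair `(P^c, R^c)` of multisets of
trees. The first one is the total cut; any other admissible cut restricts to an admissible cut on
each child of the root (to the total cut exactly when the edge to that child is cut). -/
def cutsAux (t : RTree D) (s : Multiset (Multiset (RTree D) × Multiset (RTree D))) :
    Multiset (Multiset (RTree D) × Multiset (RTree D)) :=
  ({t}, 0) ::ₘ s.map (fun p => (p.1, {RTree.graft t.root p.2}))

/-- The families of admissible cuts, one for each tree of a forest (each tree may be totally cut). -/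
def PForest.cuts : PForest D → Multiset (Multiset (RTree D) × Multiset (RTree D))
  | .nil => {(0, 0)}
  | .cons d c r => (cutsAux ⟨d, Forest.mk c⟩ c.cuts ×ˢ r.cuts).map (fun p => p.1 + p.2)

theorem map_add_swap {A : Type v} [AddCommMonoid A] (s t u : Multiset A) :
    (s ×ˢ ((t ×ˢ u).map fun p => p.1 + p.2)).map (fun p => p.1 + p.2) =
      (t ×ˢ ((s ×ˢ u).map fun p => p.1 + p.2)).map (fun p => p.1 + p.2) := by
  have key : ∀ s t u : Multiset A,
      (s ×ˢ ((t ×ˢ u).map fun p => p.1 + p.2)).map (fun p => p.1 + p.2) =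
      s.bind fun a => t.bind fun b => u.map fun c => a + (b + c) := by
    intro s t u
    simp [SProd.sprod, Multiset.product, Multiset.map_bind, Multiset.map_map]
  rw [key, key, Multiset.bind_bind]
  refine Multiset.bind_congr fun a _ => Multiset.bind_congr fun b _ => Multiset.map_congr rfl ?_
  intro c _
  exact add_left_comm _ _ _

theorem PForest.Rel.cuts_eq {a b : PForest D} (h : PForest.Rel a b) : a.cuts = b.cuts := by
  induction h with
  | refl => rfl
  | symm _ ih => exact ih.symm
  | trans _ _ ih ih' => exact ih.trans ih'
  | cons d h h' ih ih' =>
    simp only [PForest.cuts, ih, ih', Forest.mk_eq h]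
  | swap d e a b c => exact map_add_swap _ _ _

/-- The families of admissible cuts, one for each tree of a forest. -/
def Forest.cuts (f : Forest D) : Multiset (Multiset (RTree D) × Multiset (RTree D)) :=
  f.lift PForest.cuts (fun _ _ h => h.cuts_eq)

/-- The admissible cuts `c` of a tree (including the empty and the total cut), each recorded as the
pair `(P^c, R^c)`. -/
def RTree.cuts (t : RTree D) : Multiset (Multiset (RTree D) × Multiset (RTree D)) :=
  cutsAux t t.children.cuts

section HopfAlgebra

variable (K : Type u) [Field K]

/-- The algebra `H_D` of rooted forests decorated by `D`: the polynomial algebra generated by the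
rooted trees decorated by `D`. -/
abbrev HTree (K : Type u) [Field K] (D : Type v) : Type (max u v) := MvPolynomial (RTree D) K

/-- The forest with the given trees, as a monomial of `H_D`. -/
noncomputable def mon (s : Multiset (RTree D)) : HTree K D := (s.map MvPolynomial.X).prod

/-- The operator `B⁺_d` on `H_D`, sending a forest to the tree obtained by grafting it on a common
root decorated by `d`. -/
noncomputable def bPlus (d : D) : HTree K D →ₗ[K] HTree K D :=
  (MvPolynomial.basisMonomials (RTree D) K).constr K
    (fun m => MvPolynomial.X (RTree.graft d (Finsupp.toMultiset m)))

/-- The coproduct of `H_D`: the algebra morphism given on a tree `t` by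
`Δ(t) = ∑ P^c(t) ⊗ R^c(t)`, the sum being over the admissible cuts `c` of `t`. -/
noncomputable def comulTree : HTree K D →ₐ[K] HTree K D ⊗[K] HTree K D :=
  MvPolynomial.aeval (fun t => (t.cuts.map fun p => mon K p.1 ⊗ₜ[K] mon K p.2).sum)

/-- The counit of `H_D`: it vanishes on nonempty forests. -/
noncomputable def counitTree : HTree K D →ₐ[K] K := MvPolynomial.aeval (fun _ => 0)

theorem mon_add (s t : Multiset (RTree D)) : mon K (s + t) = mon K s * mon K t := by
  simp [mon]

theorem mon_eq_monomial (s : Multiset (RTree D)) [DecidableEq (RTree D)] :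
    mon K s = MvPolynomial.monomial (Multiset.toFinsupp s) 1 := by
  induction s using Multiset.induction with
  | empty => simp [mon]
  | cons a s ih =>
    have h : mon K {a} = MvPolynomial.monomial (Finsupp.single a 1) (1 : K) := by simp [mon, MvPolynomial.X]
    rw [← Multiset.singleton_add, mon_add, ih, map_add, h, MvPolynomial.monomial_mul]
    simp

theorem bPlus_mon (d : D) (s : Multiset (RTree D)) :
    bPlus K d (mon K s) = MvPolynomial.X (RTree.graft d s) := by
  classical
  have := (MvPolynomial.basisMonomials (RTree D) K).constr_basis K
    (fun m => (MvPolynomial.X (RTree.graft d (Finsupp.toMultiset m)) : HTree K D))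
    (Multiset.toFinsupp s)
  rw [mon_eq_monomial, bPlus]
  simpa using this

theorem span_mon : Submodule.span K (Set.range (mon K (D := D))) = ⊤ := by
  classical
  rw [eq_top_iff, ← (MvPolynomial.basisMonomials (RTree D) K).span_eq]
  refine Submodule.span_mono ?_
  rintro _ ⟨m, rfl⟩
  exact ⟨Finsupp.toMultiset m, by simp [mon_eq_monomial]⟩

/-- The sum of `P^c ⊗ R^c` over the families of admissible cuts of a forest. -/
noncomputable def cutSum (f : Forest D) : HTree K D ⊗[K] HTree K D :=
  (f.cuts.map fun p => mon K p.1 ⊗ₜ[K] mon K p.2).sum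

theorem sum_cutsAux (t : RTree D) (s) :
    ((cutsAux t s).map fun p => mon K p.1 ⊗ₜ[K] mon K p.2).sum =
      MvPolynomial.X t ⊗ₜ 1 + (bPlus K t.root).lTensor (HTree K D)
        ((s.map fun p => mon K p.1 ⊗ₜ[K] mon K p.2).sum) := by
  rw [cutsAux, Multiset.map_cons, Multiset.sum_cons, map_multiset_sum, Multiset.map_map,
    Multiset.map_map]
  congr 1
  · simp [mon]
  · congr 1
    refine Multiset.map_congr rfl fun p _ => ?_
    simp [bPlus_mon]
    simp [mon]

theorem comulTree_X (t : RTree D) : comulTree K (MvPolynomial.X t) =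
    MvPolynomial.X t ⊗ₜ 1 + (bPlus K t.root).lTensor (HTree K D) (cutSum K t.children) := by
  rw [comulTree, MvPolynomial.aeval_X, RTree.cuts, sum_cutsAux]
  rfl

theorem cutSum_cons (t : RTree D) (f : Forest D) :
    cutSum K (Forest.cons t f) = comulTree K (MvPolynomial.X t) * cutSum K f := by
  rw [comulTree_X]
  obtain ⟨d, c⟩ := t
  induction c using Forest.ind with | h c => ?_
  induction f using Forest.ind with | h f => ?_
  have : ∀ s t : Multiset (Multiset (RTree D) × Multiset (RTree D)),
      (((s ×ˢ t).map (fun p => p.1 + p.2)).map fun p => mon K p.1 ⊗ₜ[K] mon K p.2).sum =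
      (s.map fun p => mon K p.1 ⊗ₜ[K] mon K p.2).sum *
      (t.map fun p => mon K p.1 ⊗ₜ[K] mon K p.2).sum := by
    intro s t
    induction s using Multiset.induction with
    | empty => simp
    | cons a s ih =>
      rw [Multiset.cons_product, Multiset.map_add, Multiset.map_add, Multiset.sum_add, ih,
        Multiset.map_cons, Multiset.sum_cons, add_mul]
      congr 1
      rw [← Multiset.sum_map_mul_left, Multiset.map_map, Multiset.map_map]
      congr 1
      refine Multiset.map_congr rfl fun p _ => ?_
      simp [mon_add]
  have h2 := this (cutsAux ⟨d, Forest.mk c⟩ c.cuts) f.cuts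
  exact h2.trans (congrArg (· * _) (sum_cutsAux K _ _))

theorem cutSum_ofTrees (s : Multiset (RTree D)) :
    cutSum K (Forest.ofTrees s) = comulTree K (mon K s) := by
  induction s using Multiset.induction with
  | empty =>
    have : cutSum K (Forest.ofTrees (0 : Multiset (RTree D))) =
      (({(0, 0)} : Multiset (Multiset (RTree D) × Multiset (RTree D))).map
    fun p => mon K p.1 ⊗ₜ[K] mon K p.2).sum := rfl
    rw [this]
    simp [mon, Algebra.TensorProduct.one_def]
  | cons a s ih =>
    rw [Forest.ofTrees_cons, cutSum_cons, ih, ← map_mul]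
    simp [mon]

/-- The cocycle property of `B⁺_d`. -/
theorem comulTree_bPlus (d : D) (x : HTree K D) : comulTree K (bPlus K d x) =
    bPlus K d x ⊗ₜ 1 + (bPlus K d).lTensor (HTree K D) (comulTree K x) := by
  have hx : x ∈ Submodule.span K (Set.range (mon K (D := D))) := by rw [span_mon]; trivial
  induction hx using Submodule.span_induction with
  | mem x h =>
    obtain ⟨s, rfl⟩ := h
    rw [bPlus_mon, comulTree_X]
    simp only [RTree.graft]
    rw [cutSum_ofTrees]
  | zero => simp
  | add x y _ _ hx hy => simp only [map_add, hx, hy, TensorProduct.add_tmul]; abel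
  | smul a x _ hx => simp only [map_smul, hx, TensorProduct.smul_tmul', smul_add]

/-- Induction on trees. -/
theorem RTree.induction {p : RTree D → Prop}
    (h : ∀ d s, (∀ t ∈ s, p t) → p (RTree.graft d s)) (t : RTree D) : p t := by
  have key : ∀ a : PForest D, ∃ s, (∀ t ∈ s, p t) ∧ Forest.ofTrees s = Forest.mk a := by
    intro a
    induction a with
    | nil => exact ⟨0, by simp, rfl⟩
    | cons d c r ihc ihr =>
      obtain ⟨s, hs, hs'⟩ := ihc
      obtain ⟨s', hr, hr'⟩ := ihr
      refine ⟨⟨d, Forest.mk c⟩ ::ₘ s', ?_, ?_⟩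
      · intro t ht
        rcases Multiset.mem_cons.1 ht with rfl | ht
        · have := h d s hs
          rwa [RTree.graft, hs'] at this
        · exact hr t ht
      · rw [Forest.ofTrees_cons, hr', Forest.cons_mk]
  obtain ⟨d, f⟩ := t
  induction f using Forest.ind with
  | h a =>
    obtain ⟨s, hs, hs'⟩ := key a
    rw [← hs']
    exact h d s hs

/-- Two algebra morphisms out of `H_D` agree if they agree on `B⁺_d(x)` whenever they agree on
`x`. -/
theorem HTree.algHom_ext {A : Type*} [CommSemiring A] [Algebra K A] {f g : HTree K D →ₐ[K] A}
    (h : ∀ d x, f x = g x → f (bPlus K d x) = g (bPlus K d x)) : f = g := by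
  refine MvPolynomial.algHom_ext fun t => ?_
  induction t using RTree.induction with
  | h d s hs =>
    rw [← bPlus_mon]
    apply h
    rw [mon, map_multiset_prod, map_multiset_prod, Multiset.map_map, Multiset.map_map]
    congr 1
    exact Multiset.map_congr rfl fun t ht => hs t ht

theorem counitTree_bPlus (d : D) (x : HTree K D) : counitTree K (bPlus K d x) = 0 := by
  have hx : x ∈ Submodule.span K (Set.range (mon K (D := D))) := by rw [span_mon]; trivial
  induction hx using Submodule.span_induction with
  | mem x h =>
    obtain ⟨s, rfl⟩ := h
    simp [bPlus_mon, counitTree]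
  | zero => simp
  | add x y _ _ hx hy => simp only [map_add, hx, hy, add_zero]
  | smul a x _ hx => simp only [map_smul, hx, smul_zero]

theorem comulTree_coassoc :
    (Algebra.TensorProduct.assoc K K K (HTree K D) (HTree K D) (HTree K D)).toAlgHom.comp
      ((Algebra.TensorProduct.map (comulTree K) (.id K (HTree K D))).comp (comulTree K))
      = (Algebra.TensorProduct.map (.id K (HTree K D)) (comulTree K)).comp (comulTree K) := by
  refine HTree.algHom_ext (A := HTree K D ⊗[K] (HTree K D ⊗[K] HTree K D)) K fun d x hx => ?_
  have h1 : ∀ y : HTree K D ⊗[K] HTree K D,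
      (Algebra.TensorProduct.assoc K K K (HTree K D) (HTree K D) (HTree K D)).toAlgHom
        ((Algebra.TensorProduct.map (comulTree K) (.id K (HTree K D)))
          ((bPlus K d).lTensor (HTree K D) y)) =
      ((bPlus K d).lTensor (HTree K D)).lTensor (HTree K D)
        ((Algebra.TensorProduct.assoc K K K (HTree K D) (HTree K D) (HTree K D)).toAlgHom
        ((Algebra.TensorProduct.map (comulTree K) (.id K (HTree K D))) y)) := by
    intro y
    induction y using TensorProduct.induction_on with
    | zero => simp
    | add y z hy hz => simp only [map_add, hy, hz]
    | tmul y z =>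
      simp only [LinearMap.lTensor_tmul, Algebra.TensorProduct.map_tmul, AlgHom.id_apply]
      generalize comulTree K y = w
      induction w using TensorProduct.induction_on with
      | zero => simp
      | add y z hy hz => simp only [map_add, TensorProduct.add_tmul, hy, hz]
      | tmul y z => simp
  have h2 : ∀ y : HTree K D ⊗[K] HTree K D,
      (Algebra.TensorProduct.map (.id K (HTree K D)) (comulTree K))
          ((bPlus K d).lTensor (HTree K D) y) =
      (Algebra.TensorProduct.assoc K K K (HTree K D) (HTree K D) (HTree K D)).toAlgHom
        ((bPlus K d).lTensor (HTree K D) y ⊗ₜ[K] 1) +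
      ((bPlus K d).lTensor (HTree K D)).lTensor (HTree K D)
        ((Algebra.TensorProduct.map (.id K (HTree K D)) (comulTree K)) y) := by
    intro y
    induction y using TensorProduct.induction_on with
    | zero => simp
    | add y z hy hz => simp only [map_add, TensorProduct.add_tmul, hy, hz]; abel
    | tmul y z => simp [comulTree_bPlus, TensorProduct.tmul_add]
  have hx' : (Algebra.TensorProduct.assoc K K K (HTree K D) (HTree K D) (HTree K D)).toAlgHom
        ((Algebra.TensorProduct.map (comulTree K) (.id K (HTree K D))) (comulTree K x)) =
      (Algebra.TensorProduct.map (.id K (HTree K D)) (comulTree K)) (comulTree K x) := hx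
  simp only [AlgHom.comp_apply, comulTree_bPlus, map_add, h1, h2, hx']
  rw [← add_assoc]
  congr 1
  simp [comulTree_bPlus, TensorProduct.add_tmul, Algebra.TensorProduct.one_def]

theorem comulTree_counit_left :
    (Algebra.TensorProduct.map (counitTree K) (.id K (HTree K D))).comp (comulTree K)
      = ((Algebra.TensorProduct.lid K (HTree K D)).symm : HTree K D →ₐ[K] K ⊗[K] HTree K D) := by
  refine HTree.algHom_ext K fun d x hx => ?_
  have h1 : ∀ y : HTree K D ⊗[K] HTree K D,
      (Algebra.TensorProduct.map (counitTree K) (.id K (HTree K D)))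
          ((bPlus K d).lTensor (HTree K D) y) =
      (bPlus K d).lTensor K ((Algebra.TensorProduct.map (counitTree K) (.id K (HTree K D))) y) := by
    intro y
    induction y using TensorProduct.induction_on with
    | zero => simp
    | add y z hy hz => simp only [map_add, hy, hz]
    | tmul y z => simp
  have hx' : (Algebra.TensorProduct.map (counitTree K) (.id K (HTree K D))) (comulTree K x) =
    1 ⊗ₜ x := hx
  simp only [AlgHom.comp_apply, comulTree_bPlus, map_add, h1, hx']
  simp [counitTree_bPlus]

theorem comulTree_counit_right :
    (Algebra.TensorProduct.map (.id K (HTree K D)) (counitTree K)).comp (comulTree K)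
      = ((Algebra.TensorProduct.rid K K (HTree K D)).symm : HTree K D →ₐ[K] HTree K D ⊗[K] K) := by
  refine HTree.algHom_ext K fun d x hx => ?_
  have h1 : ∀ y : HTree K D ⊗[K] HTree K D,
      (Algebra.TensorProduct.map (.id K (HTree K D)) (counitTree K))
          ((bPlus K d).lTensor (HTree K D) y) = 0 := by
    intro y
    induction y using TensorProduct.induction_on with
    | zero => simp
    | add y z hy hz => simp only [map_add, hy, hz, add_zero]
    | tmul y z => simp [counitTree_bPlus]
  simp only [AlgHom.comp_apply, comulTree_bPlus, map_add, h1]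
  simp

/-- `x` is homogeneous of degree `n`, i.e. it belongs to `H_D(n)`. -/
def IsHomog (x : HTree K D) (n : ℕ) : Prop := x.IsWeightedHomogeneous RTree.weight n

/-- `x` belongs to `⨁_{k ≥ n} H_D(k)`, i.e. its valuation is at least `n`. -/
def ValGE (x : HTree K D) (n : ℕ) : Prop :=
  ∀ m, MvPolynomial.coeff m x ≠ 0 → n ≤ Finsupp.weight RTree.weight m

variable {K}

theorem mon_isHomog (s : Multiset (RTree D)) : IsHomog K (mon K s) (s.map RTree.weight).sum := by
  induction s using Multiset.induction with
  | empty => exact MvPolynomial.isWeightedHomogeneous_one K _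
  | cons a s ih =>
    have := (MvPolynomial.isWeightedHomogeneous_X K RTree.weight a).mul ih
    simpa [mon, IsHomog] using this

theorem RTree.weight_graft (d : D) (s : Multiset (RTree D)) :
    (RTree.graft d s).weight = 1 + (s.map RTree.weight).sum := by
  have key : ∀ s : Multiset (RTree D), (Forest.ofTrees s).lift PForest.weight
      (fun _ _ h => h.weight_eq) = (s.map RTree.weight).sum := by
    intro s
    induction s using Multiset.induction with
    | empty => rfl
    | cons t s ih =>
      obtain ⟨d, c⟩ := t
      rw [Forest.ofTrees_cons, Multiset.map_cons, Multiset.sum_cons, ← ih]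
      generalize Forest.ofTrees s = f
      induction c using Forest.ind
      induction f using Forest.ind
      rfl
  rw [← key]
  rfl

theorem weight_toMultiset (m : RTree D →₀ ℕ) :
    ((Finsupp.toMultiset m).map RTree.weight).sum = Finsupp.weight RTree.weight m := by
  induction m using Finsupp.induction_linear with
  | zero => simp
  | add f g hf hg => simp only [map_add, Multiset.map_add, Multiset.sum_add, hf, hg]
  | single a b => simp [Finsupp.weight_single, Multiset.map_nsmul, Multiset.sum_nsmul]

theorem bPlus_isHomog (d : D) {x : HTree K D} {n : ℕ} (hx : IsHomog K x n) :
    IsHomog K (bPlus K d x) (n + 1) := by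
  classical
  rw [← x.support_sum_monomial_coeff, map_sum]
  refine (MvPolynomial.weightedHomogeneousSubmodule K RTree.weight (n + 1)).sum_mem fun m hm => ?_
  have hm' := hx (MvPolynomial.mem_support_iff.1 hm)
  have h1 : MvPolynomial.monomial m (MvPolynomial.coeff m x) =
      MvPolynomial.coeff m x • mon K (Finsupp.toMultiset m) := by
    rw [mon_eq_monomial]
    simp [MvPolynomial.smul_monomial]
  rw [h1, map_smul]
  refine Submodule.smul_mem _ _ ?_
  rw [bPlus_mon]
  have h2 := MvPolynomial.isWeightedHomogeneous_X K RTree.weight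
    (RTree.graft d (Finsupp.toMultiset m))
  have h3 : (RTree.graft d (Finsupp.toMultiset m)).weight = n + 1 := by
    rw [RTree.weight_graft, ← hm', add_comm, weight_toMultiset]
  rw [h3] at h2
  exact h2

/-- A system of combinatorial Dyson-Schwinger equations with set of vertices `I`, given by its
formal series `F_i ∈ K[[h_j, j ∈ I]]`. -/
abbrev SDSE (K : Type u) (I : Type v) : Type (max u v) := I → MvPowerSeries I K

variable {I : Type v}

theorem coeff_prod_congr (d : I →₀ ℕ) {a b : I → PowerSeries (HTree K I)} {n : ℕ}
    (h : ∀ i, ∀ m < n + 1, PowerSeries.coeff m (a i) = PowerSeries.coeff m (b i)) :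
    PowerSeries.coeff n (d.prod fun s e => a s ^ e) =
      PowerSeries.coeff n (d.prod fun s e => b s ^ e) := by
  have h1 : ∀ u v : PowerSeries (HTree K I), (∀ m < n + 1, PowerSeries.coeff m u =
      PowerSeries.coeff m v) ↔ Ideal.Quotient.mk (Ideal.span {(PowerSeries.X ^ (n + 1) :
      PowerSeries (HTree K I))}) u = Ideal.Quotient.mk _ v := by
    intro u v
    rw [Ideal.Quotient.mk_eq_mk_iff_sub_mem, Ideal.mem_span_singleton, PowerSeries.X_pow_dvd_iff]
    simp [sub_eq_zero]
  refine (h1 _ _).2 ?_ n (Nat.lt_succ_self n)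
  rw [Finsupp.prod, Finsupp.prod, map_prod, map_prod]
  refine Finset.prod_congr rfl fun i _ => ?_
  rw [map_pow, map_pow, (h1 _ _).1 (h i)]

/-- The formal series `∑ₙ x_n zⁿ` attached to an element `∑ₙ x_n` of the completion
`∏ₙ H_I(n)` of `H_I` (encoded by the sequence of its homogeneous components). -/
noncomputable def gen (x : ℕ → HTree K I) : PowerSeries (HTree K I) := PowerSeries.mk x

/-- The homogeneous component of degree `n` of `f(X_j, j ∈ I)`, for `f ∈ K[[h_j, j ∈ I]]` and
elements `X_j` without constant term of the completion of `H_I`. -/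
noncomputable def evalComponent (f : MvPowerSeries I K) (X : I → ℕ → HTree K I) (n : ℕ) :
    HTree K I :=
  PowerSeries.coeff n (MvPowerSeries.subst (fun j => gen (X j)) f : PowerSeries (HTree K I))

/-- `X` is a solution of the system: each `X_i` is an element of the completion of `H_I` (encoded by
the sequence of its homogeneous components), and `X_i = B⁺_i(F_i(X_j, j ∈ I))`. -/
structure SDSE.IsSolution (F : SDSE K I) (X : I → ℕ → HTree K I) : Prop where
  isHomog : ∀ i n, IsHomog K (X i n) n
  zero : ∀ i, X i 0 = 0
  succ : ∀ i n, X i (n + 1) = bPlus K i (evalComponent (F i) X n)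

/-- Successive approximations of the solution. -/
noncomputable def SDSE.approx (F : SDSE K I) : ℕ → I → ℕ → HTree K I
  | 0, _, _ => 0
  | _ + 1, _, 0 => 0
  | m + 1, i, n + 1 => bPlus K i (evalComponent (F i) (SDSE.approx F m) n)

theorem SDSE.approx_zero (F : SDSE K I) (m : ℕ) (i : I) : F.approx m i 0 = 0 := by
  cases m <;> rfl

variable [Finite I]

theorem hasSubst_gen {X : I → ℕ → HTree K I} (h : ∀ i, X i 0 = 0) :
    MvPowerSeries.HasSubst (fun j => (gen (X j) : MvPowerSeries Unit (HTree K I))) := by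
  refine MvPowerSeries.hasSubst_of_constantCoeff_zero fun i => ?_
  have : PowerSeries.constantCoeff (gen (X i)) = 0 := by
    rw [← PowerSeries.coeff_zero_eq_constantCoeff_apply, gen, PowerSeries.coeff_mk, h]
  exact this

theorem evalComponent_eq (f : MvPowerSeries I K) {X : I → ℕ → HTree K I} (h : ∀ i, X i 0 = 0)
    (n : ℕ) : evalComponent f X n = finsum fun d : I →₀ ℕ => MvPowerSeries.coeff d f •
      PowerSeries.coeff n (d.prod fun s e => gen (X s) ^ e) :=
  MvPowerSeries.coeff_subst (hasSubst_gen h) f _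

theorem evalComponent_congr (f : MvPowerSeries I K) {X Y : I → ℕ → HTree K I}
    (hX : ∀ i, X i 0 = 0) (hY : ∀ i, Y i 0 = 0) {n : ℕ} (h : ∀ i, ∀ m < n + 1, X i m = Y i m) :
    evalComponent f X n = evalComponent f Y n := by
  rw [evalComponent_eq f hX, evalComponent_eq f hY]
  refine finsum_congr fun d => ?_
  rw [coeff_prod_congr d (b := fun i => gen (Y i))]
  intro i m hm
  simpa [gen] using h i m hm

theorem evalComponent_isHomog (f : MvPowerSeries I K) {X : I → ℕ → HTree K I}
    (hX : ∀ i, X i 0 = 0) (h : ∀ i n, IsHomog K (X i n) n) (n : ℕ) :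
    IsHomog K (evalComponent f X n) n := by
  have hmul : ∀ u v : PowerSeries (HTree K I), (∀ n, IsHomog K (PowerSeries.coeff n u) n) →
      (∀ n, IsHomog K (PowerSeries.coeff n v) n) →
      (∀ n, IsHomog K (PowerSeries.coeff n (u * v)) n) := by
    intro u v hu hv n
    rw [PowerSeries.coeff_mul]
    refine (MvPolynomial.weightedHomogeneousSubmodule K RTree.weight n).sum_mem fun p hp => ?_
    have := (hu p.1).mul (hv p.2)
    rwa [Finset.HasAntidiagonal.mem_antidiagonal.1 hp] at this
  have hone : ∀ n, IsHomog K (PowerSeries.coeff n (1 : PowerSeries (HTree K I))) n := by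
    intro n
    rw [PowerSeries.coeff_one]
    split_ifs with h0
    · rw [h0]; exact MvPolynomial.isWeightedHomogeneous_one K _
    · exact MvPolynomial.isWeightedHomogeneous_zero K _ _
  rw [evalComponent_eq f hX]
  refine finsum_induction (p := fun x => IsHomog K x n)
    (MvPolynomial.isWeightedHomogeneous_zero K _ _)
    (fun x y hx hy => (MvPolynomial.weightedHomogeneousSubmodule K RTree.weight n).add_mem hx hy) ?_
  intro d
  refine (MvPolynomial.weightedHomogeneousSubmodule K RTree.weight n).smul_mem _ ?_
  refine Finset.prod_induction (M := PowerSeries (HTree K I)) _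
    (fun u => ∀ n, IsHomog K (PowerSeries.coeff n u) n) hmul hone ?_ n
  intro i _
  induction d i with
  | zero => simpa using hone
  | succ k ih =>
    change ∀ n, IsHomog K (PowerSeries.coeff n (gen (X i) ^ (k + 1))) n
    rw [pow_succ]
    refine hmul _ _ ih fun n => ?_
    simpa [gen] using h i n

theorem SDSE.approx_isHomog (F : SDSE K I) (m : ℕ) (i : I) (n : ℕ) :
    IsHomog K (F.approx m i n) n := by
  induction m generalizing i n with
  | zero => exact MvPolynomial.isWeightedHomogeneous_zero K _ _
  | succ m ih =>
    cases n with
    | zero => exact MvPolynomial.isWeightedHomogeneous_zero K _ _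
    | succ n => exact bPlus_isHomog i (evalComponent_isHomog _ (F.approx_zero m) ih n)

theorem SDSE.approx_stable (F : SDSE K I) (n : ℕ) : ∀ (m m' : ℕ) (i : I), n ≤ m → n ≤ m' →
    F.approx m i n = F.approx m' i n := by
  induction n using Nat.strong_induction_on with
  | _ n ih =>
    intro m m' i hm hm'
    cases n with
    | zero => rw [F.approx_zero, F.approx_zero]
    | succ n =>
      obtain ⟨m, rfl⟩ := Nat.exists_eq_succ_of_ne_zero (by omega : m ≠ 0)
      obtain ⟨m', rfl⟩ := Nat.exists_eq_succ_of_ne_zero (by omega : m' ≠ 0)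
      change bPlus K i _ = bPlus K i _
      rw [evalComponent_congr (F i) (F.approx_zero m) (F.approx_zero m')]
      intro j k hk
      exact ih k (by omega) m m' j (by omega) (by omega)

/-- A system has a unique solution. -/
theorem SDSE.existsUnique_isSolution (F : SDSE K I) : ∃! X, F.IsSolution X := by
  refine ⟨fun i n => F.approx n i n, ⟨fun i n => F.approx_isHomog n i n, fun i => rfl, ?_⟩, ?_⟩
  · intro i n
    change bPlus K i _ = bPlus K i _
    rw [evalComponent_congr (F i) (F.approx_zero n) (Y := fun i n => F.approx n i n)
      (fun i => F.approx_zero 0 i)]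
    intro j k hk
    exact F.approx_stable k _ _ j (by omega) le_rfl
  · intro Y hY
    have key : ∀ n i, Y i n = F.approx n i n := by
      intro n
      induction n using Nat.strong_induction_on with
      | _ n ih =>
        intro i
        cases n with
        | zero => exact hY.zero i
        | succ n =>
          rw [hY.succ]
          change bPlus K i _ = bPlus K i _
          rw [evalComponent_congr (F i) hY.zero (F.approx_zero n)]
          intro j k hk
          rw [ih k (by omega)]
          exact F.approx_stable k _ _ j le_rfl (by omega)
    funext i n
    exact key n i

/-- The solution of a system: `F.sol i n` is the homogeneous component `X_i(n)`. -/
noncomputable def SDSE.sol (F : SDSE K I) : I → ℕ → HTree K I := F.existsUnique_isSolution.choose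

theorem SDSE.isSolution_sol (F : SDSE K I) : F.IsSolution F.sol :=
  F.existsUnique_isSolution.choose_spec.1

/-- The subalgebra `H_(S)` of `H_I` generated by the homogeneous components of the solution. -/
noncomputable def SDSE.subalg (F : SDSE K I) : Subalgebra K (HTree K I) :=
  Algebra.adjoin K {x | ∃ i n, x = F.sol i n}

/-- The span of the `P ⊗ R`, for forests `P`, `R` of total weight `n`. -/
noncomputable def tensorDeg (K : Type u) [Field K] (D : Type v) (n : ℕ) :
    Submodule K (HTree K D ⊗[K] HTree K D) :=
  Submodule.span K {z | ∃ p r : Multiset (RTree D), (p.map RTree.weight).sum +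
    (r.map RTree.weight).sum = n ∧ z = mon K p ⊗ₜ mon K r}

theorem tensorDeg_mul {n m : ℕ} {a b : HTree K D ⊗[K] HTree K D} (ha : a ∈ tensorDeg K D n)
    (hb : b ∈ tensorDeg K D m) : a * b ∈ tensorDeg K D (n + m) := by
  have h := Submodule.mul_mem_mul ha hb
  rw [tensorDeg, tensorDeg, Submodule.span_mul_span] at h
  refine Submodule.span_mono ?_ h
  rintro _ ⟨_, ⟨p, r, h1, rfl⟩, _, ⟨p', r', h2, rfl⟩, rfl⟩
  refine ⟨p + p', r + r', ?_, ?_⟩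
  · simp only [Multiset.map_add, Multiset.sum_add]
    omega
  · simp only [Algebra.TensorProduct.tmul_mul_tmul, mon_add]

theorem tensorDeg_bPlus (d : D) {n : ℕ} {a : HTree K D ⊗[K] HTree K D}
    (ha : a ∈ tensorDeg K D n) :
    (bPlus K d).lTensor (HTree K D) a ∈ tensorDeg K D (n + 1) := by
  induction ha using Submodule.span_induction with
  | mem z h =>
    obtain ⟨p, r, h, rfl⟩ := h
    refine Submodule.subset_span ⟨p, {RTree.graft d r}, ?_, ?_⟩
    · simp only [Multiset.map_singleton, Multiset.sum_singleton, RTree.weight_graft]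
      omega
    · rw [LinearMap.lTensor_tmul, bPlus_mon]
      simp [mon]
  | zero => simp
  | add y z _ _ hy hz => rw [map_add]; exact add_mem hy hz
  | smul c y _ hy => rw [map_smul]; exact Submodule.smul_mem _ _ hy

theorem comulTree_mon_mem (s₀ : Multiset (RTree D)) :
    comulTree K (mon K s₀) ∈ tensorDeg K D (s₀.map RTree.weight).sum := by
  have hone : comulTree K (mon K (0 : Multiset (RTree D))) ∈ tensorDeg K D 0 :=
    Submodule.subset_span ⟨0, 0, by simp, by simp [mon, Algebra.TensorProduct.one_def]⟩
  have hforest : ∀ s : Multiset (RTree D),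
      (∀ t ∈ s, comulTree K (MvPolynomial.X t) ∈ tensorDeg K D t.weight) →
      comulTree K (mon K s) ∈ tensorDeg K D (s.map RTree.weight).sum := by
    intro s hs
    induction s using Multiset.induction with
    | empty => simpa using hone
    | cons t s ih =>
      have h1 : mon K (t ::ₘ s) = MvPolynomial.X t * mon K s := by simp [mon]
      rw [h1, map_mul, Multiset.map_cons, Multiset.sum_cons]
      exact tensorDeg_mul (hs t (Multiset.mem_cons_self _ _))
        (ih fun t' h' => hs t' (Multiset.mem_cons_of_mem h'))
  refine hforest s₀ fun t ht => ?_
  clear ht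
  induction t using RTree.induction with
  | h d s hs =>
    rw [← bPlus_mon, comulTree_bPlus, RTree.weight_graft, bPlus_mon]
    refine add_mem (Submodule.subset_span ⟨{RTree.graft d s}, 0, ?_, ?_⟩) ?_
    · simp [RTree.weight_graft]
    · simp [mon]
    · rw [add_comm]
      exact tensorDeg_bPlus d (hforest s hs)

/-- `H_(S)` is a Hopf subalgebra of `H_I`, i.e. `Δ(H_(S)) ⊆ H_(S) ⊗ H_(S)`. (As `H_(S)` is graded
and connected, it is then automatically stable under the antipode.) -/
def SDSE.IsHopf (F : SDSE K I) : Prop :=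
  ∀ x ∈ F.subalg, comulTree K x ∈
    LinearMap.range (TensorProduct.map F.subalg.val.toLinearMap F.subalg.val.toLinearMap)

/-- The bialgebra `H_(S)` of a Hopf system. -/
def SDSE.HS (F : SDSE K I) (_ : F.IsHopf) : Type (max u v) := F.subalg

namespace SDSE

variable (F : SDSE K I) (hF : F.IsHopf)

noncomputable instance : CommRing (F.HS hF) := inferInstanceAs (CommRing F.subalg)

noncomputable instance : Algebra K (F.HS hF) := inferInstanceAs (Algebra K F.subalg)

/-- The inclusion of `H_(S)` in `H_I`. -/
noncomputable def incl : F.HS hF →ₐ[K] HTree K I := F.subalg.val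

theorem incl_injective : Function.Injective (F.incl hF) := Subtype.val_injective

/-- The inclusion of `H_(S) ⊗ H_(S)` in `H_I ⊗ H_I`. -/
noncomputable def incl2 : F.HS hF ⊗[K] F.HS hF →ₐ[K] HTree K I ⊗[K] HTree K I :=
  Algebra.TensorProduct.map (F.incl hF) (F.incl hF)

theorem incl2_injective : Function.Injective (F.incl2 hF) :=
  TensorProduct.map_injective_of_flat_flat _ _ (F.incl_injective hF) (F.incl_injective hF)

theorem comul_mem_range (x : F.HS hF) :
    ((comulTree K).comp (F.incl hF)) x ∈ (F.incl2 hF).range := by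
  obtain ⟨y, hy⟩ := hF x.1 x.2
  exact ⟨y, hy⟩

/-- The coproduct of `H_(S)`: the restriction of the coproduct of `H_I`. -/
noncomputable def comulHS : F.HS hF →ₐ[K] F.HS hF ⊗[K] F.HS hF :=
  ((AlgEquiv.ofInjective (F.incl2 hF) (F.incl2_injective hF)).symm :
    (F.incl2 hF).range →ₐ[K] F.HS hF ⊗[K] F.HS hF).comp
    (((comulTree K).comp (F.incl hF)).codRestrict (F.incl2 hF).range (F.comul_mem_range hF))

theorem incl2_comulHS (x : F.HS hF) :
    F.incl2 hF (F.comulHS hF x) = comulTree K (F.incl hF x) := by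
  have := AlgEquiv.apply_symm_apply (AlgEquiv.ofInjective (F.incl2 hF) (F.incl2_injective hF))
    (((comulTree K).comp (F.incl hF)).codRestrict (F.incl2 hF).range (F.comul_mem_range hF) x)
  exact congrArg Subtype.val this

/-- The counit of `H_(S)`. -/
noncomputable def counitHS : F.HS hF →ₐ[K] K := (counitTree K).comp (F.incl hF)

theorem comulHS_coassoc :
    (Algebra.TensorProduct.assoc K K K (F.HS hF) (F.HS hF) (F.HS hF)).toAlgHom.comp
      ((Algebra.TensorProduct.map (F.comulHS hF) (.id K (F.HS hF))).comp (F.comulHS hF))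
      = (Algebra.TensorProduct.map (.id K (F.HS hF)) (F.comulHS hF)).comp (F.comulHS hF) := by
  set i := F.incl hF with hi
  have hinj : Function.Injective (Algebra.TensorProduct.map i (F.incl2 hF)) :=
    TensorProduct.map_injective_of_flat_flat i.toLinearMap (F.incl2 hF).toLinearMap
      (F.incl_injective hF) (F.incl2_injective hF)
  refine AlgHom.ext fun x => hinj ?_
  have h1 : ∀ y : F.HS hF ⊗[K] F.HS hF,
      Algebra.TensorProduct.map i (F.incl2 hF)
        ((Algebra.TensorProduct.assoc K K K (F.HS hF) (F.HS hF) (F.HS hF)).toAlgHom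
        ((Algebra.TensorProduct.map (F.comulHS hF) (.id K (F.HS hF))) y)) =
      (Algebra.TensorProduct.assoc K K K (HTree K I) (HTree K I) (HTree K I)).toAlgHom
        ((Algebra.TensorProduct.map (comulTree K) (.id K (HTree K I))) (F.incl2 hF y)) := by
    intro y
    induction y using TensorProduct.induction_on with
    | zero => simp
    | add y z hy hz => simp only [map_add, hy, hz]
    | tmul y z =>
      have h2 : F.incl2 hF (y ⊗ₜ z) = i y ⊗ₜ i z := rfl
      rw [h2, Algebra.TensorProduct.map_tmul, Algebra.TensorProduct.map_tmul, ← incl2_comulHS]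
      generalize F.comulHS hF y = w
      induction w using TensorProduct.induction_on with
      | zero => simp
      | add y z hy hz => simp only [map_add, TensorProduct.add_tmul, hy, hz]
      | tmul y z => rfl
  have h3 : ∀ y : F.HS hF ⊗[K] F.HS hF,
      Algebra.TensorProduct.map i (F.incl2 hF)
        ((Algebra.TensorProduct.map (.id K (F.HS hF)) (F.comulHS hF)) y) =
      (Algebra.TensorProduct.map (.id K (HTree K I)) (comulTree K)) (F.incl2 hF y) := by
    intro y
    induction y using TensorProduct.induction_on with
    | zero => simp
    | add y z hy hz => simp only [map_add, hy, hz]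
    | tmul y z =>
      have h2 : F.incl2 hF (y ⊗ₜ z) = i y ⊗ₜ i z := rfl
      rw [h2, Algebra.TensorProduct.map_tmul, Algebra.TensorProduct.map_tmul,
        Algebra.TensorProduct.map_tmul, incl2_comulHS]
      rfl
  have h4 := DFunLike.congr_fun (comulTree_coassoc (D := I) K) (i x)
  simp only [AlgHom.comp_apply] at h4 ⊢
  rw [h1, h3, incl2_comulHS]
  exact h4

theorem comulHS_counit_left :
    (Algebra.TensorProduct.map (F.counitHS hF) (.id K (F.HS hF))).comp (F.comulHS hF)
      = ((Algebra.TensorProduct.lid K (F.HS hF)).symm : F.HS hF →ₐ[K] K ⊗[K] F.HS hF) := by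
  have hinj : Function.Injective (Algebra.TensorProduct.map (.id K K) (F.incl hF)) :=
    TensorProduct.map_injective_of_flat_flat LinearMap.id (F.incl hF).toLinearMap
      Function.injective_id (F.incl_injective hF)
  refine AlgHom.ext fun x => hinj ?_
  have h1 : ∀ y : F.HS hF ⊗[K] F.HS hF, Algebra.TensorProduct.map (.id K K) (F.incl hF)
      (Algebra.TensorProduct.map (F.counitHS hF) (.id K (F.HS hF)) y) =
      Algebra.TensorProduct.map (counitTree K) (.id K (HTree K I)) (F.incl2 hF y) := by
    intro y
    induction y using TensorProduct.induction_on with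
    | zero => simp
    | add y z hy hz => simp only [map_add, hy, hz]
    | tmul y z => rfl
  have h4 := DFunLike.congr_fun (comulTree_counit_left (D := I) K) (F.incl hF x)
  simp only [AlgHom.comp_apply] at h4 ⊢
  rw [h1, incl2_comulHS, h4]
  rfl

theorem comulHS_counit_right :
    (Algebra.TensorProduct.map (.id K (F.HS hF)) (F.counitHS hF)).comp (F.comulHS hF)
      = ((Algebra.TensorProduct.rid K K (F.HS hF)).symm : F.HS hF →ₐ[K] F.HS hF ⊗[K] K) := by
  have hinj : Function.Injective (Algebra.TensorProduct.map (F.incl hF) (.id K K)) :=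
    TensorProduct.map_injective_of_flat_flat (F.incl hF).toLinearMap LinearMap.id
      (F.incl_injective hF) Function.injective_id
  refine AlgHom.ext fun x => hinj ?_
  have h1 : ∀ y : F.HS hF ⊗[K] F.HS hF, Algebra.TensorProduct.map (F.incl hF) (.id K K)
      (Algebra.TensorProduct.map (.id K (F.HS hF)) (F.counitHS hF) y) =
      Algebra.TensorProduct.map (.id K (HTree K I)) (counitTree K) (F.incl2 hF y) := by
    intro y
    induction y using TensorProduct.induction_on with
    | zero => simp
    | add y z hy hz => simp only [map_add, hy, hz]
    | tmul y z => rfl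
  have h4 := DFunLike.congr_fun (comulTree_counit_right (D := I) K) (F.incl hF x)
  simp only [AlgHom.comp_apply] at h4 ⊢
  rw [h1, incl2_comulHS, h4]
  rfl

noncomputable instance : Bialgebra K (F.HS hF) :=
  Bialgebra.ofAlgHom (F.comulHS hF) (F.counitHS hF) (F.comulHS_coassoc hF)
    (F.comulHS_counit_left hF) (F.comulHS_counit_right hF)

/-- The dual algebra of the coalgebra `H_(S)`, with the convolution product
`(f g)(x) = (f ⊗ g) (Δ(x))`. -/
abbrev Dual : Type (max u v) := WithConv (F.HS hF →ₗ[K] K)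

/-- The bracket of the dual algebra: `⁅f, g⁆ = f g - g f`. -/
noncomputable instance : LieRing (F.Dual hF) := LieRing.ofAssociativeRing

noncomputable instance : LieAlgebra K (F.Dual hF) := LieAlgebra.ofAssociativeAlgebra

/-- `f` belongs to the graded dual `⨁ₙ H_(S)(n)^*`: it vanishes on the elements of `H_(S)` of large
valuation. -/
def InGradedDual (f : F.Dual hF) : Prop :=
  ∃ n, ∀ x : F.HS hF, ValGE K (F.incl hF x) n → f x = 0

/-- `f` is primitive for the coproduct of `H_(S)^*` dual to the product of `H_(S)`:
`f(xy) = (f ⊗ ε + ε ⊗ f)(x ⊗ y)`. -/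
def IsPrim (f : F.Dual hF) : Prop :=
  ∀ x y : F.HS hF, f (x * y) =
    f x * Coalgebra.counit (R := K) y + Coalgebra.counit (R := K) x * f y

theorem mul_apply (f g : F.Dual hF) (x : F.HS hF) : (f * g) x =
    LinearMap.mul' K K (TensorProduct.map f.ofConv g.ofConv (F.comulHS hF x)) := rfl

theorem IsPrim.lie {f g : F.Dual hF} (hf : F.IsPrim hF f) (hg : F.IsPrim hF g) :
    F.IsPrim hF ⁅f, g⁆ := by
  have key : ∀ f g : F.Dual hF, F.IsPrim hF f → F.IsPrim hF g →
      ∀ a b : F.HS hF ⊗[K] F.HS hF,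
      LinearMap.mul' K K (TensorProduct.map f.ofConv g.ofConv (a * b)) =
      LinearMap.mul' K K (TensorProduct.map f.ofConv g.ofConv a) *
        LinearMap.mul' K K (TensorProduct.map (F.counitHS hF).toLinearMap
          (F.counitHS hF).toLinearMap b) +
      LinearMap.mul' K K (TensorProduct.map f.ofConv (F.counitHS hF).toLinearMap a) *
        LinearMap.mul' K K (TensorProduct.map (F.counitHS hF).toLinearMap g.ofConv b) +
      LinearMap.mul' K K (TensorProduct.map (F.counitHS hF).toLinearMap g.ofConv a) *
        LinearMap.mul' K K (TensorProduct.map f.ofConv (F.counitHS hF).toLinearMap b) +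
      LinearMap.mul' K K (TensorProduct.map (F.counitHS hF).toLinearMap
          (F.counitHS hF).toLinearMap a) *
        LinearMap.mul' K K (TensorProduct.map f.ofConv g.ofConv b) := by
    intro f g hf hg a b
    induction a using TensorProduct.induction_on with
    | zero => simp
    | add y z hy hz => simp only [map_add, add_mul, hy, hz]; ring
    | tmul y z =>
      induction b using TensorProduct.induction_on with
      | zero => simp
      | add u v hu hv => simp only [map_add, mul_add, hu, hv]; ring
      | tmul u v =>
        have h1 : f.ofConv (y * u) = f.ofConv y * F.counitHS hF u + F.counitHS hF y * f.ofConv u :=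
          hf y u
        have h2 : g.ofConv (z * v) = g.ofConv z * F.counitHS hF v + F.counitHS hF z * g.ofConv v :=
          hg z v
        simp only [Algebra.TensorProduct.tmul_mul_tmul, TensorProduct.map_tmul,
          LinearMap.mul'_apply, AlgHom.toLinearMap_apply, h1, h2]
        ring
  have hε : ∀ x : F.HS hF, LinearMap.mul' K K (TensorProduct.map (F.counitHS hF).toLinearMap
      (F.counitHS hF).toLinearMap (F.comulHS hF x)) = F.counitHS hF x := by
    intro x
    exact congrArg (fun h : F.Dual hF => h x) (one_mul (1 : F.Dual hF))
  have hl : ∀ (h : F.Dual hF) (x : F.HS hF), LinearMap.mul' K K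
      (TensorProduct.map (F.counitHS hF).toLinearMap h.ofConv (F.comulHS hF x)) = h x := by
    intro h x
    exact congrArg (fun h : F.Dual hF => h x) (one_mul h)
  have hr : ∀ (h : F.Dual hF) (x : F.HS hF), LinearMap.mul' K K
      (TensorProduct.map h.ofConv (F.counitHS hF).toLinearMap (F.comulHS hF x)) = h x := by
    intro h x
    exact congrArg (fun h : F.Dual hF => h x) (mul_one h)
  intro x y
  have h3 : ∀ z, ⁅f, g⁆ z = (f * g) z - (g * f) z := fun _ => rfl
  have h4 : ∀ z, Coalgebra.counit (R := K) z = F.counitHS hF z := fun _ => rfl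
  rw [h3, h3, h3, mul_apply, mul_apply, map_mul, key f g hf hg, key g f hg hf]
  simp only [hε, hl, hr, h4, ← mul_apply]
  ring

theorem exists_extension {f : F.Dual hF} {n : ℕ}
    (hf : ∀ x : F.HS hF, ValGE K (F.incl hF x) n → f x = 0) :
    ∃ f' : HTree K I →ₗ[K] K, (∀ x, ValGE K x n → f' x = 0) ∧ f'.comp (F.incl hF).toLinearMap
      = f.ofConv := by
  let V : Submodule K (HTree K I) :=
    { carrier := {x | ValGE K x n}
      add_mem' := by
        intro x y hx hy m hm
        by_contra hlt
        have h1 : MvPolynomial.coeff m x = 0 := by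
          by_contra h; exact hlt (hx m h)
        have h2 : MvPolynomial.coeff m y = 0 := by
          by_contra h; exact hlt (hy m h)
        exact hm (by rw [MvPolynomial.coeff_add, h1, h2, add_zero])
      zero_mem' := fun m hm => absurd (MvPolynomial.coeff_zero m) hm
      smul_mem' := by
        intro c x hx m hm
        refine hx m fun h => hm ?_
        rw [MvPolynomial.coeff_smul, h, smul_zero] }
  have h1 : f.ofConv ∈ (V.mkQ.comp (F.incl hF).toLinearMap).ker.dualAnnihilator := by
    rw [Submodule.mem_dualAnnihilator]
    intro x hx
    refine hf x ?_
    have : V.mkQ (F.incl hF x) = 0 := hx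
    rwa [Submodule.mkQ_apply, Submodule.Quotient.mk_eq_zero] at this
  rw [← LinearMap.range_dualMap_eq_dualAnnihilator_ker] at h1
  obtain ⟨φ, hφ⟩ := h1
  refine ⟨φ.comp V.mkQ, fun x hx => ?_, hφ⟩
  have : V.mkQ x = 0 := by
    rw [Submodule.mkQ_apply, Submodule.Quotient.mk_eq_zero]; exact hx
  rw [LinearMap.comp_apply, this, map_zero]

theorem InGradedDual.mul {f g : F.Dual hF} (hf : F.InGradedDual hF f) (hg : F.InGradedDual hF g) :
    F.InGradedDual hF (f * g) := by
  obtain ⟨n, hf⟩ := hf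
  obtain ⟨m, hg⟩ := hg
  obtain ⟨f', hf', hff⟩ := exists_extension F hF hf
  obtain ⟨g', hg', hgg⟩ := exists_extension F hF hg
  refine ⟨n + m, fun x hx => ?_⟩
  rw [mul_apply, ← hff, ← hgg, TensorProduct.map_comp]
  change LinearMap.mul' K K (TensorProduct.map f' g' (F.incl2 hF (F.comulHS hF x))) = 0
  rw [incl2_comulHS]
  generalize F.incl hF x = y at hx ⊢
  have key : ∀ s : Multiset (RTree I), n + m ≤ (s.map RTree.weight).sum →
      LinearMap.mul' K K (TensorProduct.map f' g' (comulTree K (mon K s))) = 0 := by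
    intro s hs
    have hval : ∀ t : Multiset (RTree I), ValGE K (mon K t) (t.map RTree.weight).sum := by
      intro t d hd
      exact (mon_isHomog t hd).ge
    have h1 := comulTree_mon_mem (K := K) s
    generalize comulTree K (mon K s) = z at h1
    induction h1 using Submodule.span_induction with
    | mem z h =>
      obtain ⟨p, r, hpr, rfl⟩ := h
      rw [TensorProduct.map_tmul, LinearMap.mul'_apply]
      rcases (by omega : n ≤ (p.map RTree.weight).sum ∨ m ≤ (r.map RTree.weight).sum) with h | h
      · rw [hf' _ fun d hd => h.trans (hval p d hd), zero_mul]
      · rw [hg' _ fun d hd => h.trans (hval r d hd), mul_zero]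
    | zero => simp
    | add y z _ _ hy hz => simp only [map_add, hy, hz, add_zero]
    | smul a y _ hy => simp only [map_smul, hy, smul_zero]
  classical
  rw [← y.support_sum_monomial_coeff, map_sum, map_sum, map_sum]
  refine Finset.sum_eq_zero fun d hd => ?_
  have h1 : MvPolynomial.monomial d (MvPolynomial.coeff d y) =
      MvPolynomial.coeff d y • mon K (Finsupp.toMultiset d) := by
    rw [mon_eq_monomial]
    simp [MvPolynomial.smul_monomial]
  rw [h1, map_smul, map_smul, map_smul, key, smul_zero]
  rw [weight_toMultiset]
  exact hx d (MvPolynomial.mem_support_iff.1 hd)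

/-- The Lie algebra `𝔤_(S) = Prim(H_(S)^*)` of the primitive elements of the graded dual of
`H_(S)`. -/
noncomputable def lieAlg : LieSubalgebra K (F.Dual hF) where
  carrier := {f | F.IsPrim hF f ∧ F.InGradedDual hF f}
  add_mem' := by
    rintro f g ⟨hf, n, hn⟩ ⟨hg, m, hm⟩
    refine ⟨fun x y => ?_, max n m, fun x hx => ?_⟩
    · have h1 := hf x y
      have h2 := hg x y
      have h3 : ∀ z, (f + g) z = f z + g z := fun _ => rfl
      rw [h3, h3, h3, h1, h2]; ring
    · have h3 : (f + g) x = f x + g x := rfl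
      rw [h3, hn x (fun k hk => (le_max_left _ _).trans (hx k hk)),
        hm x (fun k hk => (le_max_right _ _).trans (hx k hk)), add_zero]
  zero_mem' := ⟨fun x y => by simp, 0, fun x _ => rfl⟩
  smul_mem' := by
    rintro c f ⟨hf, n, hn⟩
    have h3 : ∀ z, (c • f) z = c * f z := fun _ => rfl
    refine ⟨fun x y => ?_, n, fun x hx => ?_⟩
    · rw [h3, h3, h3, hf x y]; ring
    · rw [h3, hn x hx, mul_zero]
  lie_mem' := by
    rintro f g ⟨hf, hf'⟩ ⟨hg, hg'⟩
    refine ⟨IsPrim.lie F hF hf hg, ?_⟩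
    obtain ⟨n, hn⟩ := InGradedDual.mul F hF hf' hg'
    obtain ⟨m, hm⟩ := InGradedDual.mul F hF hg' hf'
    refine ⟨max n m, fun x hx => ?_⟩
    have h3 : ⁅f, g⁆ x = (f * g) x - (g * f) x := rfl
    rw [h3, hn x (fun k hk => (le_max_left _ _).trans (hx k hk)),
        hm x (fun k hk => (le_max_right _ _).trans (hx k hk)), sub_zero]

end SDSE

end HopfAlgebra

section Systems

variable {K : Type u} [Field K] {I : Type v}

namespace SDSE

/-- The standing assumptions on a system: no `F_i` is constant, and `F_i(0) = 1`. -/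
def IsSDSE (F : SDSE K I) : Prop :=
  ∀ i, MvPowerSeries.constantCoeff (F i) = 1 ∧
    F i ≠ MvPowerSeries.C (MvPowerSeries.constantCoeff (F i))

/-- The oriented graph of the system: there is an edge from `i` to `j` if `F_i` depends on `h_j`. -/
def Edge (F : SDSE K I) (i j : I) : Prop := MvPowerSeries.pderiv K j (F i) ≠ 0

/-- The descendants of `i`: the ends of the oriented paths of length at least `1` from `i`. -/
def descendants (F : SDSE K I) (i : I) : Set I := {j | Relation.TransGen F.Edge i j}

/-- The restriction of a system to a set `B` of vertices: the variables `h_j`, `j ∉ B`, are sent to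
`0` in the `F_i`, `i ∈ B`. -/
noncomputable def restrict (F : SDSE K I) (B : Set I) : SDSE K B := fun i =>
  MvPowerSeries.killCompl (Function.Embedding.subtype (· ∈ B)) (F i)

/-- `F` is the extension, by the vertex `x`, of its restriction to the other vertices: `F_i` does
not depend on `h_x` for `i ≠ x`, and `F_x = 1 + ∑_{i ≠ x} a_i h_i`, with `F_i = F_j` whenever `a_i`
and `a_j` are nonzero. -/
def IsExtensionAt [Fintype I] (F : SDSE K I) (x : I) : Prop :=
  (∀ i, i ≠ x → ¬ F.Edge i x) ∧
    ∃ a : I → K, a x = 0 ∧ F x = 1 + ∑ i, a i • MvPowerSeries.X i ∧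
      ∀ i j, a i ≠ 0 → a j ≠ 0 → F i = F j

open scoped Classical in
/-- `i` is an extension vertex: if `J` is the set of its descendants, then the restriction of the
system to `J ∪ {i}` is an extension by `i` of the restriction to `J`. -/
def IsExtensionVertex [Fintype I] (F : SDSE K I) (i : I) : Prop :=
  IsExtensionAt (F.restrict (insert i (F.descendants i))) ⟨i, Set.mem_insert _ _⟩

/-- `F` is the dilatation of `G` given by the partition of `I` in the fibres of `π : I → J`:
`F_x = G_{π(x)}(∑_{y ∈ π⁻¹(j)} h_y, j ∈ J)`. -/
def IsDilatation [Fintype I] {J : Type*} [DecidableEq J] (π : I → J) (G : SDSE K J)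
    (F : SDSE K I) : Prop :=
  Function.Surjective π ∧ ∀ x, F x = MvPowerSeries.subst
    (fun j => ∑ y, if π y = j then (MvPowerSeries.X y : MvPowerSeries I K) else 0) (G (π x))

/-- `F` is obtained from `G` by a change of variables: `F_i = μ_i G_i(λ_j h_j, j ∈ I)`, for nonzero
scalars `λ_j` and `μ_i`. -/
def IsChangeOfVariables (G F : SDSE K I) : Prop :=
  ∃ l m : I → K, (∀ i, l i ≠ 0 ∧ m i ≠ 0) ∧ ∀ i, F i = m i • MvPowerSeries.rescale l (G i)

end SDSE

section Fundamental

variable {J : Type*}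

/-- The formal series `f_β(c h_j)`, where
`f_β(h) = ∑_k (1 + β)(1 + 2 β) ⋯ (1 + (k - 1) β) / k! h^k`. -/
noncomputable def fSeries (β c : K) (j : J) : MvPowerSeries J K :=
  PowerSeries.subst (c • MvPowerSeries.X j : MvPowerSeries J K)
    (PowerSeries.mk fun k => (∏ m ∈ Finset.range k, (1 + m * β)) / (k.factorial : K))

/-- The formal series `-(1 / β) ln(1 - β h_j) = ∑_{k ≥ 1} β^{k - 1} / k h_j^k` (which is `h_j` if
`β = 0`). -/
noncomputable def lnSeries (β : K) (j : J) : MvPowerSeries J K :=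
  PowerSeries.subst (MvPowerSeries.X j : MvPowerSeries J K)
    (PowerSeries.mk fun k => if k = 0 then 0 else β ^ (k - 1) / (k : K))

/-- The five parts of the partition of the vertices of a fundamental system. -/
inductive VertexKind : Type
  | I0 | J0 | K0 | I1 | J1

/-- The combinatorial data and the parameters of a fundamental system (before dilatation and change
of variables); only the values on the relevant parts of the partition matter: `β j` for `j ∈ I₀`,
`ν i` for `i ∈ I₁ ∪ J₁`, `a i j = a_j^{(i)}` for `i ∈ I₁` and `j ∈ I₀ ∪ J₀ ∪ K₀` or `i ∈ J₁` and
`j ∈ I₁`, and `b i j = b_j^{(i)}` for `i ∈ J₁` and `j ∈ I₀ ∪ J₀ ∪ K₀`. -/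
structure FundamentalData (K : Type*) (J : Type*) where
  /-- The partition `J = I₀ ∪ J₀ ∪ K₀ ∪ I₁ ∪ J₁` of the set of vertices. -/
  kind : J → VertexKind
  /-- The scalars `β_j`. -/
  β : J → K
  /-- The scalars `ν_i`. -/
  ν : J → K
  /-- The scalars `a_j^{(i)}`. -/
  a : J → J → K
  /-- The scalars `b_j^{(i)}`. -/
  b : J → J → K

namespace FundamentalData

variable [Fintype J] [DecidableEq J] (D : FundamentalData K J)

/-- The formal series of the system, vertex by vertex. By convention, `f_{β / λ}(λ h)` is `1` if
`λ = 0` (this is also what `fSeries (β / 0) 0` evaluates to). -/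
noncomputable def series : SDSE K J := fun i =>
  match D.kind i with
  | .I0 => ∏ j, match D.kind j with
    | .I0 => if j = i then fSeries (D.β i) 1 i
        else fSeries (D.β j / (1 + D.β j)) (1 + D.β j) j
    | .J0 => fSeries 1 1 j
    | _ => 1
  | .J0 => ∏ j, match D.kind j with
    | .I0 => fSeries (D.β j / (1 + D.β j)) (1 + D.β j) j
    | .J0 => if j = i then 1 else fSeries 1 1 j
    | _ => 1
  | .K0 => ∏ j, match D.kind j with
    | .I0 => fSeries (D.β j / (1 + D.β j)) (1 + D.β j) j
    | .J0 => fSeries 1 1 j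
    | _ => 1
  | .I1 =>
    open scoped Classical in
    if D.ν i ≠ 0 then
      (D.ν i)⁻¹ • (∏ j, match D.kind j with
        | .I0 => fSeries (D.β j / (D.ν i * D.a i j)) (D.ν i * D.a i j) j
        | .J0 => fSeries (1 / (D.ν i * D.a i j)) (D.ν i * D.a i j) j
        | .K0 => fSeries 0 (D.ν i * D.a i j) j
        | _ => 1) + MvPowerSeries.C (1 - (D.ν i)⁻¹)
    else
      (∑ j, match D.kind j with
        | .I0 => D.a i j • lnSeries (D.β j) j
        | .J0 => D.a i j • lnSeries 1 j
        | .K0 => D.a i j • MvPowerSeries.X j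
        | _ => 0) + 1
  | .J1 =>
      (D.ν i)⁻¹ • (∏ j, match D.kind j with
        | .I0 => fSeries (D.β j / (D.b i j - 1 - D.β j)) (D.b i j - 1 - D.β j) j
        | .J0 => fSeries (1 / (D.b i j - 1)) (D.b i j - 1) j
        | .K0 => fSeries 0 (D.b i j) j
        | _ => 1) +
      (∑ j, match D.kind j with
        | .I1 => D.a i j • MvPowerSeries.X j
        | _ => 0) + MvPowerSeries.C (1 - (D.ν i)⁻¹)

/-- The conditions on the parameters of a fundamental system. -/
structure Valid : Prop where
  /-- `I₀ ∪ J₀` is not empty. -/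
  nonempty : ∃ j, D.kind j = .I0 ∨ D.kind j = .J0
  /-- The condition on the parameters of the vertices of `I₁`. -/
  cond_I1 : ∀ i, D.kind i = .I1 → D.ν i ≠ 1 ∨ (∃ j, D.kind j = .I0 ∧ D.a i j ≠ 1 + D.β j) ∨
    (∃ j, D.kind j = .J0 ∧ D.a i j ≠ 1) ∨ (∃ j, D.kind j = .K0 ∧ D.a i j ≠ 0)
  /-- `ν_i ≠ 0` for `i ∈ J₁`. -/
  ν_ne_zero : ∀ i, D.kind i = .J1 → D.ν i ≠ 0
  /-- For `i ∈ J₁`, the set `I₁^{(i)} = {j ∈ I₁ | a_j^{(i)} ≠ 0}` is not empty. -/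
  exists_I1 : ∀ i, D.kind i = .J1 → ∃ j, D.kind j = .I1 ∧ D.a i j ≠ 0
  /-- `ν_j = 1` for `j ∈ I₁^{(i)}`. -/
  ν_eq_one : ∀ i j, D.kind i = .J1 → D.kind j = .I1 → D.a i j ≠ 0 → D.ν j = 1
  /-- `F_j = F_k` for `j` and `k` in `I₁^{(i)}`. -/
  series_eq : ∀ i j k, D.kind i = .J1 → D.kind j = .I1 → D.a i j ≠ 0 → D.kind k = .I1 →
    D.a i k ≠ 0 → D.series j = D.series k
  /-- `b_t^{(i)} = a_t^{(j)}` for `j ∈ I₁^{(i)}` and `t ∈ I₀ ∪ J₀ ∪ K₀`. -/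
  b_eq : ∀ i j t, D.kind i = .J1 → D.kind j = .I1 → D.a i j ≠ 0 →
    (D.kind t = .I0 ∨ D.kind t = .J0 ∨ D.kind t = .K0) → D.b i t = D.a j t

/-- The scalar `b_j` attached to the vertex `j`: `1 + β_j` if `j ∈ I₀`, `1` if `j ∈ J₀`, and `0`
otherwise. -/
def bCoeff (j : J) : K :=
  match D.kind j with
  | .I0 => 1 + D.β j
  | .J0 => 1
  | _ => 0

end FundamentalData

end Fundamental

namespace SDSE

/-- `F` is a fundamental abelian system: up to a change of variables, it is the dilatation of one of
the systems above, and all the scalars `b_j` are zero. -/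
def IsFundamentalAbelian [Fintype I] (F : SDSE K I) : Prop :=
  F.IsSDSE ∧ ∃ (n : ℕ) (D : FundamentalData K (Fin n)) (π : I → Fin n) (G : SDSE K I),
    D.Valid ∧ (∀ j, D.bCoeff j = 0) ∧ IsDilatation π D.series G ∧ IsChangeOfVariables G F

open scoped Classical in
/-- The restriction of `F` to `B` is obtained from a fundamental abelian system by a finite number
of successive extensions. -/
inductive IsExtendedOn [Fintype I] (F : SDSE K I) : Set I → Prop
  | base (B : Set I) (h : IsFundamentalAbelian (F.restrict B)) : IsExtendedOn F B
  | step (B : Set I) (x : I) (hx : x ∉ B) (hB : IsExtendedOn F B)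
      (h : IsExtensionAt (F.restrict (insert x B)) ⟨x, Set.mem_insert _ _⟩) :
      IsExtendedOn F (insert x B)

/-- `F` is an extended fundamental abelian system: it is obtained from a fundamental abelian system
by a finite number (possibly zero) of successive extensions. -/
def IsExtendedFundamentalAbelian [Fintype I] (F : SDSE K I) : Prop := F.IsExtendedOn Set.univ

end SDSE

end Systems

section Target

attribute [local instance] LieRing.ofAssociativeRing

variable (K : Type u) [Field K]

/-- A vector space seen as a Lie algebra with zero bracket. -/
def TrivLie (V : Type v) : Type v := V

namespace TrivLie

variable (V : Type v) [AddCommGroup V]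

instance : AddCommGroup (TrivLie V) := inferInstanceAs (AddCommGroup V)

instance [Module K V] : Module K (TrivLie V) := inferInstanceAs (Module K V)

instance : LieRing (TrivLie V) where
  bracket _ _ := 0
  add_lie _ _ _ := (add_zero 0).symm
  lie_add _ _ _ := (add_zero 0).symm
  lie_self _ := rfl
  leibniz_lie _ _ _ := (add_zero 0).symm

instance [Module K V] : LieAlgebra K (TrivLie V) where
  lie_smul c _ _ := (smul_zero c).symm

theorem lie_eq_zero (x y : TrivLie V) : ⁅x, y⁆ = 0 := rfl

/-- The identity of a vector space, seen as a map to the corresponding Lie algebra with zero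
bracket. -/
def of [Module K V] : V ≃ₗ[K] TrivLie V := LinearEquiv.refl K V

end TrivLie

/-- The action of a Lie algebra `L` on an `L`-module `V`, by derivations of `V` seen as a Lie
algebra with zero bracket. -/
def moduleAction (L : Type*) (V : Type*) [LieRing L] [LieAlgebra K L] [AddCommGroup V] [Module K V]
    [LieRingModule L V] [LieModule K L V] :
    L →ₗ⁅K⁆ LieDerivation K (TrivLie V) (TrivLie V) where
  toFun x :=
    { toLinearMap := ((TrivLie.of K V).toLinearMap ∘ₗ LieModule.toEnd K L V x) ∘ₗ
        (TrivLie.of K V).symm.toLinearMap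
      leibniz' := fun a b => by
        simp only [TrivLie.lie_eq_zero, map_zero, sub_zero] }
  map_add' x y := by
    ext v
    exact add_lie x y ((TrivLie.of K V).symm v)
  map_smul' c x := by
    ext v
    exact smul_lie c x ((TrivLie.of K V).symm v)
  map_lie' := by
    intro x y
    ext v
    exact lie_lie x y ((TrivLie.of K V).symm v)

/-- The semi-direct product `V ⋊ L` of a Lie algebra `L` and an `L`-module `V` (which is an abelian
ideal of `V ⋊ L`). -/
abbrev ModuleSemidirect (L : Type*) (V : Type*) [LieRing L] [LieAlgebra K L] [AddCommGroup V]
    [Module K V] [LieRingModule L V] [LieModule K L V] : Type _ :=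
  LieAlgebra.SemiDirectSum (TrivLie V) L (moduleAction K L V)

/-- The vector space with basis `(g(k))_{k ≥ 1}`, where `g(k) = Finsupp.single k 1`. -/
abbrev Seq (K : Type u) [Field K] : Type u := ℕ+ →₀ K

/-- The module over `L` attached to a representation of `L` on the vector space with basis
`(g(k))_{k ≥ 1}`. -/
def RepModule {K : Type u} [Field K] {L : Type*} [LieRing L] [LieAlgebra K L]
    (_ : L →ₗ⁅K⁆ Module.End K (Seq K)) : Type u := Seq K

namespace RepModule

variable {K} {L : Type*} [LieRing L] [LieAlgebra K L] (ρ : L →ₗ⁅K⁆ Module.End K (Seq K))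

noncomputable instance : AddCommGroup (RepModule ρ) := inferInstanceAs (AddCommGroup (Seq K))

noncomputable instance : Module K (RepModule ρ) := inferInstanceAs (Module K (Seq K))

/-- The identity of the vector space underlying the module. -/
noncomputable def of : Seq K ≃ₗ[K] RepModule ρ := LinearEquiv.refl K (Seq K)

noncomputable instance : LieRingModule L (RepModule ρ) where
  bracket x v := of ρ (ρ x ((of ρ).symm v))
  add_lie x y v := by
    rw [map_add, LinearMap.add_apply, map_add]
  lie_add x v w := by
    rw [map_add, map_add, map_add]
  leibniz_lie x y v := by
    simp only [LinearEquiv.symm_apply_apply]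
    rw [← map_add]
    congr 1
    have h : ρ ⁅x, y⁆ = ρ x * ρ y - ρ y * ρ x := ρ.map_lie x y
    rw [h, LinearMap.sub_apply, Module.End.mul_apply, Module.End.mul_apply, sub_add_cancel]

noncomputable instance : LieModule K L (RepModule ρ) where
  smul_lie c x v := by
    change of ρ (ρ (c • x) ((of ρ).symm v)) = c • of ρ (ρ x ((of ρ).symm v))
    rw [map_smul, LinearMap.smul_apply, map_smul]
  lie_smul c x v := by
    change of ρ (ρ x ((of ρ).symm (c • v))) = c • of ρ (ρ x ((of ρ).symm v))
    rw [map_smul, map_smul, map_smul]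

end RepModule

/-- The operator `g(l) ↦ g(k + l)`. -/
noncomputable def shift (k : ℕ+) : Module.End K (Seq K) :=
  Finsupp.linearCombination K fun l => Finsupp.single (k + l) 1

/-- The operator sending `g(1)` to `g(k + 1)` and `g(l)` to `0` if `l ≥ 2`. -/
noncomputable def shiftOne (k : ℕ+) : Module.End K (Seq K) :=
  Finsupp.linearCombination K fun l => if l = 1 then Finsupp.single (k + 1) 1 else 0

variable {K}

theorem shift_single (k l : ℕ+) (c : K) :
    shift K k (Finsupp.single l c) = Finsupp.single (k + l) c := by
  simp [shift]

theorem shiftOne_single (k l : ℕ+) (c : K) : shiftOne K k (Finsupp.single l c) =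
    if l = 1 then Finsupp.single (k + 1) c else 0 := by
  rw [shiftOne, Finsupp.linearCombination_single]
  split_ifs <;> simp

theorem shift_comm (k l : ℕ+) : shift K k * shift K l = shift K l * shift K k := by
  refine Finsupp.lhom_ext fun m c => ?_
  simp only [Module.End.mul_apply, shift_single]
  rw [add_left_comm]

theorem shiftOne_mul (k l : ℕ+) : shiftOne K k * shiftOne K l = 0 := by
  refine Finsupp.lhom_ext fun m c => ?_
  rw [Module.End.mul_apply, shiftOne_single]
  split_ifs with h
  · rw [shiftOne_single, if_neg]
    · rfl
    · exact (PNat.lt_add_left 1 l).ne'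
  · simp

theorem shiftOne_mul_shift (k l : ℕ+) : shiftOne K k * shift K l = 0 := by
  refine Finsupp.lhom_ext fun m c => ?_
  rw [Module.End.mul_apply, shift_single, shiftOne_single, if_neg]
  · rfl
  · exact ((one_le (a := m)).trans_lt (PNat.lt_add_left m l)).ne'

theorem shift_mul_shiftOne (k l : ℕ+) : shift K k * shiftOne K l = shiftOne K (k + l) := by
  refine Finsupp.lhom_ext fun m c => ?_
  rw [Module.End.mul_apply, shiftOne_single, shiftOne_single]
  split_ifs
  · rw [shift_single, add_assoc]
  · simp

/-- The abelian Lie algebra `𝔤_ab` with basis `(e^{(i)}(k))_{1 ≤ i ≤ M, k ≥ 1}`, where `e^{(i)}(k)`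
is `Finsupp.single (i, k) 1`. -/
abbrev GAb (K : Type u) [Field K] (M : ℕ) : Type u := TrivLie ((Fin M × ℕ+) →₀ K)

variable {M N : ℕ}

/-- The linear map `e^{(i)}(k) ↦ T i k` on `𝔤_ab`. -/
noncomputable def GAb.lift (T : Fin M → ℕ+ → Module.End K (Seq K)) :
    GAb K M →ₗ[K] Module.End K (Seq K) :=
  (Finsupp.linearCombination K fun p : Fin M × ℕ+ => T p.1 p.2) ∘ₗ
    (TrivLie.of K ((Fin M × ℕ+) →₀ K)).symm.toLinearMap

theorem linearCombination_mul {ι κ : Type*} (T : ι → Module.End K (Seq K))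
    (U : κ → Module.End K (Seq K)) (x : ι →₀ K) (y : κ →₀ K) :
    Finsupp.linearCombination K T x * Finsupp.linearCombination K U y =
      x.sum fun p c => y.sum fun q d => (c * d) • (T p * U q) := by
  rw [Finsupp.linearCombination_apply, Finsupp.linearCombination_apply, Finsupp.sum_mul]
  refine Finsupp.sum_congr fun p _ => ?_
  rw [Finsupp.mul_sum]
  refine Finsupp.sum_congr fun q _ => ?_
  rw [smul_mul_smul_comm]

theorem linearCombination_comm {ι κ : Type*} {T : ι → Module.End K (Seq K)}
    {U : κ → Module.End K (Seq K)} (h : ∀ p q, T p * U q = U q * T p) (x : ι →₀ K) (y : κ →₀ K) :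
    Finsupp.linearCombination K T x * Finsupp.linearCombination K U y =
      Finsupp.linearCombination K U y * Finsupp.linearCombination K T x := by
  rw [linearCombination_mul, linearCombination_mul, Finsupp.sum_comm]
  simp only [h, mul_comm]

theorem GAb.lift_comm {T : Fin M → ℕ+ → Module.End K (Seq K)}
    (hT : ∀ i k j l, T i k * T j l = T j l * T i k) (x y : GAb K M) :
    GAb.lift T x * GAb.lift T y = GAb.lift T y * GAb.lift T x :=
  linearCombination_comm (fun p q => hT p.1 p.2 q.1 q.2) _ _

/-- The representation `e^{(i)}(k).f(l) = υ_i f(k + l)` of `𝔤_ab`. -/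
noncomputable def repV (υ : Fin M → K) : GAb K M →ₗ⁅K⁆ Module.End K (Seq K) :=
  { GAb.lift fun i k => υ i • shift K k with
    map_lie' := by
      intro x y
      rw [TrivLie.lie_eq_zero]
      change GAb.lift (fun i k => υ i • shift K k) 0 =
        GAb.lift (fun i k => υ i • shift K k) x * GAb.lift (fun i k => υ i • shift K k) y -
        GAb.lift (fun i k => υ i • shift K k) y * GAb.lift (fun i k => υ i • shift K k) x
      rw [map_zero, GAb.lift_comm (fun i k j l => ?_) x y]
      · exact (sub_self (GAb.lift (fun i k => υ i • shift K k) y *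
          GAb.lift (fun i k => υ i • shift K k) x)).symm
      · rw [smul_mul_smul_comm, smul_mul_smul_comm, shift_comm, mul_comm] }

/-- The `𝔤_ab`-module `V_υ`. -/
abbrev V (υ : Fin M → K) : Type u := RepModule (repV υ)

/-- The `𝔤_ab`-module `V_{υ^{(1)}} ⊕ ⋯ ⊕ V_{υ^{(N)}}`. -/
abbrev VSum (υ : Fin N → Fin M → K) : Type u := DirectSum (Fin N) fun j => V (υ j)

/-- The Lie algebra `(V_{υ^{(1)}} ⊕ ⋯ ⊕ V_{υ^{(N)}}) ⋊ 𝔤_ab`. -/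
abbrev GV (υ : Fin N → Fin M → K) : Type u := ModuleSemidirect K (GAb K M) (VSum υ)

/-- The linear map `f^{(j)}(k) ↦ U j k` on `V_{υ^{(1)}} ⊕ ⋯ ⊕ V_{υ^{(N)}}`. -/
noncomputable def VSum.lift (υ : Fin N → Fin M → K) (U : Fin N → ℕ+ → Module.End K (Seq K)) :
    VSum υ →ₗ[K] Module.End K (Seq K) :=
  DirectSum.toModule K (Fin N) _ fun j =>
    (Finsupp.linearCombination K (U j)) ∘ₗ (RepModule.of (repV (υ j))).symm.toLinearMap

theorem VSum.lift_of (υ : Fin N → Fin M → K) (U : Fin N → ℕ+ → Module.End K (Seq K)) (j : Fin N)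
    (v : Seq K) : VSum.lift υ U (DirectSum.lof K (Fin N) (fun j => V (υ j)) j
      (RepModule.of (repV (υ j)) v)) = Finsupp.linearCombination K (U j) v :=
  DirectSum.toModule_lof K j _

theorem VSum.ind {υ : Fin N → Fin M → K} {p : VSum υ → Prop} (h0 : p 0)
    (hadd : ∀ v w, p v → p w → p (v + w))
    (h : ∀ j v, p (DirectSum.lof K (Fin N) (fun j => V (υ j)) j (RepModule.of (repV (υ j)) v)))
    (v : VSum υ) : p v := by
  induction v using DirectSum.induction_on with
  | zero => exact h0
  | add x y hx hy => exact hadd x y hx hy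
  | of j v => exact h j ((RepModule.of (repV (υ j))).symm v)

theorem VSum.lift_comm {υ : Fin N → Fin M → K} {U : Fin N → ℕ+ → Module.End K (Seq K)}
    (hU : ∀ i k j l, U i k * U j l = U j l * U i k) (v w : VSum υ) :
    VSum.lift υ U v * VSum.lift υ U w = VSum.lift υ U w * VSum.lift υ U v := by
  induction v using VSum.ind with
  | h0 => rw [map_zero, zero_mul, mul_zero]
  | hadd x y hx hy => rw [map_add, add_mul, mul_add, hx, hy]
  | h i v =>
    induction w using VSum.ind with
    | h0 => rw [map_zero, zero_mul, mul_zero]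
    | hadd x y hx hy => rw [map_add, add_mul, mul_add, hx, hy]
    | h j w =>
      rw [VSum.lift_of, VSum.lift_of]
      exact linearCombination_comm (fun k l => hU i k j l) v w

theorem VSum.lift_lie {υ : Fin N → Fin M → K} {T : Fin M → ℕ+ → Module.End K (Seq K)}
    {U : Fin N → ℕ+ → Module.End K (Seq K)}
    (hTU : ∀ i k j l, T i k * U j l = U j l * T i k + υ j i • U j (k + l))
    (a : GAb K M) (v : VSum υ) : GAb.lift T a * VSum.lift υ U v =
      VSum.lift υ U v * GAb.lift T a + VSum.lift υ U ⁅a, v⁆ := by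
  induction v using VSum.ind with
  | h0 => rw [lie_zero, map_zero, zero_mul, mul_zero, add_zero]
  | hadd x y hx hy => rw [lie_add, map_add, map_add, add_mul, mul_add, hx, hy]; abel
  | h j v =>
    have h2 : ⁅a, DirectSum.lof K (Fin N) (fun j => V (υ j)) j (RepModule.of (repV (υ j)) v)⁆ =
        DirectSum.lof K (Fin N) (fun j => V (υ j)) j (RepModule.of (repV (υ j)) (repV (υ j) a v)) :=
      ((DirectSum.lieModuleOf K (Fin N) (GAb K M) (fun j => V (υ j)) j).map_lie a
        (RepModule.of (repV (υ j)) v)).symm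
    rw [h2, VSum.lift_of, VSum.lift_of]
    clear h2
    have key : ∀ a : (Fin M × ℕ+) →₀ K,
        Finsupp.linearCombination K (fun p : Fin M × ℕ+ => T p.1 p.2) a *
          Finsupp.linearCombination K (U j) v =
        Finsupp.linearCombination K (U j) v *
          Finsupp.linearCombination K (fun p : Fin M × ℕ+ => T p.1 p.2) a +
        Finsupp.linearCombination K (U j) (Finsupp.linearCombination K
          (fun p : Fin M × ℕ+ => υ j p.1 • shift K p.2) a v) := by
      intro a
      induction a using Finsupp.induction_linear with
      | zero => simp
      | add a a' h h' =>
        rw [map_add, add_mul, h, h', map_add, LinearMap.add_apply, map_add, mul_add]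
        abel
      | single p c =>
        induction v using Finsupp.induction_linear with
        | zero => simp
        | add x x' h h' =>
          simp only [map_add, add_mul, mul_add, h, h']
          abel
        | single l d =>
          simp only [Finsupp.linearCombination_single, smul_mul_smul_comm, hTU,
            LinearMap.smul_apply, shift_single, map_smul]
          rw [smul_add, smul_comm (υ j p.1) d, smul_smul c d, mul_comm d c]
    exact key a

/-- The representation of `(V_{υ^{(1)}} ⊕ ⋯ ⊕ V_{υ^{(N)}}) ⋊ 𝔤_ab` where `e^{(i)}(k)` acts by `T i k`
and `f^{(j)}(k)` acts by `U j k`. -/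
noncomputable def GV.rep (υ : Fin N → Fin M → K) (T : Fin M → ℕ+ → Module.End K (Seq K))
    (U : Fin N → ℕ+ → Module.End K (Seq K))
    (hT : ∀ i k j l, T i k * T j l = T j l * T i k) (hU : ∀ i k j l, U i k * U j l = U j l * U i k)
    (hTU : ∀ i k j l, T i k * U j l = U j l * T i k + υ j i • U j (k + l)) :
    GV υ →ₗ⁅K⁆ Module.End K (Seq K) where
  toFun x := GAb.lift T x.right + VSum.lift υ U ((TrivLie.of K (VSum υ)).symm x.left)
  map_add' x y := by
    change GAb.lift T (x.right + y.right) +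
      VSum.lift υ U ((TrivLie.of K (VSum υ)).symm (x.left + y.left)) = _
    rw [map_add, map_add, map_add]
    abel
  map_smul' c x := by
    change GAb.lift T (c • x.right) + VSum.lift υ U ((TrivLie.of K (VSum υ)).symm (c • x.left)) = _
    rw [map_smul, map_smul, map_smul, RingHom.id_apply, smul_add]
  map_lie' := by
    intro x y
    obtain ⟨v, a⟩ := x
    obtain ⟨w, b⟩ := y
    obtain ⟨v, rfl⟩ := (TrivLie.of K (VSum υ)).surjective v
    obtain ⟨w, rfl⟩ := (TrivLie.of K (VSum υ)).surjective w
    have h1 : (⁅(⟨TrivLie.of K (VSum υ) v, a⟩ : GV υ), (⟨TrivLie.of K (VSum υ) w, b⟩ : GV υ)⁆) =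
        ⟨TrivLie.of K (VSum υ) (⁅a, w⁆ - ⁅b, v⁆), 0⟩ := by
      rw [LieAlgebra.SemiDirectSum.lie_eq_mk, map_sub, TrivLie.lie_eq_zero, TrivLie.lie_eq_zero,
        zero_add]
      rfl
    rw [h1]
    have h2 := GAb.lift_comm hT a b
    have h3 := VSum.lift_comm hU v w
    have h4 := VSum.lift_lie hTU a w
    have h5 := VSum.lift_lie hTU b v
    simp only [LinearEquiv.symm_apply_apply, map_zero, zero_add, map_sub]
    change _ = (GAb.lift T a + VSum.lift υ U v) * (GAb.lift T b + VSum.lift υ U w) -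
      (GAb.lift T b + VSum.lift υ U w) * (GAb.lift T a + VSum.lift υ U v)
    rw [add_mul, mul_add, mul_add, add_mul, mul_add, mul_add, h2, h3, h4, h5]
    abel

/-- The parameters of a module `W_ν`, or of a module `W'_{ν, μ}` (with the condition
`μ_j (ν_i - υ_i^{(j)}) = 0`). -/
inductive WParam (υ : Fin N → Fin M → K) : Type u
  | W (ν : Fin M → K) : WParam υ
  | W' (ν : Fin M → K) (μ : Fin N → K) (h : ∀ i j, μ j * (ν i - υ j i) = 0) : WParam υ

/-- The representation on `W_ν` (`e^{(i)}(k).g(1) = ν_i g(k + 1)`, `e^{(i)}(k).g(l) = 0` if `l ≥ 2`,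
`f^{(j)}(k).g(l) = 0`), or on `W'_{ν, μ}` (`e^{(i)}(k).g(l) = ν_i g(k + l)`,
`f^{(j)}(k).g(1) = μ_j g(k + 1)`, `f^{(j)}(k).g(l) = 0` if `l ≥ 2`). -/
noncomputable def repW {υ : Fin N → Fin M → K} : WParam υ → (GV υ →ₗ⁅K⁆ Module.End K (Seq K))
  | .W ν => GV.rep υ (fun i k => ν i • shiftOne K k) (fun _ _ => 0)
      (fun i k j l => by
        rw [smul_mul_smul_comm, smul_mul_smul_comm, shiftOne_mul, shiftOne_mul, smul_zero,
          smul_zero])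
      (fun i k j l => rfl) (fun i k j l => by rw [mul_zero, zero_mul, smul_zero, add_zero])
  | .W' ν μ h => GV.rep υ (fun i k => ν i • shift K k) (fun j k => μ j • shiftOne K k)
      (fun i k j l => by
        rw [smul_mul_smul_comm, smul_mul_smul_comm, shift_comm, mul_comm])
      (fun i k j l => by
        rw [smul_mul_smul_comm, smul_mul_smul_comm, shiftOne_mul, shiftOne_mul, smul_zero,
          smul_zero])
      (fun i k j l => by
        rw [smul_mul_smul_comm, smul_mul_smul_comm, shiftOne_mul_shift, shift_mul_shiftOne,
          smul_zero, zero_add, smul_smul]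
        congr 1
        linear_combination h i j)

/-- The direct sum `W` of a finite family of modules `W_ν` and `W'_{ν, μ}`. -/
abbrev WSum {P : ℕ} {υ : Fin N → Fin M → K} (w : Fin P → WParam υ) : Type u :=
  DirectSum (Fin P) fun c => RepModule (repW (w c))

/-- The Lie algebra `W ⋊ ((V_{υ^{(1)}} ⊕ ⋯ ⊕ V_{υ^{(N)}}) ⋊ 𝔤_ab)`. -/
abbrev GWV {P : ℕ} {υ : Fin N → Fin M → K} (w : Fin P → WParam υ) : Type u :=
  ModuleSemidirect K (GV υ) (WSum w)

end Target

end HopfSDSE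

/-!
`𝔤_(S)` is identified with the infinitesimal characters of `H_(S)` vanishing in large degrees: such
a form `f` is determined by its values `c_x(n) = f(X_x(n))` on the generators, so that `𝔤_(S)`
embeds in the space of families `c = (c_x)_{x ∈ I}` of finite sequences. Everything rests on one
computation, that of the Lie bracket in these coordinates, and on the fact that all families occur.

*Shape of the system.* If the last step of the construction of `(S)` were an extension at `x`, then
`x` would be an extension vertex. Hence `(S)` is, up to a change of variables, the dilatation of a
basic system with all `b_j` zero. A vertex of `K₀` would then have a constant series, so only `I₀`,
`I₁` and `J₁` remain, and as `β_j = -1` all the series `f_{β/λ}(λ h)` that occur are binomial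
series `(1 + h)^λ`. This is `exists_abelianPresentation`.

*Bracket.* Let `φ` be an infinitesimal character, so that `∂ = (φ ⊗ id) ∘ Δ` is a derivation of
`H_I`. Write `L_j = ∑ l_y X_y` for the sum over the fibre of `j` under the dilatation. For `j ∈ I₀`
the equation of the system gives `L_j = t B(1 + L_j)` for a linear combination `B` of the `B⁺_y`,
and the cocycle property of the `B⁺_y` yields `∂ L_j = φ(L_j) (1 + L_j)`. Thus `∂` acts on
`1 + L_j` by the scalar series `φ(L_j)`, on `(1 + L_j)^a` by `a φ(L_j)`, and it sends `ln(1 + L_j)`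
to `φ(L_j)`; hence, for every `x`, `∂ F_x(X)` is an affine function of `F_x(X)` whose coefficients
are scalar series. Applying `B⁺_x` and a second infinitesimal character gives the operation `star`,
of which the bracket is the antisymmetrization (`AbelianPresentation.exists_coordinates`). The
constant term of the affine function only involves the coordinates of degree one, extracted by
`headPart`.

*All families occur.* The series `F_x(X)` always have a nonzero linear part, so every `X_x(n)`,
`n ≥ 1`, contains a ladder with root `x`; coefficients of ladders are infinitesimal characters, and
suitable combinations of them take arbitrary values on the `X_x(n)`.

*Matching.* The sums `L_j`, `j ∈ I₀`, have coordinates with zero bracket: they give `𝔤_ab`. The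
other vertices above `I₀`, and those above the `i ∈ I₁` with `ν_i ≠ 0`, give the modules `V_υ`; the
vertices above the `i ∈ I₁` with `ν_i = 0` give modules `W_ν`, and those above `J₁` modules
`W'_{ν, μ}`. When `ν_i ≠ 0`, the affine part is absorbed by the rescaling `twist` of the component
of degree one. The condition `μ_j (ν_i - υ_i^{(j)}) = 0` holds because the vertices of `I₁` on
which a vertex of `J₁` depends have `ν = 1` and the same exponents as that vertex. This is
`gwvOf_splitMap_star_sub_star`.
-/

namespace HopfSDSE

universe u v

/-! ### Coefficientwise linear maps and derivations of power series -/

section CoefficientwiseMaps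

variable {K A B : Type*} [Field K] [CommRing A] [Algebra K A] [CommRing B] [Algebra K B]

/-- The coefficientwise extension `∑ xₙ tⁿ ↦ ∑ T(xₙ) tⁿ` of a linear map `T`. -/
noncomputable def coeffMap (T : A →ₗ[K] B) : PowerSeries A →ₗ[K] PowerSeries B where
  toFun x := PowerSeries.mk fun n => T (PowerSeries.coeff n x)
  map_add' x y := by ext n; simp
  map_smul' c x := by ext n; simp

@[simp] theorem coeff_coeffMap (T : A →ₗ[K] B) (x : PowerSeries A) (n : ℕ) :
    PowerSeries.coeff n (coeffMap T x) = T (PowerSeries.coeff n x) := by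
  simp [coeffMap]

/-- Scalars `K⟦t⟧` inside `A⟦t⟧`. -/
noncomputable def scal (A : Type*) [CommRing A] [Algebra K A] (p : PowerSeries K) : PowerSeries A :=
  PowerSeries.map (algebraMap K A) p

theorem coeffMap_scal_mul (T : A →ₗ[K] B) (p : PowerSeries K) (x : PowerSeries A) :
    coeffMap T (scal A p * x) = scal B p * coeffMap T x := by
  ext n
  simp only [coeff_coeffMap, PowerSeries.coeff_mul, scal, PowerSeries.coeff_map, map_sum,
    ← Algebra.smul_def, map_smul]

theorem scal_self (p : PowerSeries K) : scal K p = p := by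
  ext n; simp [scal]

theorem coeffMap_X_mul (T : A →ₗ[K] B) (x : PowerSeries A) :
    coeffMap T (PowerSeries.X * x) = PowerSeries.X * coeffMap T x := by
  ext n
  cases n <;> simp [PowerSeries.coeff_succ_X_mul]

/-- The coefficientwise extension of a derivation of `A` is a derivation of `A⟦t⟧`. -/
noncomputable def seriesDerivation (D : Derivation K A A) :
    Derivation K (PowerSeries A) (PowerSeries A) :=
  Derivation.mk' (coeffMap D.toLinearMap) fun x y => by
    ext n
    simp only [coeff_coeffMap, PowerSeries.coeff_mul, smul_eq_mul, map_add, map_sum,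
      Derivation.coeFn_coe, Derivation.leibniz, Finset.sum_add_distrib]
    congr 1
    rw [← Finset.Nat.sum_antidiagonal_swap]
    rfl

@[simp] theorem coeff_seriesDerivation (D : Derivation K A A) (x : PowerSeries A) (n : ℕ) :
    PowerSeries.coeff n (seriesDerivation D x) = D (PowerSeries.coeff n x) := coeff_coeffMap _ _ _

theorem coeff_pow_eq_zero {g : PowerSeries A} (hg : PowerSeries.constantCoeff g = 0) {n d : ℕ}
    (h : n < d) : PowerSeries.coeff n (g ^ d) = 0 := by
  have h1 : PowerSeries.X ^ d ∣ g ^ d := pow_dvd_pow_of_dvd (PowerSeries.X_dvd_iff.2 hg) d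
  exact PowerSeries.X_pow_dvd_iff.1 h1 n h

/-- The chain rule. The coefficient of `tⁿ` only involves a truncation of `f`, which reduces it to
the chain rule for polynomials. -/
theorem seriesDerivation_subst (D : Derivation K A A) (f : PowerSeries K) {g : PowerSeries A}
    (hg0 : PowerSeries.constantCoeff g = 0) :
    seriesDerivation D (f.subst g) =
      (PowerSeries.derivative K f).subst g * seriesDerivation D g := by
  have hg : PowerSeries.HasSubst g := PowerSeries.HasSubst.of_constantCoeff_zero' hg0
  ext n
  have hz : ∀ {i d : ℕ}, i ≤ n → n < d → PowerSeries.coeff i (g ^ d) = 0 := fun hi hd =>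
    coeff_pow_eq_zero hg0 (lt_of_le_of_lt hi hd)
  have h1 : PowerSeries.coeff n (f.subst g) =
      PowerSeries.coeff n ((↑(PowerSeries.trunc (n + 2) f) : PowerSeries K).subst g) := by
    rw [PowerSeries.coeff_subst' hg, PowerSeries.coeff_subst' hg]
    refine finsum_congr fun d => ?_
    obtain hd | hd := lt_or_ge d (n + 2)
    · rw [PowerSeries.coeff_coe_trunc_of_lt hd]
    · rw [hz le_rfl (by omega), smul_zero, smul_zero]
  have h2 : seriesDerivation D ((↑(PowerSeries.trunc (n + 2) f) : PowerSeries K).subst g) =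
      (PowerSeries.derivative K (↑(PowerSeries.trunc (n + 2) f) : PowerSeries K)).subst g *
        seriesDerivation D g := by
    simp [PowerSeries.subst_coe hg, PowerSeries.derivative_coe,
      Derivation.comp_aeval_eq (a := g) (seriesDerivation D), smul_eq_mul]
  rw [coeff_seriesDerivation, h1, ← coeff_seriesDerivation, h2, PowerSeries.coeff_mul,
    PowerSeries.coeff_mul]
  refine Finset.sum_congr rfl fun ⟨i, j⟩ hij => ?_
  rw [Finset.HasAntidiagonal.mem_antidiagonal] at hij
  congr 1
  simp only [PowerSeries.coeff_subst' hg]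
  refine finsum_congr fun d => ?_
  obtain hd | hd := lt_or_ge n d
  · rw [hz (by simp at hij; omega) hd, smul_zero, smul_zero]
  · simp only [PowerSeries.coeff_derivative, Polynomial.coeff_coe, PowerSeries.coeff_trunc]
    rw [if_pos (by omega)]

end CoefficientwiseMaps

/-! ### Infinitesimal characters and their derivations -/

section InfinitesimalCharacters

variable {K : Type u} [Field K] {D : Type v}

/-- Infinitesimal characters of `H_D`: the linear forms with
`φ(xy) = φ(x) ε(y) + ε(x) φ(y)`, where `ε` is the counit. -/
def IsInfChar (φ : HTree K D →ₗ[K] K) : Prop :=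
  ∀ x y, φ (x * y) = φ x * counitTree K y + counitTree K x * φ y

/-- The map `φ ⊗ id : H_D ⊗ H_D → H_D`. -/
noncomputable def contract (φ : HTree K D →ₗ[K] K) : HTree K D ⊗[K] HTree K D →ₗ[K] HTree K D :=
  (TensorProduct.lid K (HTree K D)).toLinearMap ∘ₗ φ.rTensor (HTree K D)

@[simp] theorem contract_tmul (φ : HTree K D →ₗ[K] K) (x y : HTree K D) :
    contract φ (x ⊗ₜ y) = φ x • y := by
  simp [contract]

/-- The counit axiom. -/
theorem contract_counit (x : HTree K D) :
    contract (counitTree K (D := D)).toLinearMap (comulTree K x) = x := by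
  have h := DFunLike.congr_fun (comulTree_counit_left (D := D) K) x
  have h1 : ∀ z : HTree K D ⊗[K] HTree K D, contract (counitTree K (D := D)).toLinearMap z =
      TensorProduct.lid K (HTree K D)
        (Algebra.TensorProduct.map (counitTree K) (.id K (HTree K D)) z) := by
    intro z
    induction z using TensorProduct.induction_on with
    | zero => simp
    | add y z hy hz => simp only [map_add, hy, hz]
    | tmul y z => simp
  rw [h1]
  simp only [AlgHom.comp_apply] at h
  rw [h]
  simp

/-- The convolution product `φ * ψ` is `ψ ∘ (φ ⊗ id) ∘ Δ`. -/
theorem mul'_map_eq (φ ψ : HTree K D →ₗ[K] K) (z : HTree K D ⊗[K] HTree K D) :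
    LinearMap.mul' K K (TensorProduct.map φ ψ z) = ψ (contract φ z) := by
  induction z using TensorProduct.induction_on with
  | zero => simp
  | add y z hy hz => simp only [map_add, hy, hz]
  | tmul y z => simp

theorem IsInfChar.contract_mul {φ : HTree K D →ₗ[K] K} (h : IsInfChar φ)
    (a b : HTree K D ⊗[K] HTree K D) : contract φ (a * b) =
      contract φ a * contract (counitTree K (D := D)).toLinearMap b +
      contract (counitTree K (D := D)).toLinearMap a * contract φ b := by
  induction a using TensorProduct.induction_on with
  | zero => simp
  | add y z hy hz => simp only [map_add, add_mul, hy, hz]; ring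
  | tmul y z =>
    induction b using TensorProduct.induction_on with
    | zero => simp
    | add u v hu hv => simp only [map_add, mul_add, hu, hv]; ring
    | tmul u v =>
      simp only [Algebra.TensorProduct.tmul_mul_tmul, contract_tmul, h y u,
        AlgHom.toLinearMap_apply, add_smul, smul_mul_smul_comm]

theorem IsInfChar.map_one {φ : HTree K D →ₗ[K] K} (h : IsInfChar φ) : φ 1 = 0 := by
  have := h 1 1
  simpa using this

/-- The derivation `(φ ⊗ id) ∘ Δ` of `H_D` attached to an infinitesimal character `φ`. -/
noncomputable def IsInfChar.derivation {φ : HTree K D →ₗ[K] K} (h : IsInfChar φ) :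
    Derivation K (HTree K D) (HTree K D) :=
  Derivation.mk' (contract φ ∘ₗ (comulTree K).toLinearMap) fun x y => by
    simp only [LinearMap.comp_apply, AlgHom.toLinearMap_apply, map_mul, h.contract_mul,
      contract_counit, smul_eq_mul]
    ring

theorem IsInfChar.derivation_apply {φ : HTree K D →ₗ[K] K} (h : IsInfChar φ) (x : HTree K D) :
    h.derivation x = contract φ (comulTree K x) := rfl

/-- The cocycle property of `B⁺_d`, seen by the derivation `(φ ⊗ id) ∘ Δ`. -/
theorem IsInfChar.derivation_bPlus {φ : HTree K D →ₗ[K] K} (h : IsInfChar φ) (d : D)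
    (x : HTree K D) :
    h.derivation (bPlus K d x) = algebraMap K _ (φ (bPlus K d x)) + bPlus K d (h.derivation x) := by
  rw [derivation_apply, derivation_apply, comulTree_bPlus, map_add, contract_tmul,
    Algebra.algebraMap_eq_smul_one]
  congr 1
  generalize comulTree K x = z
  induction z using TensorProduct.induction_on with
  | zero => simp
  | add y z hy hz => simp only [map_add, hy, hz]
  | tmul y z => simp

/-- The linear form sending `x` to the coefficient in `x` of the tree `t`. -/
noncomputable def treeCoeff (t : RTree D) : HTree K D →ₗ[K] K :=
  MvPolynomial.lcoeff K (Finsupp.single t 1)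

theorem counitTree_eq (x : HTree K D) : counitTree K x = MvPolynomial.constantCoeff x := by
  rw [counitTree, MvPolynomial.aeval_zero' x]
  rfl

/-- The coefficient of `t` is `ε ∘ ∂/∂t`; hence it is an infinitesimal character. -/
theorem treeCoeff_eq (t : RTree D) (x : HTree K D) :
    treeCoeff t x = counitTree K (MvPolynomial.pderiv t x) := by
  classical
  rw [counitTree_eq, MvPolynomial.constantCoeff_eq, MvPolynomial.coeff_pderiv]
  simp [treeCoeff]

theorem isInfChar_treeCoeff (t : RTree D) : IsInfChar (K := K) (treeCoeff t) := by
  intro x y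
  simp only [treeCoeff_eq, Derivation.leibniz, smul_eq_mul, map_add, map_mul]
  ring

theorem treeCoeff_X [DecidableEq (RTree D)] (t s : RTree D) :
    treeCoeff (K := K) t (MvPolynomial.X s) = if s = t then 1 else 0 := by
  simp [treeCoeff, MvPolynomial.coeff_X, Finsupp.single_left_inj]

end InfinitesimalCharacters

/-! ### Binomial and logarithmic series -/

section OneVariable

variable {K : Type u} [Field K]

/-- The binomial series `(1 + h)^c`. -/
noncomputable def binom (c : K) : PowerSeries K :=
  PowerSeries.mk fun k => (∏ m ∈ Finset.range k, (c - m)) / (k.factorial : K)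

/-- The series `ln(1 + h)`. -/
noncomputable def logOneAdd (K : Type u) [Field K] : PowerSeries K :=
  PowerSeries.mk fun k => if k = 0 then 0 else (-1) ^ (k - 1) / (k : K)

theorem binom_zero : binom (0 : K) = 1 := by
  ext k
  rw [binom, PowerSeries.coeff_mk, PowerSeries.coeff_one]
  split_ifs with h
  · subst h; simp
  · rw [Finset.prod_eq_zero (Finset.mem_range.2 (Nat.pos_of_ne_zero h)) (by simp), zero_div]

theorem binom_one : binom (1 : K) = 1 + PowerSeries.X := by
  ext k
  rw [binom, PowerSeries.coeff_mk, map_add, PowerSeries.coeff_one, PowerSeries.coeff_X]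
  rcases k with _ | _ | k
  · simp
  · simp
  · rw [Finset.prod_eq_zero (i := 1) (Finset.mem_range.2 (by omega)) (by simp)]
    simp

theorem constantCoeff_binom (c : K) : PowerSeries.constantCoeff (binom c) = 1 := by
  rw [← PowerSeries.coeff_zero_eq_constantCoeff_apply]; simp [binom]

theorem constantCoeff_logOneAdd : PowerSeries.constantCoeff (logOneAdd K) = 0 := by
  rw [← PowerSeries.coeff_zero_eq_constantCoeff_apply]; simp [logOneAdd]

variable [CharZero K]

theorem one_add_X_mul_derivative_binom (c : K) :
    (1 + PowerSeries.X) * PowerSeries.derivative K (binom c) = c • binom c := by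
  have hb : ∀ k : ℕ, PowerSeries.coeff (k + 1) (binom c) * (k + 1) =
      (c - k) * PowerSeries.coeff k (binom c) := by
    intro k
    rw [binom, PowerSeries.coeff_mk, PowerSeries.coeff_mk, Finset.prod_range_succ,
      Nat.factorial_succ]
    push_cast
    have h1 : (k : K) + 1 ≠ 0 := by exact_mod_cast k.succ_ne_zero
    have h2 : (k.factorial : K) ≠ 0 := by exact_mod_cast k.factorial_ne_zero
    field_simp
  ext k
  rw [add_mul, one_mul, map_add, PowerSeries.coeff_derivative, hb, map_smul, smul_eq_mul]
  cases k with
  | zero => simp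
  | succ k =>
    rw [PowerSeries.coeff_succ_X_mul, PowerSeries.coeff_derivative]
    push_cast
    ring

theorem one_add_X_mul_derivative_logOneAdd :
    (1 + PowerSeries.X) * PowerSeries.derivative K (logOneAdd K) = 1 := by
  have hb : ∀ k : ℕ, PowerSeries.coeff (k + 1) (logOneAdd K) * (k + 1) = (-1) ^ k := by
    intro k
    have h1 : (k : K) + 1 ≠ 0 := by exact_mod_cast k.succ_ne_zero
    simp [logOneAdd, h1]
  ext k
  rw [add_mul, one_mul, map_add, PowerSeries.coeff_derivative, hb, PowerSeries.coeff_one]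
  cases k with
  | zero => simp
  | succ k =>
    rw [PowerSeries.coeff_succ_X_mul, PowerSeries.coeff_derivative, hb]
    simp [pow_succ]

variable {A : Type*} [CommRing A] [Algebra K A] (δ : Derivation K A A)

/-- If `δ` acts on `1 + L` by multiplication by `w`, it acts on `(1 + L)^c` by multiplication by
`c w`. -/
theorem derivation_binom_subst {L w : PowerSeries A} (hL : PowerSeries.constantCoeff L = 0)
    (h : seriesDerivation δ L = (1 + L) * w) (c : K) :
    seriesDerivation δ ((binom c).subst L) = (c • w) * (binom c).subst L := by
  have hs := PowerSeries.HasSubst.of_constantCoeff_zero' hL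
  have h1 := congrArg (PowerSeries.substAlgHom (R := K) hs) (one_add_X_mul_derivative_binom c)
  rw [map_mul, map_add, map_one, map_smul, PowerSeries.substAlgHom_X,
    PowerSeries.coe_substAlgHom] at h1
  rw [seriesDerivation_subst δ _ hL, h]
  calc _ = ((1 + L) * PowerSeries.subst L (PowerSeries.derivative K (binom c))) * w := by ring
    _ = _ := by rw [h1, smul_mul_assoc, smul_mul_assoc, mul_comm]

theorem derivation_logOneAdd_subst {L w : PowerSeries A} (hL : PowerSeries.constantCoeff L = 0)
    (h : seriesDerivation δ L = (1 + L) * w) :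
    seriesDerivation δ ((logOneAdd K).subst L) = w := by
  have hs := PowerSeries.HasSubst.of_constantCoeff_zero' hL
  have h1 := congrArg (PowerSeries.substAlgHom (R := K) hs)
    (one_add_X_mul_derivative_logOneAdd (K := K))
  rw [map_mul, map_add, map_one, PowerSeries.substAlgHom_X,
    PowerSeries.coe_substAlgHom] at h1
  rw [seriesDerivation_subst δ _ hL, h]
  calc _ = ((1 + L) * PowerSeries.subst L (PowerSeries.derivative K (logOneAdd K))) * w := by ring
    _ = _ := by rw [h1, one_mul]

/-- The logarithmic derivative of `∏ⱼ (1 + Lⱼ)^{cⱼ}`. -/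
theorem derivation_prod_binom {J : Type*} (s : Finset J) {L w : J → PowerSeries A} {c : J → K}
    (hL : ∀ j, PowerSeries.constantCoeff (L j) = 0)
    (h : ∀ j, c j ≠ 0 → seriesDerivation δ (L j) = (1 + L j) * w j) :
    seriesDerivation δ (∏ j ∈ s, (binom (c j)).subst (L j)) =
      (∑ j ∈ s, c j • w j) * ∏ j ∈ s, (binom (c j)).subst (L j) := by
  classical
  have h1 : ∀ j, seriesDerivation δ ((binom (c j)).subst (L j)) =
      (c j • w j) * (binom (c j)).subst (L j) := by
    intro j
    by_cases hc : c j = 0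
    · have hs := PowerSeries.HasSubst.of_constantCoeff_zero' (hL j)
      have h2 : (1 : PowerSeries K).subst (L j) = 1 := by
        rw [← PowerSeries.coe_substAlgHom hs, map_one]
      rw [hc, binom_zero, h2, Derivation.map_one_eq_zero, zero_smul, zero_mul]
    · exact derivation_binom_subst δ (hL j) (h j hc) (c j)
  induction s using Finset.induction_on with
  | empty => simp
  | insert j s hj ih =>
    rw [Finset.prod_insert hj, Finset.sum_insert hj, Derivation.leibniz, ih, h1]
    simp only [smul_eq_mul]
    ring

end OneVariable

/-! ### Systems without extension vertices -/

section Reduction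

variable {K : Type u} [Field K] {I : Type v}

/-- Keeping all variables only reindexes a series by `Set.univ`. -/
theorem eq_rename_killCompl_univ (f : MvPowerSeries I K) :
    f = MvPowerSeries.rename (Function.Embedding.subtype (· ∈ (Set.univ : Set I)))
      (MvPowerSeries.killCompl (Function.Embedding.subtype (· ∈ (Set.univ : Set I))) f) := by
  ext x
  have hx : Finsupp.embDomain (Function.Embedding.subtype (· ∈ (Set.univ : Set I)))
      (x.comapDomain Subtype.val Subtype.val_injective.injOn) = x := by
    ext i
    have := Finsupp.embDomain_apply_self (Function.Embedding.subtype (· ∈ (Set.univ : Set I)))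
      (x.comapDomain Subtype.val Subtype.val_injective.injOn) ⟨i, trivial⟩
    simpa using this
  rw [← hx, MvPowerSeries.coeff_embDomain_rename, MvPowerSeries.coeff_killCompl]

theorem killCompl_univ_injective : Function.Injective (MvPowerSeries.killCompl (R := K)
    (Function.Embedding.subtype (· ∈ (Set.univ : Set I)))) := by
  intro f g h
  rw [eq_rename_killCompl_univ f, eq_rename_killCompl_univ g, h]

theorem killCompl_pderiv {A : Set I} (x : A) (f : MvPowerSeries I K) :
    MvPowerSeries.killCompl (Function.Embedding.subtype (· ∈ A)) (MvPowerSeries.pderiv K x.1 f) =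
      MvPowerSeries.pderiv K x
        (MvPowerSeries.killCompl (Function.Embedding.subtype (· ∈ A)) f) := by
  ext d
  rw [MvPowerSeries.coeff_killCompl, MvPowerSeries.coeff_pderiv, MvPowerSeries.coeff_pderiv,
    MvPowerSeries.coeff_killCompl]
  have h1 := Finsupp.embDomain_apply_self (Function.Embedding.subtype (· ∈ A)) d x
  rw [Function.Embedding.coe_subtype] at h1
  rw [h1, Finsupp.embDomain_add, Finsupp.embDomain_single]
  rfl

/-- An extension of the whole system at `x` restricts to an extension at `x` on every set of
vertices containing `x`. -/
theorem SDSE.IsExtensionAt.restrict [Fintype I] {F : SDSE K I} {x : I} (h : F.IsExtensionAt x)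
    (A : Set I) [Fintype A] (hx : x ∈ A) : SDSE.IsExtensionAt (F.restrict A) ⟨x, hx⟩ := by
  classical
  obtain ⟨h1, a, ha, hF, h2⟩ := h
  refine ⟨fun i hi hE => hE ?_, fun i => a i, ha, ?_, fun i j hi hj => ?_⟩
  · have h3 : MvPowerSeries.pderiv K x (F i) = 0 :=
      not_not.1 (h1 i fun h => hi (Subtype.ext h))
    rw [SDSE.restrict, ← killCompl_pderiv, h3, map_zero]
  · rw [SDSE.restrict, hF, map_add, map_one, map_sum]
    congr 1
    rw [← Finset.sum_subset (Finset.subset_univ (Finset.univ.filter (· ∈ A)))]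
    · rw [Finset.sum_subtype (p := (· ∈ A)) _ (by simp)]
      refine Finset.sum_congr rfl fun i _ => ?_
      rw [map_smul]
      exact congrArg (a i • ·)
        (MvPowerSeries.killCompl_X (R := K) (e := Function.Embedding.subtype (· ∈ A)) i)
    · intro i _ hi
      rw [map_smul, MvPowerSeries.killCompl_X_eq_zero, smul_zero]
      simpa using hi
  · rw [SDSE.restrict, SDSE.restrict, h2 i j hi hj]

/-- The converse, for the restriction to all vertices, given by a set equal to `Set.univ` and with
its own `Fintype` instance. -/
theorem SDSE.IsExtensionAt.of_restrict_univ [Fintype I] {F : SDSE K I} {A : Set I} [Fintype A]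
    (hA : A = Set.univ) {x : I} (hx : x ∈ A) (h : SDSE.IsExtensionAt (F.restrict A) ⟨x, hx⟩) :
    F.IsExtensionAt x := by
  classical
  subst hA
  obtain ⟨h1, a, ha, hF, h2⟩ := h
  refine ⟨fun i hi hE => hE ?_, fun i => a ⟨i, trivial⟩, ha, ?_, fun i j hi hj => ?_⟩
  · have h3 : MvPowerSeries.pderiv K ⟨x, trivial⟩ (F.restrict Set.univ ⟨i, trivial⟩) = 0 :=
      not_not.1 (h1 ⟨i, trivial⟩ fun h => hi (congrArg Subtype.val h))
    refine killCompl_univ_injective ?_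
    have := killCompl_pderiv (⟨x, trivial⟩ : (Set.univ : Set I)) (F i)
    rw [map_zero]
    exact this.trans h3
  · refine killCompl_univ_injective ?_
    refine Eq.trans hF ?_
    rw [map_add, map_one, map_sum]
    congr 1
    refine Fintype.sum_equiv (Equiv.Set.univ I) _ _ fun i => ?_
    rw [map_smul]
    congr 1
    exact (MvPowerSeries.killCompl_X (R := K) (e := Function.Embedding.subtype _) i).symm
  · exact killCompl_univ_injective (h2 _ _ hi hj)

/-- Without extension vertices, no extension has taken place: the vertex `x` added by the last
extension would be an extension vertex, as extensions at `x` restrict to the set formed by `x` and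
its descendants. -/
theorem isFundamentalAbelian_of_no_extensionVertex [Fintype I] {F : SDSE K I}
    (hab : F.IsExtendedFundamentalAbelian) (hext : ∀ i, ¬ F.IsExtensionVertex i) :
    ∃ _ : Fintype (Set.univ : Set I), SDSE.IsFundamentalAbelian (F.restrict Set.univ) := by
  classical
  have key : ∀ A : Set I, F.IsExtendedOn A → A = Set.univ →
      ∃ _ : Fintype (Set.univ : Set I), SDSE.IsFundamentalAbelian (F.restrict Set.univ) := by
    intro A hA
    cases hA with
    | base _ h => rintro rfl; exact ⟨_, h⟩
    | step B x hx hB h =>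
      intro hu
      exfalso
      refine hext x ?_
      rw [SDSE.IsExtensionVertex]
      refine SDSE.IsExtensionAt.restrict ?_ _ _
      exact SDSE.IsExtensionAt.of_restrict_univ hu _ h
  exact key _ hab rfl

end Reduction

/-! ### The series of an abelian fundamental system -/

section SeriesFormulas

variable {K : Type u} [Field K]

theorem constantCoeff_subst_of_zero {σ τ : Type*} [Finite σ] {A : Type*} [CommRing A] [Algebra K A]
    {a : σ → MvPowerSeries τ A} (ha : ∀ i, MvPowerSeries.constantCoeff (a i) = 0)
    (f : MvPowerSeries σ K) : MvPowerSeries.constantCoeff (MvPowerSeries.subst a f) =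
      algebraMap K A (MvPowerSeries.constantCoeff f) := by
  have hs := MvPowerSeries.hasSubst_of_constantCoeff_zero ha
  have h1 : f = MvPowerSeries.C (MvPowerSeries.constantCoeff f) +
      (f - MvPowerSeries.C (MvPowerSeries.constantCoeff f)) := by ring
  have h2 : MvPowerSeries.subst a (MvPowerSeries.C (MvPowerSeries.constantCoeff f)) =
      algebraMap K (MvPowerSeries τ A) (MvPowerSeries.constantCoeff f) := by
    rw [← MvPowerSeries.coe_substAlgHom hs]
    exact (MvPowerSeries.substAlgHom hs).commutes _
  have h3 := MvPowerSeries.constantCoeff_subst_eq_zero hs ha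
    (f := f - MvPowerSeries.C (MvPowerSeries.constantCoeff f)) (by simp)
  conv_lhs => rw [h1, MvPowerSeries.subst_add hs, map_add, h3, add_zero, h2]
  rw [MvPowerSeries.algebraMap_apply, MvPowerSeries.constantCoeff_C]

theorem constantCoeff_subst_X {J : Type*} (j : J) (f : PowerSeries K) :
    MvPowerSeries.constantCoeff (PowerSeries.subst (MvPowerSeries.X j : MvPowerSeries J K) f) =
      PowerSeries.constantCoeff f :=
  constantCoeff_subst_of_zero (σ := Unit) (fun _ => MvPowerSeries.constantCoeff_X j) f

theorem subst_subst_X {J : Type*} [Finite J] {A : Type*} [CommRing A] [Algebra K A]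
    {L : J → PowerSeries A} (hL : ∀ j, PowerSeries.constantCoeff (L j) = 0) (j : J)
    (f : PowerSeries K) : MvPowerSeries.subst L
      (PowerSeries.subst (MvPowerSeries.X j : MvPowerSeries J K) f) =
      (PowerSeries.subst (L j) f : PowerSeries A) := by
  have hs : MvPowerSeries.HasSubst L := MvPowerSeries.hasSubst_of_constantCoeff_zero hL
  have h1 : MvPowerSeries.HasSubst (fun _ : Unit => (MvPowerSeries.X j : MvPowerSeries J K)) :=
    (PowerSeries.HasSubst.X j).const
  rw [PowerSeries.subst_def, MvPowerSeries.subst_comp_subst_apply h1 hs, PowerSeries.subst_def]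
  simp only [MvPowerSeries.subst_X hs]

/-- With `β = -1`, the series `f_{β / c}(c h)` is `(1 + h)^c`. This includes `c = 0`, where both are
`1`. -/
theorem fSeries_eq {J : Type*} (c : K) (j : J) :
    fSeries (-1 / c) c j = PowerSeries.subst (MvPowerSeries.X j) (binom c) := by
  have h1 : PowerSeries.rescale c (PowerSeries.mk fun k =>
      (∏ m ∈ Finset.range k, (1 + m * (-1 / c))) / (k.factorial : K)) = binom c := by
    ext k
    rw [PowerSeries.coeff_rescale, PowerSeries.coeff_mk, binom, PowerSeries.coeff_mk,
      ← mul_div_assoc]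
    congr 1
    by_cases hc : c = 0
    · subst hc
      rcases k with _ | k
      · simp
      · rw [zero_pow (by omega), zero_mul,
          Finset.prod_eq_zero (Finset.mem_range.2 (Nat.succ_pos k)) (by simp)]
    · rw [← Finset.card_range k, ← Finset.prod_const, Finset.card_range, ← Finset.prod_mul_distrib]
      refine Finset.prod_congr rfl fun m _ => ?_
      field_simp
      ring
  rw [← h1, PowerSeries.rescale_eq_subst, PowerSeries.subst_comp_subst_apply
    (PowerSeries.HasSubst.smul_X' c) (PowerSeries.HasSubst.X j), fSeries]
  congr 1
  rw [← PowerSeries.coe_substAlgHom (PowerSeries.HasSubst.X j), map_smul,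
    PowerSeries.substAlgHom_X]

theorem lnSeries_eq {J : Type*} (j : J) :
    lnSeries (-1 : K) j = PowerSeries.subst (MvPowerSeries.X j) (logOneAdd K) := rfl

theorem subst_X_one {J : Type*} (j : J) :
    PowerSeries.subst (MvPowerSeries.X j : MvPowerSeries J K) (1 : PowerSeries K) = 1 := by
  rw [← PowerSeries.coe_substAlgHom (PowerSeries.HasSubst.X j), map_one]

end SeriesFormulas

namespace FundamentalData

variable {K : Type u} [Field K] {J : Type*}

/-- The scalars `a_j^{(i)}`, `j ∈ I₀`, extended by `0` to all vertices. -/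
def linA (D : FundamentalData K J) (i j : J) : K :=
  match D.kind j with
  | .I0 => D.a i j
  | _ => 0

/-- The scalars `b_j^{(i)}`, `j ∈ I₀`, extended by `0` to all vertices. -/
def expB (D : FundamentalData K J) (i j : J) : K :=
  match D.kind j with
  | .I0 => D.b i j
  | _ => 0

/-- The scalars `a_j^{(i)}`, `j ∈ I₁`, extended by `0` to all vertices. -/
def linU (D : FundamentalData K J) (i j : J) : K :=
  match D.kind j with
  | .I1 => D.a i j
  | _ => 0

variable {D : FundamentalData K J}

theorem kind_eq_I0_of_linA {i j : J} (h : D.linA i j ≠ 0) : D.kind j = .I0 := by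
  unfold linA at h; split at h <;> simp_all

theorem kind_eq_I0_of_expB {i j : J} (h : D.expB i j ≠ 0) : D.kind j = .I0 := by
  unfold expB at h; split at h <;> simp_all

theorem kind_eq_I1_of_linU {i j : J} (h : D.linU i j ≠ 0) : D.kind j = .I1 := by
  unfold linU at h; split at h <;> simp_all

theorem linU_eq {i j : J} (h : D.kind j = .I1) : D.linU i j = D.a i j := by
  unfold linU; rw [h]

variable [Fintype J] [DecidableEq J]

/-- The data of an abelian fundamental system without constant series: `J₀` and `K₀` are empty and
`β_j = -1` for all `j ∈ I₀`. -/
structure IsReducedAbelian (D : FundamentalData K J) : Prop where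
  valid : D.Valid
  kind_cases : ∀ i, D.kind i = .I0 ∨ D.kind i = .I1 ∨ D.kind i = .J1
  β_eq : ∀ j, D.kind j = .I0 → D.β j = -1

variable {D : FundamentalData K J}

theorem IsReducedAbelian.ν_eq_one (h : D.IsReducedAbelian) {i k : J} (hi : D.kind i = .J1)
    (hk : D.linU i k ≠ 0) : D.ν k = 1 := by
  have h1 := kind_eq_I1_of_linU hk
  rw [linU_eq h1] at hk
  exact h.valid.ν_eq_one i k hi h1 hk

/-- A vertex of `J₁` has the same exponents as the vertices of `I₁` on which it depends. -/
theorem IsReducedAbelian.expB_eq (h : D.IsReducedAbelian) {i k : J} (hi : D.kind i = .J1)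
    (hk : D.linU i k ≠ 0) : D.expB i = D.linA k := by
  have h1 := kind_eq_I1_of_linU hk
  rw [linU_eq h1] at hk
  funext j
  unfold expB linA
  split
  · rename_i hj
    exact h.valid.b_eq i k j hi h1 hk (Or.inl hj)
  · rfl

theorem IsReducedAbelian.exists_linU (h : D.IsReducedAbelian) {i : J} (hi : D.kind i = .J1) :
    ∃ k, D.linU i k ≠ 0 := by
  obtain ⟨k, hk, hk'⟩ := h.valid.exists_I1 i hi
  exact ⟨k, by rwa [linU_eq hk]⟩

theorem IsReducedAbelian.series_I0 (h : D.IsReducedAbelian) {i : J} (hi : D.kind i = .I0) :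
    D.series i = 1 + MvPowerSeries.X i := by
  have hX : PowerSeries.subst (MvPowerSeries.X i : MvPowerSeries J K) (binom (1 : K)) =
      1 + MvPowerSeries.X i := by
    rw [binom_one, ← PowerSeries.coe_substAlgHom (PowerSeries.HasSubst.X i), map_add, map_one,
      PowerSeries.substAlgHom_X]
  rw [series, hi]
  dsimp only
  rw [Finset.prod_eq_single i]
  · rw [hi]
    dsimp only
    rw [if_pos rfl, h.β_eq i hi, ← hX, ← fSeries_eq, div_one]
  · intro j _ hj
    rcases h.kind_cases j with hk | hk | hk
    · rw [hk]
      dsimp only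
      rw [if_neg hj, h.β_eq j hk, add_neg_cancel, fSeries_eq, binom_zero, subst_X_one]
    · rw [hk]
    · rw [hk]
  · simp

theorem IsReducedAbelian.series_I1 (h : D.IsReducedAbelian) {i : J} (hi : D.kind i = .I1)
    (hν : D.ν i ≠ 0) :
    D.series i = (D.ν i)⁻¹ • (∏ j, PowerSeries.subst (MvPowerSeries.X j : MvPowerSeries J K)
      (binom (D.ν i * D.linA i j))) + MvPowerSeries.C (1 - (D.ν i)⁻¹) := by
  rw [series, hi]
  dsimp only
  rw [if_pos hν]
  congr 2
  refine Finset.prod_congr rfl fun j _ => ?_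
  unfold linA
  rcases h.kind_cases j with hk | hk | hk
  · rw [hk]
    dsimp only
    rw [h.β_eq j hk, fSeries_eq]
  · rw [hk, mul_zero, binom_zero, subst_X_one]
  · rw [hk, mul_zero, binom_zero, subst_X_one]

theorem IsReducedAbelian.series_I1_zero (h : D.IsReducedAbelian) {i : J} (hi : D.kind i = .I1)
    (hν : D.ν i = 0) :
    D.series i = (∑ j, D.linA i j • PowerSeries.subst (MvPowerSeries.X j : MvPowerSeries J K)
      (logOneAdd K)) + 1 := by
  rw [series, hi]
  dsimp only
  rw [if_neg (not_not.2 hν)]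
  congr 1
  refine Finset.sum_congr rfl fun j _ => ?_
  unfold linA
  rcases h.kind_cases j with hk | hk | hk
  · rw [hk]
    dsimp only
    rw [h.β_eq j hk, lnSeries_eq]
  · rw [hk, zero_smul]
  · rw [hk, zero_smul]

theorem IsReducedAbelian.series_J1 (h : D.IsReducedAbelian) {i : J} (hi : D.kind i = .J1) :
    D.series i = (D.ν i)⁻¹ • (∏ j, PowerSeries.subst (MvPowerSeries.X j : MvPowerSeries J K)
      (binom (D.expB i j))) + (∑ j, D.linU i j • MvPowerSeries.X j) +
      MvPowerSeries.C (1 - (D.ν i)⁻¹) := by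
  rw [series, hi]
  dsimp only
  congr 2
  · congr 1
    refine Finset.prod_congr rfl fun j _ => ?_
    unfold expB
    rcases h.kind_cases j with hk | hk | hk
    · rw [hk]
      dsimp only
      rw [h.β_eq j hk, sub_neg_eq_add, sub_add_cancel, fSeries_eq]
    · rw [hk, binom_zero, subst_X_one]
    · rw [hk, binom_zero, subst_X_one]
  · refine Finset.sum_congr rfl fun j _ => ?_
    unfold linU
    rcases h.kind_cases j with hk | hk | hk
    · rw [hk, zero_smul]
    · rw [hk]
    · rw [hk, zero_smul]

theorem IsReducedAbelian.constantCoeff_series (h : D.IsReducedAbelian) (i : J) :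
    MvPowerSeries.constantCoeff (D.series i) = 1 := by
  rcases h.kind_cases i with hi | hi | hi
  · rw [h.series_I0 hi]; simp
  · by_cases hν : D.ν i = 0
    · rw [h.series_I1_zero hi hν]
      simp [constantCoeff_subst_X, constantCoeff_logOneAdd]
    · rw [h.series_I1 hi hν]
      simp [constantCoeff_subst_X, constantCoeff_binom]
  · rw [h.series_J1 hi]
    simp [constantCoeff_subst_X, constantCoeff_binom]

/-- A vertex of `I₁` depending on no vertex of `I₀` has a constant series. -/
theorem IsReducedAbelian.series_eq_one (h : D.IsReducedAbelian) {i : J} (hi : D.kind i = .I1)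
    (h0 : ∀ j, D.linA i j = 0) : D.series i = 1 := by
  by_cases hν : D.ν i = 0
  · rw [h.series_I1_zero hi hν]
    simp [h0]
  · rw [h.series_I1 hi hν]
    simp only [h0, mul_zero, binom_zero, subst_X_one, Finset.prod_const_one]
    rw [map_sub, map_one, MvPowerSeries.smul_eq_C_mul, mul_one, add_sub_cancel]

/-- If all the scalars `b_j` are zero and no series is constant, then `J₀` and `K₀` are empty:
`b_j = 1` for `j ∈ J₀`, and the series of a vertex of `K₀` is a product of series `(1 + h_j)^0`. -/
theorem isReducedAbelian_of_ne_one (hD : D.Valid) (hb : ∀ j, D.bCoeff j = 0)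
    (h1 : ∀ i, D.series i ≠ 1) : D.IsReducedAbelian := by
  have hβ : ∀ j, D.kind j = .I0 → D.β j = -1 := by
    intro j hj
    have := hb j
    rw [bCoeff, hj] at this
    exact (neg_eq_of_add_eq_zero_right this).symm
  have hJ : ∀ j, D.kind j ≠ .J0 := by
    intro j hj
    have := hb j
    rw [bCoeff, hj] at this
    exact one_ne_zero this
  refine ⟨hD, fun i => ?_, hβ⟩
  rcases hi : D.kind i with _ | _ | _ | _ | _
  · simp
  · exact (hJ i hi).elim
  · refine (h1 i ?_).elim
    rw [series, hi]
    dsimp only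
    refine Finset.prod_eq_one fun j _ => ?_
    rcases hj : D.kind j with _ | _ | _ | _ | _
    · dsimp only
      rw [hβ j hj, add_neg_cancel, fSeries_eq, binom_zero, subst_X_one]
    · exact (hJ j hj).elim
    all_goals rfl
  · simp
  · simp

end FundamentalData

/-! ### Evaluation of changes of variables and dilatations -/

section ChangeOfVariables

variable {K : Type u} [Field K] {I : Type v} [Fintype I]

theorem eval_eq_eval_restrict_univ (F : SDSE K I) (x : I) {A : Type*} [CommRing A] [Algebra K A]
    (X : I → PowerSeries A) (hX : ∀ i, PowerSeries.constantCoeff (X i) = 0) :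
    (MvPowerSeries.subst X (F x) : PowerSeries A) =
      MvPowerSeries.subst (fun i : (Set.univ : Set I) => X i)
        (F.restrict Set.univ ⟨x, trivial⟩) := by
  have hs : MvPowerSeries.HasSubst X := MvPowerSeries.hasSubst_of_constantCoeff_zero hX
  conv_lhs => rw [eq_rename_killCompl_univ (F x), MvPowerSeries.rename_eq_subst,
    MvPowerSeries.subst_comp_subst_apply (MvPowerSeries.HasSubst.X_comp _) hs]
  congr 1
  funext i
  exact MvPowerSeries.subst_X hs _

/-- Evaluation of a change of variables of a dilatation. -/
theorem eval_rescale_dilatation {J : Type*} [Finite J] [DecidableEq J] (π : I → J) (l : I → K)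
    (f : MvPowerSeries J K) {A : Type*} [CommRing A] [Algebra K A]
    (X : I → PowerSeries A) (hX : ∀ i, PowerSeries.constantCoeff (X i) = 0) :
    (MvPowerSeries.subst X (MvPowerSeries.rescale l (MvPowerSeries.subst
      (fun j => ∑ y, if π y = j then (MvPowerSeries.X y : MvPowerSeries I K) else 0) f)) :
        PowerSeries A) =
      MvPowerSeries.subst (fun j => ∑ y, if π y = j then l y • X y else 0) f := by
  have hs : MvPowerSeries.HasSubst X := MvPowerSeries.hasSubst_of_constantCoeff_zero hX
  have h1 : MvPowerSeries.HasSubst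
      (fun j => ∑ y, if π y = j then (MvPowerSeries.X y : MvPowerSeries I K) else 0) := by
    refine MvPowerSeries.hasSubst_of_constantCoeff_zero fun j => ?_
    rw [map_sum]
    refine Finset.sum_eq_zero fun y _ => ?_
    split_ifs <;> simp
  have h2 : MvPowerSeries.HasSubst (l • MvPowerSeries.X : I → MvPowerSeries I K) :=
    MvPowerSeries.HasSubst.smul_X l
  rw [MvPowerSeries.rescale_eq_subst, MvPowerSeries.subst_comp_subst_apply h1 h2,
    MvPowerSeries.subst_comp_subst_apply
      (by simpa only [MvPowerSeries.coe_substAlgHom] using h1.comp h2) hs]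
  congr 1
  funext j
  rw [MvPowerSeries.subst_comp_subst_apply h2 hs]
  have h3 : (fun s => MvPowerSeries.subst X ((l • MvPowerSeries.X : I → MvPowerSeries I K) s)) =
      fun s => (l s • X s : PowerSeries A) := by
    funext s
    rw [Pi.smul_apply', MvPowerSeries.subst_smul hs, MvPowerSeries.subst_X hs]
  rw [h3]
  have h4 : MvPowerSeries.HasSubst (fun s => (l s • X s : PowerSeries A)) :=
    h3 ▸ by simpa only [MvPowerSeries.coe_substAlgHom] using h2.comp hs
  rw [← MvPowerSeries.coe_substAlgHom h4, map_sum]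
  refine Finset.sum_congr rfl fun y _ => ?_
  split_ifs
  · rw [MvPowerSeries.substAlgHom_X]
  · rw [map_zero]

end ChangeOfVariables

/-! ### Presentation of the system -/

section Presentation

variable {K : Type u} [Field K] {I : Type v} [Fintype I]

/-- The sum `∑_y l_y X_y` over the fibre of `j` under `π`. -/
noncomputable def fibreSum {J : Type*} [DecidableEq J] (π : I → J) (l : I → K) {M : Type*}
    [AddCommGroup M] [Module K M] (X : I → M) (j : J) : M :=
  ∑ y, if π y = j then l y • X y else 0

theorem map_fibreSum {J : Type*} [DecidableEq J] (π : I → J) (l : I → K) {M N : Type*}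
    [AddCommGroup M] [Module K M] [AddCommGroup N] [Module K N] (T : M →ₗ[K] N) (X : I → M)
    (j : J) : T (fibreSum π l X j) = fibreSum π l (fun y => T (X y)) j := by
  rw [fibreSum, map_sum]
  refine Finset.sum_congr rfl fun y _ => ?_
  split_ifs <;> simp

/-- `F` is, up to the change of variables with parameters `l`, the dilatation along `π` of the
abelian fundamental system with data `D`; this is recorded through the values `F_x(X)`. -/
structure AbelianPresentation (F : SDSE K I) {J : Type*} [Fintype J] [DecidableEq J]
    (D : FundamentalData K J) (π : I → J) (l : I → K) : Prop where
  surjective : Function.Surjective π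
  l_ne_zero : ∀ i, l i ≠ 0
  reduced : D.IsReducedAbelian
  series_ne_one : ∀ i, D.series i ≠ 1
  eval : ∀ x (X : I → PowerSeries (HTree K I)), (∀ i, PowerSeries.constantCoeff (X i) = 0) →
    (MvPowerSeries.subst X (F x) : PowerSeries (HTree K I)) =
      MvPowerSeries.subst (fibreSum π l X) (D.series (π x))

theorem exists_abelianPresentation {F : SDSE K I}
    (hab : F.IsExtendedFundamentalAbelian) (hext : ∀ i, ¬ F.IsExtensionVertex i) :
    ∃ (n : ℕ) (D : FundamentalData K (Fin n)) (π : I → Fin n) (l : I → K),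
      AbelianPresentation F D π l := by
  obtain ⟨_, hF', n, D, π, G, hD, hb, ⟨hπ, hG⟩, l, m, hlm, hGF⟩ :=
    isFundamentalAbelian_of_no_extensionVertex hab hext
  have hcomp : ∀ x, F.restrict Set.univ x = m x • MvPowerSeries.rescale l (MvPowerSeries.subst
      (fun j => ∑ y, if π y = j then (MvPowerSeries.X y : MvPowerSeries _ K) else 0)
        (D.series (π x))) := fun x => by rw [hGF, hG]
  have hzero : ∀ j, MvPowerSeries.constantCoeff
      (∑ y, if π y = j then (MvPowerSeries.X y : MvPowerSeries (Set.univ : Set I) K) else 0) =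
        0 := by
    intro j
    rw [map_sum]
    refine Finset.sum_eq_zero fun y _ => ?_
    split_ifs <;> simp
  have hone : ∀ i, D.series i ≠ 1 := by
    intro i hi
    obtain ⟨x, rfl⟩ := hπ i
    refine (hF' x).2 ?_
    rw [hcomp, hi, ← MvPowerSeries.coe_substAlgHom
      (MvPowerSeries.hasSubst_of_constantCoeff_zero hzero), map_one, map_one,
      MvPowerSeries.smul_eq_C_mul, mul_one, MvPowerSeries.constantCoeff_C]
  have hR := FundamentalData.isReducedAbelian_of_ne_one hD hb hone
  -- The constant terms are all `1`, hence so are the factors `μ_i`.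
  have hm : ∀ x, m x = 1 := by
    intro x
    have h1 := (hF' x).1
    rw [hcomp, MvPowerSeries.smul_eq_C_mul, map_mul, MvPowerSeries.constantCoeff_C,
      ← MvPowerSeries.coeff_zero_eq_constantCoeff_apply, MvPowerSeries.coeff_rescale,
      MvPowerSeries.coeff_zero_eq_constantCoeff_apply, constantCoeff_subst_of_zero hzero,
      hR.constantCoeff_series] at h1
    simpa using h1
  refine ⟨n, D, fun x => π ⟨x, trivial⟩, fun x => l ⟨x, trivial⟩, ?_, fun i => (hlm _).1, hR, hone,
    fun x X hX => ?_⟩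
  · intro j
    obtain ⟨x, rfl⟩ := hπ j
    exact ⟨x.1, rfl⟩
  · rw [eval_eq_eval_restrict_univ F x X hX, hcomp, hm, one_smul]
    rw [eval_rescale_dilatation π l (D.series (π ⟨x, trivial⟩)) (fun i => X i) (fun i => hX i)]
    congr 1
    funext j
    exact Fintype.sum_equiv (Equiv.Set.univ I) _ _ fun y => rfl

end Presentation

/-! ### The series of the solution -/

section Evaluation

variable {K : Type u} [Field K] {I : Type v} [Fintype I] {J : Type*} [DecidableEq J]
  {F : SDSE K I} {D : FundamentalData K J} {π : I → J} {l : I → K}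

/-- The generating series `∑ X_x(n) tⁿ` of the solution. -/
noncomputable def solSeries (F : SDSE K I) (x : I) : PowerSeries (HTree K I) := gen (F.sol x)

@[simp] theorem coeff_solSeries (x : I) (n : ℕ) :
    PowerSeries.coeff n (solSeries F x) = F.sol x n := by
  simp [solSeries, gen]

theorem constantCoeff_solSeries (x : I) : PowerSeries.constantCoeff (solSeries F x) = 0 := by
  rw [← PowerSeries.coeff_zero_eq_constantCoeff_apply, coeff_solSeries]
  exact F.isSolution_sol.zero x

/-- The series `∑_y l_y X_y` attached to the fibre of `j`. -/
noncomputable def fibreSeries (F : SDSE K I) (π : I → J) (l : I → K) (j : J) :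
    PowerSeries (HTree K I) :=
  fibreSum π l (solSeries F) j

theorem coeff_fibreSeries (j : J) (n : ℕ) :
    PowerSeries.coeff n (fibreSeries F π l j) = fibreSum π l (fun x => F.sol x n) j := by
  refine (map_fibreSum π l ((PowerSeries.coeff n).restrictScalars K) (solSeries F) j).trans ?_
  simp

theorem constantCoeff_fibreSeries (j : J) :
    PowerSeries.constantCoeff (fibreSeries F π l j) = 0 := by
  rw [← PowerSeries.coeff_zero_eq_constantCoeff_apply, coeff_fibreSeries]
  simp [fibreSum, F.isSolution_sol.zero]

/-- The series `F_x(X)`. -/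
noncomputable def evalSeries (F : SDSE K I) (x : I) : PowerSeries (HTree K I) :=
  MvPowerSeries.subst (solSeries F) (F x)

/-- The equation of the system. The factor `t` accounts for the root added by `B⁺_x`. -/
theorem solSeries_eq (x : I) :
    solSeries F x = PowerSeries.X * coeffMap (bPlus K x) (evalSeries F x) := by
  ext1 n
  cases n with
  | zero => simpa using F.isSolution_sol.zero x
  | succ n =>
    rw [coeff_solSeries, PowerSeries.coeff_succ_X_mul, coeff_coeffMap, F.isSolution_sol.succ]
    rfl

namespace AbelianPresentation

variable [Fintype J] (P : AbelianPresentation F D π l)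
include P

theorem evalSeries_eq (x : I) : evalSeries F x =
    MvPowerSeries.substAlgHom (R := K) (MvPowerSeries.hasSubst_of_constantCoeff_zero
      (a := fibreSeries F π l) constantCoeff_fibreSeries) (D.series (π x)) := by
  rw [evalSeries, P.eval x _ constantCoeff_solSeries, MvPowerSeries.coe_substAlgHom]
  rfl

theorem evalSeries_I0 {x : I} (hx : D.kind (π x) = .I0) :
    evalSeries F x = 1 + fibreSeries F π l (π x) := by
  rw [P.evalSeries_eq, P.reduced.series_I0 hx, map_add, map_one, MvPowerSeries.substAlgHom_X]

end AbelianPresentation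

end Evaluation

/-! ### Derivatives of the evaluated series -/

section Derivations

variable {K : Type u} [Field K] {I : Type v} [Fintype I] {J : Type*} [DecidableEq J]
  {F : SDSE K I} {D : FundamentalData K J} {π : I → J} {l : I → K}

namespace AbelianPresentation

theorem substAlgHom_subst_X [Finite J] (j : J) (f : PowerSeries K) :
    MvPowerSeries.substAlgHom (R := K) (MvPowerSeries.hasSubst_of_constantCoeff_zero
      (a := fibreSeries F π l) constantCoeff_fibreSeries)
      (PowerSeries.subst (MvPowerSeries.X j : MvPowerSeries J K) f) =
      (PowerSeries.subst (fibreSeries F π l j) f : PowerSeries (HTree K I)) := by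
  rw [MvPowerSeries.coe_substAlgHom]
  exact subst_subst_X constantCoeff_fibreSeries j f

theorem substAlgHom_C [Finite J] (c : K) :
    MvPowerSeries.substAlgHom (R := K) (MvPowerSeries.hasSubst_of_constantCoeff_zero
      (a := fibreSeries F π l) constantCoeff_fibreSeries) (MvPowerSeries.C c) =
      c • (1 : PowerSeries (HTree K I)) := by
  have h : (MvPowerSeries.C c : MvPowerSeries J K) = c • 1 := by
    rw [MvPowerSeries.smul_eq_C_mul, mul_one]
  rw [h, map_smul, map_one]

variable [Fintype J] (P : AbelianPresentation F D π l)
include P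

theorem evalSeries_I1 {x : I} (hx : D.kind (π x) = .I1) (hν : D.ν (π x) ≠ 0) :
    evalSeries F x = (D.ν (π x))⁻¹ • (∏ j, (PowerSeries.subst (fibreSeries F π l j)
      (binom (D.ν (π x) * D.linA (π x) j)) : PowerSeries (HTree K I))) +
      (1 - (D.ν (π x))⁻¹) • (1 : PowerSeries (HTree K I)) := by
  rw [P.evalSeries_eq, P.reduced.series_I1 hx hν, map_add, map_smul, map_prod, substAlgHom_C]
  simp only [substAlgHom_subst_X]

theorem evalSeries_I1_zero {x : I} (hx : D.kind (π x) = .I1) (hν : D.ν (π x) = 0) :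
    evalSeries F x = (∑ j, D.linA (π x) j • (PowerSeries.subst (fibreSeries F π l j)
      (logOneAdd K) : PowerSeries (HTree K I))) + 1 := by
  rw [P.evalSeries_eq, P.reduced.series_I1_zero hx hν, map_add, map_sum, map_one]
  simp only [map_smul, substAlgHom_subst_X]

theorem evalSeries_J1 {x : I} (hx : D.kind (π x) = .J1) :
    evalSeries F x = (D.ν (π x))⁻¹ • (∏ j, (PowerSeries.subst (fibreSeries F π l j)
      (binom (D.expB (π x) j)) : PowerSeries (HTree K I))) +
      (∑ j, D.linU (π x) j • fibreSeries F π l j) +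
      (1 - (D.ν (π x))⁻¹) • (1 : PowerSeries (HTree K I)) := by
  rw [P.evalSeries_eq, P.reduced.series_J1 hx, map_add, map_add, map_smul, map_prod, map_sum,
    substAlgHom_C]
  simp only [map_smul, substAlgHom_subst_X, MvPowerSeries.substAlgHom_X]

variable [CharZero K] (δ : Derivation K (HTree K I) (HTree K I)) {w : J → PowerSeries (HTree K I)}
  (hw : ∀ j, D.kind j = .I0 →
    seriesDerivation δ (fibreSeries F π l j) = (1 + fibreSeries F π l j) * w j)
include hw

/-- The logarithmic derivatives of the `1 + L_j` determine the derivative of `F_x(X)`, `x ∈ I₁`. -/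
theorem derivation_evalSeries_I1 {x : I} (hx : D.kind (π x) = .I1) :
    seriesDerivation δ (evalSeries F x) = (∑ j, D.linA (π x) j • w j) *
      (D.ν (π x) • evalSeries F x + (1 - D.ν (π x)) • (1 : PowerSeries (HTree K I))) := by
  by_cases hν : D.ν (π x) = 0
  · rw [P.evalSeries_I1_zero hx hν, hν, zero_smul, zero_add, sub_zero, one_smul, mul_one, map_add,
      Derivation.map_one_eq_zero, add_zero, map_sum]
    refine Finset.sum_congr rfl fun j _ => ?_
    rw [Derivation.map_smul]
    by_cases hj : D.linA (π x) j = 0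
    · rw [hj, zero_smul, zero_smul]
    · rw [derivation_logOneAdd_subst δ (constantCoeff_fibreSeries j)
        (hw j (FundamentalData.kind_eq_I0_of_linA hj))]
  · have h1 := derivation_prod_binom δ Finset.univ (L := fibreSeries F π l) (w := w)
      (c := fun j => D.ν (π x) * D.linA (π x) j) constantCoeff_fibreSeries
      (fun j hj => hw j (FundamentalData.kind_eq_I0_of_linA (right_ne_zero_of_mul hj)))
    have h2 : ∑ j, (D.ν (π x) * D.linA (π x) j) • w j = D.ν (π x) • ∑ j, D.linA (π x) j • w j := by
      rw [Finset.smul_sum]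
      exact Finset.sum_congr rfl fun j _ => mul_smul _ _ _
    rw [P.evalSeries_I1 hx hν, map_add, Derivation.map_smul, Derivation.map_smul,
      Derivation.map_one_eq_zero, h1, h2, smul_zero, add_zero, smul_mul_assoc,
      inv_smul_smul₀ hν, smul_add, smul_inv_smul₀ hν, add_assoc, smul_smul, ← add_smul,
      show D.ν (π x) * (1 - (D.ν (π x))⁻¹) + (1 - D.ν (π x)) = 0 by field_simp; ring,
      zero_smul, add_zero]

/-- The logarithmic derivatives of the `1 + L_j` and the derivatives of the `L_k`, `k ∈ I₁`,
determine the derivative of `F_x(X)`, `x ∈ J₁`. -/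
theorem derivation_evalSeries_J1 {x : I} (hx : D.kind (π x) = .J1) :
    seriesDerivation δ (evalSeries F x) = (∑ j, D.expB (π x) j • w j) *
      (evalSeries F x - (∑ k, D.linU (π x) k • fibreSeries F π l k) +
        ((D.ν (π x))⁻¹ - 1) • (1 : PowerSeries (HTree K I))) +
      ∑ k, D.linU (π x) k • seriesDerivation δ (fibreSeries F π l k) := by
  have h1 := derivation_prod_binom δ Finset.univ (L := fibreSeries F π l) (w := w)
      (c := fun j => D.expB (π x) j) constantCoeff_fibreSeries
      (fun j hj => hw j (FundamentalData.kind_eq_I0_of_expB hj))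
  rw [P.evalSeries_J1 hx]
  simp only [map_add, Derivation.map_smul, Derivation.map_one_eq_zero, h1, smul_zero, add_zero,
    map_sum]
  congr 1
  rw [add_sub_right_comm, add_sub_cancel_right, add_assoc, ← add_smul, sub_add_sub_cancel,
    sub_self, zero_smul, add_zero, mul_smul_comm]

end AbelianPresentation

end Derivations

/-! ### Action of the infinitesimal characters on the solution -/

section InfinitesimalCharacters

variable {K : Type u} [Field K] {I : Type v} [Fintype I] {J : Type*} [DecidableEq J]
  {F : SDSE K I} {D : FundamentalData K J} {π : I → J} {l : I → K}

/-- The series `∑ φ(X_x(n)) tⁿ` of the values of a linear form on the solution. -/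
noncomputable def valSeries (F : SDSE K I) (φ : HTree K I →ₗ[K] K) (x : I) : PowerSeries K :=
  coeffMap φ (solSeries F x)

/-- The series `•_x t`. -/
noncomputable def rootSeries (K : Type u) [Field K] (x : I) : PowerSeries (HTree K I) :=
  PowerSeries.X * coeffMap (bPlus K x) 1

theorem scal_smul {K A : Type*} [Field K] [CommRing A] [Algebra K A] (c : K) (p : PowerSeries K) :
    scal A (c • p) = c • scal A p := by
  ext n
  have h : PowerSeries.coeff n (c • PowerSeries.map (algebraMap K A) p) =
      c • PowerSeries.coeff n (PowerSeries.map (algebraMap K A) p) := by simp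
  have h' : PowerSeries.coeff n (c • p) = c * PowerSeries.coeff n p := by simp
  rw [scal, scal, h, PowerSeries.coeff_map, PowerSeries.coeff_map, h', map_mul, Algebra.smul_def]

theorem scal_sum {K A ι : Type*} [Field K] [CommRing A] [Algebra K A] (s : Finset ι)
    (p : ι → PowerSeries K) : scal A (∑ i ∈ s, p i) = ∑ i ∈ s, scal A (p i) := map_sum _ _ _

theorem scal_fibreSum {A : Type*} [CommRing A] [Algebra K A] (p : I → PowerSeries K) (j : J) :
    scal A (fibreSum π l p j) = fibreSum π l (fun y => scal A (p y)) j := by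
  rw [fibreSum, scal_sum]
  refine Finset.sum_congr rfl fun y _ => ?_
  split_ifs
  · rw [scal_smul]
  · exact map_zero _

theorem fibreSum_congr {M : Type*} [AddCommGroup M] [Module K M] {X Y : I → M} {j : J}
    (h : ∀ y, π y = j → X y = Y y) : fibreSum π l X j = fibreSum π l Y j := by
  refine Finset.sum_congr rfl fun y _ => ?_
  split_ifs with hy
  · rw [h y hy]
  · rfl

variable {φ : HTree K I →ₗ[K] K} (hφ : IsInfChar φ)

/-- The cocycle property of `B⁺_x`, applied to the equation `X_x = t B⁺_x(F_x(X))`. -/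
theorem derivation_solSeries (x : I) : seriesDerivation hφ.derivation (solSeries F x) =
    scal _ (valSeries F φ x) +
      PowerSeries.X * coeffMap (bPlus K x) (seriesDerivation hφ.derivation (evalSeries F x)) := by
  ext1 n
  cases n with
  | zero =>
    rw [map_add, coeff_seriesDerivation, scal, PowerSeries.coeff_map, valSeries, coeff_coeffMap]
    simp [F.isSolution_sol.zero]
  | succ n =>
    simp only [coeff_seriesDerivation, map_add, PowerSeries.coeff_succ_X_mul, coeff_coeffMap,
      scal, PowerSeries.coeff_map, valSeries]
    have h : PowerSeries.coeff (n + 1) (solSeries F x) =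
        bPlus K x (PowerSeries.coeff n (evalSeries F x)) := by
      rw [coeff_solSeries, F.isSolution_sol.succ]
      rfl
    rw [h, hφ.derivation_bPlus]

namespace AbelianPresentation

variable [Fintype J] (P : AbelianPresentation F D π l)
include P

/-- For `j ∈ I₀`, the derivation `(φ ⊗ id) ∘ Δ` multiplies `1 + L_j` by the scalar series
`φ(L_j)`. -/
theorem derivation_fibreSeries_I0 {j : J} (hj : D.kind j = .I0) :
    seriesDerivation hφ.derivation (fibreSeries F π l j) =
      (1 + fibreSeries F π l j) * scal _ (fibreSum π l (valSeries F φ) j) := by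
  set B : HTree K I →ₗ[K] HTree K I := fibreSum π l (fun y => bPlus K y) j with hB
  have hBa : ∀ z, PowerSeries.X * coeffMap B z =
      fibreSum π l (fun y => PowerSeries.X * coeffMap (bPlus K y) z) j := by
    intro z
    ext1 n
    cases n with
    | zero =>
      rw [fibreSum, map_sum, Finset.sum_eq_zero]
      · simp
      · intro y _
        split_ifs <;> simp
    | succ n =>
      rw [fibreSum, map_sum, PowerSeries.coeff_succ_X_mul, coeff_coeffMap, hB, fibreSum,
        LinearMap.sum_apply]
      refine Finset.sum_congr rfl fun y _ => ?_
      split_ifs <;> simp [PowerSeries.coeff_succ_X_mul]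
  have hL : fibreSeries F π l j = PowerSeries.X * coeffMap B (1 + fibreSeries F π l j) := by
    rw [hBa, fibreSeries]
    refine fibreSum_congr fun y hy => ?_
    rw [solSeries_eq, P.evalSeries_I0 (by rw [hy, hj]), hy]
    rfl
  -- Both sides are fixed points of the contraction `z ↦ φ(L_j) + t B(z)`.
  have h1 : seriesDerivation hφ.derivation (fibreSeries F π l j) =
      scal _ (fibreSum π l (valSeries F φ) j) +
        PowerSeries.X * coeffMap B (seriesDerivation hφ.derivation (fibreSeries F π l j)) := by
    rw [hBa, scal_fibreSum]
    conv_lhs => rw [fibreSeries, ← Derivation.coeFn_coe, map_fibreSum]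
    rw [fibreSum, fibreSum, fibreSum, ← Finset.sum_add_distrib]
    refine Finset.sum_congr rfl fun y _ => ?_
    split_ifs with hy
    · rw [Derivation.coeFn_coe, derivation_solSeries, P.evalSeries_I0 (by rw [hy, hj]), map_add,
        Derivation.map_one_eq_zero, zero_add, hy, smul_add]
    · rw [add_zero]
  have h2 : (1 + fibreSeries F π l j) * scal _ (fibreSum π l (valSeries F φ) j) =
      scal _ (fibreSum π l (valSeries F φ) j) +
        PowerSeries.X * coeffMap B
          ((1 + fibreSeries F π l j) * scal _ (fibreSum π l (valSeries F φ) j)) := by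
    rw [mul_comm (1 + fibreSeries F π l j), coeffMap_scal_mul, mul_left_comm, ← hL, mul_add,
      mul_one]
  ext1 n
  induction n with
  | zero => rw [h1, h2]; simp
  | succ n ih =>
    rw [h1, h2]
    simp only [map_add, PowerSeries.coeff_succ_X_mul, coeff_coeffMap, ih]

theorem derivation_solSeries_I0 {x : I} (hx : D.kind (π x) = .I0) :
    seriesDerivation hφ.derivation (solSeries F x) = scal _ (valSeries F φ x) +
      scal _ (fibreSum π l (valSeries F φ) (π x)) * solSeries F x := by
  rw [derivation_solSeries, P.evalSeries_I0 hx, map_add, Derivation.map_one_eq_zero, zero_add,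
    P.derivation_fibreSeries_I0 hφ hx, mul_comm (1 + _), coeffMap_scal_mul]
  conv_rhs => rw [solSeries_eq, P.evalSeries_I0 hx]
  ring

variable [CharZero K]

theorem derivation_solSeries_I1 {x : I} (hx : D.kind (π x) = .I1) :
    seriesDerivation hφ.derivation (solSeries F x) = scal _ (valSeries F φ x) +
      scal _ (∑ j, D.linA (π x) j • fibreSum π l (valSeries F φ) j) *
        (D.ν (π x) • solSeries F x + (1 - D.ν (π x)) • rootSeries K x) := by
  have h := P.derivation_evalSeries_I1 hφ.derivation
    (w := fun j => scal _ (fibreSum π l (valSeries F φ) j))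
    (fun j hj => P.derivation_fibreSeries_I0 hφ hj) hx
  simp only [← scal_smul, ← scal_sum] at h
  rw [derivation_solSeries, h, coeffMap_scal_mul, map_add, map_smul, map_smul, mul_left_comm,
    mul_add, mul_smul_comm, mul_smul_comm, ← solSeries_eq]
  rfl

theorem derivation_solSeries_J1 {x : I} (hx : D.kind (π x) = .J1) :
    seriesDerivation hφ.derivation (solSeries F x) = scal _ (valSeries F φ x) +
      scal _ (∑ j, D.expB (π x) j • fibreSum π l (valSeries F φ) j) *
        (solSeries F x + ((D.ν (π x))⁻¹ - 1) • rootSeries K x) +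
      scal _ (∑ k, D.linU (π x) k • fibreSum π l (valSeries F φ) k) * rootSeries K x := by
  have h := P.derivation_evalSeries_J1 hφ.derivation
    (w := fun j => scal _ (fibreSum π l (valSeries F φ) j))
    (fun j hj => P.derivation_fibreSeries_I0 hφ hj) hx
  set B := ∑ j, D.expB (π x) j • fibreSum π l (valSeries F φ) j with hB
  -- The vertices of `I₁^{(i)}` have `ν = 1` and the exponents of `x`.
  have hk : ∀ k, D.linU (π x) k • seriesDerivation hφ.derivation (fibreSeries F π l k) =
      D.linU (π x) k • (scal _ (fibreSum π l (valSeries F φ) k) +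
        scal _ B * fibreSeries F π l k) := by
    intro k
    by_cases h0 : D.linU (π x) k = 0
    · rw [h0, zero_smul, zero_smul]
    · have hk1 := FundamentalData.kind_eq_I1_of_linU h0
      congr 1
      rw [fibreSeries, ← Derivation.coeFn_coe, map_fibreSum, scal_fibreSum, fibreSum, fibreSum,
        fibreSum, Finset.mul_sum, ← Finset.sum_add_distrib]
      refine Finset.sum_congr rfl fun y _ => ?_
      split_ifs with hy
      · rw [Derivation.coeFn_coe, P.derivation_solSeries_I1 hφ (by rw [hy, hk1]), hy,
          P.reduced.ν_eq_one hx h0, one_smul, sub_self, zero_smul, add_zero, hB,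
          P.reduced.expB_eq hx h0, smul_add, mul_smul_comm]
      · rw [mul_zero, add_zero]
  have h' : seriesDerivation hφ.derivation (evalSeries F x) =
      scal _ B * (evalSeries F x + ((D.ν (π x))⁻¹ - 1) • (1 : PowerSeries (HTree K I))) +
      scal _ (∑ k, D.linU (π x) k • fibreSum π l (valSeries F φ) k) * 1 := by
    simp only [← scal_smul, ← scal_sum] at h
    rw [h, Finset.sum_congr rfl fun k _ => hk k]
    simp only [smul_add, Finset.sum_add_distrib, ← scal_smul, ← scal_sum, ← mul_smul_comm,
      ← Finset.mul_sum]
    ring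
  rw [derivation_solSeries, h', map_add, coeffMap_scal_mul, coeffMap_scal_mul, map_add, map_smul,
    mul_add, mul_left_comm, mul_add, mul_left_comm, mul_smul_comm, ← solSeries_eq, ← add_assoc]
  rfl

end AbelianPresentation

end InfinitesimalCharacters

/-! ### Trees and forests -/

section Trees

variable {D : Type v}

/-- The trees of a planar forest. -/
def PForest.trees : PForest D → Multiset (RTree D)
  | .nil => 0
  | .cons d c r => ⟨d, Forest.mk c⟩ ::ₘ r.trees

theorem PForest.Rel.trees_eq {a b : PForest D} (h : PForest.Rel a b) : a.trees = b.trees := by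
  induction h with
  | refl => rfl
  | symm _ ih => exact ih.symm
  | trans _ _ ih ih' => exact ih.trans ih'
  | cons d h h' ih ih' => simp only [PForest.trees, ih', Forest.mk_eq h]
  | swap d e a b c => exact Multiset.cons_swap _ _ _

/-- The trees of a forest. -/
def Forest.trees (f : Forest D) : Multiset (RTree D) :=
  f.lift PForest.trees (fun _ _ h => h.trees_eq)

theorem Forest.trees_ofTrees (s : Multiset (RTree D)) : (Forest.ofTrees s).trees = s := by
  induction s using Multiset.induction with
  | empty => rfl
  | cons t s ih =>
    obtain ⟨d, c⟩ := t
    rw [Forest.ofTrees_cons]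
    conv_rhs => rw [← ih]
    generalize Forest.ofTrees s = f
    induction c using Forest.ind
    induction f using Forest.ind
    rfl

theorem RTree.graft_inj {d e : D} {s t : Multiset (RTree D)} :
    RTree.graft d s = RTree.graft e t ↔ d = e ∧ s = t := by
  constructor
  · intro h
    refine ⟨congrArg RTree.root h, ?_⟩
    rw [← Forest.trees_ofTrees s, ← Forest.trees_ofTrees t]
    exact congrArg (fun t => t.children.trees) h
  · rintro ⟨rfl, rfl⟩
    rfl

variable {K : Type u} [Field K]

theorem treeCoeff_mon [DecidableEq (RTree D)] (t : RTree D) (s : Multiset (RTree D)) :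
    treeCoeff (K := K) t (mon K s) = if s = {t} then 1 else 0 := by
  rw [treeCoeff, mon_eq_monomial, MvPolynomial.lcoeff_apply, MvPolynomial.coeff_monomial]
  refine if_congr ?_ rfl rfl
  rw [← Multiset.toFinsupp_singleton]
  exact Multiset.toFinsupp.injective.eq_iff

theorem treeCoeff_bPlus_of_ne {t : RTree D} {d : D} (h : t.root ≠ d) (z : HTree K D) :
    treeCoeff t (bPlus K d z) = 0 := by
  classical
  have hz : z ∈ Submodule.span K (Set.range (mon K (D := D))) := by rw [span_mon]; trivial
  induction hz using Submodule.span_induction with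
  | mem x hx =>
    obtain ⟨s, rfl⟩ := hx
    rw [bPlus_mon, treeCoeff_X, if_neg]
    rintro rfl
    exact h rfl
  | zero => simp
  | add x y _ _ hx hy => rw [map_add, map_add, hx, hy, add_zero]
  | smul a x _ hx => rw [map_smul, map_smul, hx, smul_zero]

theorem treeCoeff_graft_bPlus (t : RTree D) (d : D) (z : HTree K D) :
    treeCoeff (RTree.graft d {t}) (bPlus K d z) = treeCoeff t z := by
  classical
  have hz : z ∈ Submodule.span K (Set.range (mon K (D := D))) := by rw [span_mon]; trivial
  induction hz using Submodule.span_induction with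
  | mem x hx =>
    obtain ⟨s, rfl⟩ := hx
    rw [bPlus_mon, treeCoeff_X, treeCoeff_mon]
    exact if_congr (by simp [RTree.graft_inj]) rfl rfl
  | zero => simp
  | add x y _ _ hx hy => simp only [map_add, hx, hy]
  | smul a x _ hx => simp only [map_smul, hx]

end Trees

/-! ### Nonvanishing of the components of the solution -/

section LinearPart

variable {K : Type u} [Field K] {I : Type v}

/-- The coefficientwise extension of the counit. -/
noncomputable def counitSeries (K : Type u) [Field K] (I : Type v) :
    PowerSeries (HTree K I) →+* PowerSeries K :=
  PowerSeries.map (counitTree K (D := I)).toRingHom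

theorem coeff_counitSeries (z : PowerSeries (HTree K I)) (n : ℕ) :
    PowerSeries.coeff n (counitSeries K I z) = counitTree K (PowerSeries.coeff n z) := by
  simp [counitSeries]

theorem counitSeries_smul (c : K) (z : PowerSeries (HTree K I)) :
    counitSeries K I (c • z) = c • counitSeries K I z := by
  ext n
  have h1 : PowerSeries.coeff n (c • z) = c • PowerSeries.coeff n z := by simp
  have h2 : PowerSeries.coeff n (c • counitSeries K I z) =
      c • PowerSeries.coeff n (counitSeries K I z) := by simp
  rw [coeff_counitSeries, h1, h2, map_smul, coeff_counitSeries]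

theorem counitSeries_subst {L : PowerSeries (HTree K I)} (hL : PowerSeries.constantCoeff L = 0)
    (h : counitSeries K I L = 0) (f : PowerSeries K) :
    counitSeries K I (PowerSeries.subst L f) = PowerSeries.C (PowerSeries.constantCoeff f) := by
  have hs := PowerSeries.HasSubst.of_constantCoeff_zero' hL
  have h1 := congrArg (PowerSeries.substAlgHom (R := K) hs) (PowerSeries.eq_X_mul_shift_add_const f)
  have h2 : PowerSeries.substAlgHom (R := K) hs (PowerSeries.C (PowerSeries.constantCoeff f)) =
      (PowerSeries.constantCoeff f) • 1 := by
    rw [← map_one (PowerSeries.substAlgHom (R := K) hs), ← map_smul, PowerSeries.smul_eq_C_mul,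
      mul_one]
  rw [map_add, map_mul, h2, PowerSeries.substAlgHom_X, PowerSeries.coe_substAlgHom] at h1
  rw [h1, map_add, map_mul, h, zero_mul, zero_add, counitSeries_smul, map_one,
    PowerSeries.smul_eq_C_mul, mul_one]

/-- The derivation `∂/∂t` allows linear parts to be computed as logarithmic derivatives. -/
theorem coeffMap_treeCoeff (t : RTree I) (z : PowerSeries (HTree K I)) :
    coeffMap (treeCoeff t) z =
      counitSeries K I (seriesDerivation (MvPolynomial.pderiv t) z) := by
  ext n
  rw [coeff_coeffMap, coeff_counitSeries, coeff_seriesDerivation, treeCoeff_eq]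

variable [Fintype I] {J : Type*} [DecidableEq J]
  {F : SDSE K I} {D : FundamentalData K J} {π : I → J} {l : I → K}

theorem treeCoeff_sol_of_ne {t : RTree I} {x : I} {n : ℕ} (h : t.root ≠ x ∨ t.weight ≠ n) :
    treeCoeff t (F.sol x n) = 0 := by
  rcases h with h | h
  · cases n with
    | zero => rw [F.isSolution_sol.zero, map_zero]
    | succ n => rw [F.isSolution_sol.succ, treeCoeff_bPlus_of_ne h]
  · by_contra h0
    have := F.isSolution_sol.isHomog x n h0
    rw [Finsupp.weight_single, one_smul] at this
    exact h this

theorem counitSeries_solSeries (x : I) : counitSeries K I (solSeries F x) = 0 := by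
  ext n
  rw [coeff_counitSeries, coeff_solSeries]
  cases n with
  | zero => rw [F.isSolution_sol.zero, map_zero, map_zero]
  | succ n => rw [F.isSolution_sol.succ, counitTree_bPlus, map_zero]

theorem counitSeries_fibreSeries (j : J) : counitSeries K I (fibreSeries F π l j) = 0 := by
  rw [fibreSeries, fibreSum, map_sum]
  refine Finset.sum_eq_zero fun y _ => ?_
  split_ifs
  · rw [counitSeries_smul, counitSeries_solSeries, smul_zero]
  · rw [map_zero]

namespace AbelianPresentation

variable [Fintype J] (P : AbelianPresentation F D π l)
include P

theorem sol_one (x : I) : F.sol x 1 = MvPolynomial.X (RTree.graft x 0) := by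
  have h1 : MvPowerSeries.constantCoeff (evalSeries F x) = 1 := by
    rw [P.evalSeries_eq, MvPowerSeries.coe_substAlgHom,
      constantCoeff_subst_of_zero constantCoeff_fibreSeries, P.reduced.constantCoeff_series,
      map_one]
  have h2 : evalComponent (F x) F.sol 0 = mon K 0 := by
    refine Eq.trans ?_ (h1.trans (by simp [mon]))
    exact PowerSeries.coeff_zero_eq_constantCoeff_apply _
  rw [F.isSolution_sol.succ, h2, bPlus_mon]

variable [CharZero K]

/-- The linear part of `F_x(X)` is a nontrivial linear combination of those of the `L_j`. For
`x ∈ I₁`, this is where the series of the system have to be nonconstant. -/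
theorem exists_linear_part (x : I) : ∃ c : J → K, (∃ j, c j ≠ 0) ∧
    ∀ t : RTree I, coeffMap (treeCoeff t) (evalSeries F x) =
      ∑ j, c j • coeffMap (treeCoeff t) (fibreSeries F π l j) := by
  have hunit : ∀ j, PowerSeries.constantCoeff (1 + fibreSeries F π l j) =
      ((1 : (HTree K I)ˣ) : HTree K I) := by
    intro j
    rw [map_add, constantCoeff_fibreSeries, map_one, add_zero, Units.val_one]
  -- The logarithmic derivative of `1 + L_j` along `∂/∂t`.
  let w : RTree I → J → PowerSeries (HTree K I) := fun t j =>
    PowerSeries.invOfUnit (1 + fibreSeries F π l j) 1 *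
      seriesDerivation (MvPolynomial.pderiv t) (fibreSeries F π l j)
  have hw : ∀ t j, seriesDerivation (MvPolynomial.pderiv t) (fibreSeries F π l j) =
      (1 + fibreSeries F π l j) * w t j := by
    intro t j
    rw [← mul_assoc, PowerSeries.mul_invOfUnit _ _ (hunit j), one_mul]
  have hEw : ∀ t j, counitSeries K I (w t j) = coeffMap (treeCoeff t) (fibreSeries F π l j) := by
    intro t j
    rw [coeffMap_treeCoeff, hw t j, map_mul (counitSeries K I) (1 + _), map_add, map_one,
      counitSeries_fibreSeries, add_zero, one_mul]
  have hsub : ∀ (s : Finset J) (c : J → K), counitSeries K I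
      (∏ j ∈ s, (PowerSeries.subst (fibreSeries F π l j) (binom (c j)))) = 1 := by
    intro s c
    rw [map_prod]
    refine Finset.prod_eq_one fun j _ => ?_
    rw [counitSeries_subst (constantCoeff_fibreSeries j) (counitSeries_fibreSeries j),
      constantCoeff_binom, map_one]
  rcases P.reduced.kind_cases (π x) with hx | hx | hx
  · refine ⟨Pi.single (π x) 1, ⟨π x, by simp⟩, fun t => ?_⟩
    rw [Finset.sum_eq_single (π x) (fun j _ hj => by rw [Pi.single_eq_of_ne hj, zero_smul])
      (by simp), Pi.single_eq_same, one_smul, coeffMap_treeCoeff, P.evalSeries_I0 hx, map_add,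
      Derivation.map_one_eq_zero, zero_add, coeffMap_treeCoeff]
  · refine ⟨D.linA (π x), ?_, fun t => ?_⟩
    · by_contra! h0
      exact P.series_ne_one (π x) (P.reduced.series_eq_one hx h0)
    · have hE : counitSeries K I (D.ν (π x) • evalSeries F x +
          (1 - D.ν (π x)) • (1 : PowerSeries (HTree K I))) = 1 := by
        by_cases hν : D.ν (π x) = 0
        · rw [hν, zero_smul, zero_add, sub_zero, one_smul, map_one]
        · rw [P.evalSeries_I1 hx hν, map_add, counitSeries_smul, map_add, counitSeries_smul,
            counitSeries_smul, counitSeries_smul, hsub, map_one, smul_add,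
            smul_inv_smul₀ hν, smul_smul, add_assoc, ← add_smul,
            show D.ν (π x) * (1 - (D.ν (π x))⁻¹) + (1 - D.ν (π x)) = 0 by field_simp; ring,
            zero_smul, add_zero]
      rw [coeffMap_treeCoeff, P.derivation_evalSeries_I1 _ (fun j _ => hw t j) hx, map_mul, hE,
        mul_one, map_sum]
      exact Finset.sum_congr rfl fun j _ => by rw [counitSeries_smul, hEw]
  · have hν := P.reduced.valid.ν_ne_zero _ hx
    refine ⟨fun j => (D.ν (π x))⁻¹ * D.expB (π x) j + D.linU (π x) j, ?_, fun t => ?_⟩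
    · obtain ⟨k, hk⟩ := P.reduced.exists_linU hx
      refine ⟨k, ?_⟩
      have h0 : D.expB (π x) k = 0 := by
        by_contra h
        have h1 := FundamentalData.kind_eq_I1_of_linU hk
        rw [FundamentalData.kind_eq_I0_of_expB h] at h1
        cases h1
      change (D.ν (π x))⁻¹ * D.expB (π x) k + D.linU (π x) k ≠ 0
      rwa [h0, mul_zero, zero_add]
    · have hE : counitSeries K I (evalSeries F x - (∑ k, D.linU (π x) k • fibreSeries F π l k) +
          ((D.ν (π x))⁻¹ - 1) • (1 : PowerSeries (HTree K I))) = (D.ν (π x))⁻¹ • 1 := by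
        rw [P.evalSeries_J1 hx, add_sub_right_comm, add_sub_cancel_right, add_assoc, ← add_smul,
          sub_add_sub_cancel, sub_self, zero_smul, add_zero, counitSeries_smul, hsub]
      rw [coeffMap_treeCoeff, P.derivation_evalSeries_J1 _ (fun j _ => hw t j) hx, map_add, map_mul,
        hE, map_sum, map_sum, Finset.sum_mul, ← Finset.sum_add_distrib]
      refine Finset.sum_congr rfl fun j _ => ?_
      rw [counitSeries_smul, counitSeries_smul, hEw, ← coeffMap_treeCoeff, mul_smul_comm, mul_one,
        smul_smul, add_smul]

/-- Some tree occurs in `X_x(n + 1)`. The tree obtained by induction is a ladder rooted at `x`. -/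
theorem exists_treeCoeff_sol_ne_zero (n : ℕ) (x : I) :
    ∃ t : RTree I, treeCoeff t (F.sol x (n + 1)) ≠ 0 := by
  classical
  induction n generalizing x with
  | zero =>
    refine ⟨RTree.graft x 0, ?_⟩
    rw [zero_add, P.sol_one, treeCoeff_X, if_pos rfl]
    exact one_ne_zero
  | succ n ih =>
    obtain ⟨c, ⟨k, hk⟩, hc⟩ := P.exists_linear_part x
    obtain ⟨y, rfl⟩ := P.surjective k
    obtain ⟨t, ht⟩ := ih y
    have hty : t.root = y ∧ t.weight = n + 1 := by
      by_contra h
      exact ht (treeCoeff_sol_of_ne (by tauto))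
    refine ⟨RTree.graft x {t}, ?_⟩
    have h1 := congrArg (PowerSeries.coeff (n + 1)) (hc t)
    have h2 : ∀ j, PowerSeries.coeff (n + 1) (c j • coeffMap (treeCoeff t) (fibreSeries F π l j)) =
        if π y = j then c j * (l y * treeCoeff t (F.sol y (n + 1))) else 0 := by
      intro j
      have h3 : PowerSeries.coeff (n + 1) (c j • coeffMap (treeCoeff t) (fibreSeries F π l j)) =
          c j * treeCoeff t (PowerSeries.coeff (n + 1) (fibreSeries F π l j)) := by simp
      rw [h3, coeff_fibreSeries, map_fibreSum, fibreSum, Finset.sum_eq_single y]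
      · split_ifs <;> simp
      · intro z _ hz
        rw [treeCoeff_sol_of_ne (Or.inl (by rw [hty.1]; exact hz.symm))]
        simp
      · simp
    rw [coeff_coeffMap, map_sum, Finset.sum_congr rfl fun j _ => h2 j, Finset.sum_ite_eq,
      if_pos (Finset.mem_univ _)] at h1
    rw [F.isSolution_sol.succ, treeCoeff_graft_bPlus]
    have h4 : treeCoeff t (evalComponent (F x) F.sol (n + 1)) =
        c (π y) * (l y * treeCoeff t (F.sol y (n + 1))) := h1
    rw [h4]
    exact mul_ne_zero hk (mul_ne_zero (P.l_ne_zero y) ht)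

end AbelianPresentation

end LinearPart

/-! ### Finite sequences -/

section Sequences

variable {K : Type u} [Field K]

/-- The formal series `∑ s(n) tⁿ` of a finite sequence. -/
noncomputable def seqSeries : Seq K →ₗ[K] PowerSeries K :=
  Finsupp.linearCombination K fun n : ℕ+ => (PowerSeries.X : PowerSeries K) ^ (n : ℕ)

theorem seqSeries_single (n : ℕ+) (a : K) :
    seqSeries (Finsupp.single n a) = a • (PowerSeries.X : PowerSeries K) ^ (n : ℕ) := by
  simp [seqSeries]

theorem coeff_seqSeries (s : Seq K) (n : ℕ+) : PowerSeries.coeff (n : ℕ) (seqSeries s) = s n := by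
  induction s using Finsupp.induction_linear with
  | zero => simp
  | add f g hf hg => rw [map_add, map_add, hf, hg, Finsupp.add_apply]
  | single m a =>
    rw [seqSeries_single, map_smul, PowerSeries.coeff_X_pow, Finsupp.single_apply]
    by_cases h : m = n
    · simp [h]
    · have : (n : ℕ) ≠ m := fun h' => h (PNat.coe_injective h'.symm)
      simp [h, this]

theorem constantCoeff_seqSeries (s : Seq K) : PowerSeries.coeff 0 (seqSeries s) = 0 := by
  induction s using Finsupp.induction_linear with
  | zero => simp
  | add f g hf hg => rw [map_add, map_add, hf, hg, add_zero]
  | single m a => simp [seqSeries_single, m.ne_zero.symm]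

theorem seqSeries_injective : Function.Injective (seqSeries (K := K)) := by
  intro s s' h
  ext n
  rw [← coeff_seqSeries, h, coeff_seqSeries]

/-- The product of finite sequences, seen as polynomials without constant term. -/
noncomputable def seqMul : Seq K →ₗ[K] Module.End K (Seq K) :=
  Finsupp.linearCombination K fun k : ℕ+ => shift K k

theorem seqMul_single (k l : ℕ+) (a b : K) :
    seqMul (Finsupp.single k a) (Finsupp.single l b) = Finsupp.single (k + l) (a * b) := by
  simp [seqMul, shift_single]

theorem seqSeries_seqMul (s s' : Seq K) :
    seqSeries (seqMul s s') = seqSeries s * seqSeries s' := by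
  induction s using Finsupp.induction_linear with
  | zero => simp
  | add f g hf hg => rw [map_add, LinearMap.add_apply, map_add, map_add, hf, hg, add_mul]
  | single k a =>
    induction s' using Finsupp.induction_linear with
    | zero => simp
    | add f g hf hg => rw [map_add, map_add, map_add, hf, hg, mul_add]
    | single l b =>
      rw [seqMul_single, seqSeries_single, seqSeries_single, seqSeries_single, PNat.add_coe,
        pow_add, smul_mul_smul_comm]

theorem seqMul_apply_one (s s' : Seq K) : seqMul s s' 1 = 0 := by
  induction s using Finsupp.induction_linear with
  | zero => simp
  | add f g hf hg => rw [map_add, LinearMap.add_apply, Finsupp.add_apply, hf, hg, add_zero]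
  | single k a =>
    induction s' using Finsupp.induction_linear with
    | zero => simp
    | add f g hf hg => rw [map_add, Finsupp.add_apply, hf, hg, add_zero]
    | single l b =>
      rw [seqMul_single, Finsupp.single_apply, if_neg]
      exact ((one_le (a := l)).trans_lt (PNat.lt_add_left l k)).ne'

/-- The part of degree one of a finite sequence. -/
noncomputable def headPart : Seq K →ₗ[K] Seq K := Finsupp.lsingle 1 ∘ₗ Finsupp.lapply 1

theorem headPart_apply (s : Seq K) : headPart s = Finsupp.single 1 (s 1) := rfl

theorem seqSeries_headPart (s : Seq K) : seqSeries (headPart s) =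
    PowerSeries.C (PowerSeries.coeff 1 (seqSeries s)) * PowerSeries.X := by
  have := coeff_seqSeries s 1
  rw [PNat.one_coe] at this
  rw [headPart_apply, seqSeries_single, PNat.one_coe, pow_one, this, PowerSeries.smul_eq_C_mul]

end Sequences

/-! ### The product of the graded dual in coordinates -/

section Star

variable {K : Type u} [Field K] {I : Type v} [Fintype I] {J : Type*} [DecidableEq J] [Fintype J]

/-- The values on the `X_x(n)` of the convolution product `f g` of elements of `𝔤_(S)`, in terms of
the sequences `c_x = (f(X_x(n)))_n` and `d_x = (g(X_x(n)))_n`. -/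
noncomputable def star (D : FundamentalData K J) (π : I → J) (l : I → K) (c d : I → Seq K) (x : I) :
    Seq K :=
  match D.kind (π x) with
  | .I0 => seqMul (fibreSum π l c (π x)) (d x)
  | .I1 => seqMul (∑ j, D.linA (π x) j • fibreSum π l c j)
      (D.ν (π x) • d x + (1 - D.ν (π x)) • headPart (d x))
  | .J1 => seqMul (∑ j, D.expB (π x) j • fibreSum π l c j)
      (d x + ((D.ν (π x))⁻¹ - 1) • headPart (d x)) +
      seqMul (∑ k, D.linU (π x) k • fibreSum π l c k) (headPart (d x))
  | _ => 0

end Star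

section Coordinates

variable {K : Type u} [Field K] {I : Type v}

theorem IsInfChar.coeffMap_scal {ψ : HTree K I →ₗ[K] K} (hψ : IsInfChar ψ) (p : PowerSeries K) :
    coeffMap ψ (scal _ p) = 0 := by
  have h1 : coeffMap ψ 1 = 0 := by
    ext n
    rw [coeff_coeffMap, PowerSeries.coeff_one]
    split_ifs
    · rw [hψ.map_one, map_zero]
    · rw [map_zero, map_zero]
  rw [← mul_one (scal _ p), coeffMap_scal_mul, h1, mul_zero]

variable [Fintype I] {J : Type*} [DecidableEq J] [Fintype J] {F : SDSE K I}
  {D : FundamentalData K J} {π : I → J} {l : I → K}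

namespace AbelianPresentation

variable (P : AbelianPresentation F D π l)
include P

theorem coeffMap_rootSeries (ψ : HTree K I →ₗ[K] K) (x : I) : coeffMap ψ (rootSeries K x) =
    PowerSeries.C (PowerSeries.coeff 1 (valSeries F ψ x)) * PowerSeries.X := by
  have h : F.sol x 1 = bPlus K x 1 := by
    have := bPlus_mon K x (0 : Multiset (RTree I))
    rw [P.sol_one, ← this]
    simp [mon]
  rw [valSeries, coeff_coeffMap, coeff_solSeries, h, rootSeries, coeffMap_X_mul, mul_comm]
  congr 1
  ext n
  rw [coeff_coeffMap, coeff_coeffMap, PowerSeries.coeff_one, PowerSeries.coeff_C]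
  split_ifs <;> simp

variable [CharZero K]

/-- The values of the product of two infinitesimal characters on the solution. -/
theorem coeffMap_derivation_solSeries {φ ψ : HTree K I →ₗ[K] K} (hφ : IsInfChar φ)
    (hψ : IsInfChar ψ) {c d : I → Seq K} (hc : ∀ x, valSeries F φ x = seqSeries (c x))
    (hd : ∀ x, valSeries F ψ x = seqSeries (d x)) (x : I) :
    coeffMap ψ (seriesDerivation hφ.derivation (solSeries F x)) =
      seqSeries (star D π l c d x) := by
  have hL : ∀ j, fibreSum π l (valSeries F φ) j = seqSeries (fibreSum π l c j) := by
    intro j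
    rw [map_fibreSum]
    exact fibreSum_congr fun y _ => hc y
  have hr : coeffMap ψ (rootSeries K x) = seqSeries (headPart (d x)) := by
    rw [P.coeffMap_rootSeries, hd, seqSeries_headPart]
  have hs : coeffMap ψ (solSeries F x) = seqSeries (d x) := hd x
  rcases P.reduced.kind_cases (π x) with hx | hx | hx
  · rw [P.derivation_solSeries_I0 hφ hx, map_add, hψ.coeffMap_scal, zero_add, coeffMap_scal_mul,
      scal_self, hs, hL, star, hx]
    dsimp only
    rw [seqSeries_seqMul]
  · rw [P.derivation_solSeries_I1 hφ hx, map_add, hψ.coeffMap_scal, zero_add, coeffMap_scal_mul,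
      scal_self, map_add, map_smul, map_smul, hs, hr, star, hx]
    dsimp only
    rw [seqSeries_seqMul]
    simp only [map_add, map_sum, map_smul, hL]
  · rw [P.derivation_solSeries_J1 hφ hx, map_add, map_add, hψ.coeffMap_scal, zero_add,
      coeffMap_scal_mul, coeffMap_scal_mul, scal_self, scal_self, map_add, map_smul, hs, hr, star,
      hx]
    dsimp only
    rw [map_add, seqSeries_seqMul, seqSeries_seqMul]
    simp only [map_add, map_sum, map_smul, hL]

end AbelianPresentation

end Coordinates

/-! ### Elements of the Lie algebra of the system -/

section LieAlgebra

variable {K : Type u} [Field K] {I : Type v} [Finite I] {F : SDSE K I}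

/-- The vector space of the infinitesimal characters. -/
def infChar (K : Type u) [Field K] (D : Type*) : Submodule K (HTree K D →ₗ[K] K) where
  carrier := {φ | IsInfChar φ}
  add_mem' := by
    intro φ ψ hφ hψ x y
    rw [LinearMap.add_apply, hφ x y, hψ x y, LinearMap.add_apply, LinearMap.add_apply]
    ring
  zero_mem' := fun x y => by simp
  smul_mem' := by
    intro c φ hφ x y
    rw [LinearMap.smul_apply, hφ x y, LinearMap.smul_apply, LinearMap.smul_apply]
    simp only [smul_eq_mul]
    ring

/-- `X_x(n)`, as an element of `H_(S)`. -/
noncomputable def solHS (hH : F.IsHopf) (x : I) (n : ℕ) : F.HS hH :=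
  (⟨F.sol x n, Algebra.subset_adjoin ⟨x, n, rfl⟩⟩ : F.subalg)

theorem incl_solHS (hH : F.IsHopf) (x : I) (n : ℕ) : F.incl hH (solHS hH x n) = F.sol x n := rfl

/-- The linear forms on `H_D` vanishing on the elements of large valuation. -/
def gradedForms (K : Type u) [Field K] (D : Type*) : Submodule K (HTree K D →ₗ[K] K) where
  carrier := {φ | ∃ n, ∀ x, ValGE K x n → φ x = 0}
  add_mem' := by
    rintro φ ψ ⟨n, hn⟩ ⟨m, hm⟩
    refine ⟨max n m, fun x hx => ?_⟩
    rw [LinearMap.add_apply, hn x fun k hk => (le_max_left _ _).trans (hx k hk),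
      hm x fun k hk => (le_max_right _ _).trans (hx k hk), add_zero]
  zero_mem' := ⟨0, fun x _ => rfl⟩
  smul_mem' := by
    rintro c φ ⟨n, hn⟩
    exact ⟨n, fun x hx => by rw [LinearMap.smul_apply, hn x hx, smul_zero]⟩

theorem treeCoeff_mem_gradedForms {D : Type*} (t : RTree D) :
    treeCoeff t ∈ gradedForms K D := by
  refine ⟨t.weight + 1, fun x hx => ?_⟩
  by_contra h
  have := hx _ h
  rw [Finsupp.weight_single, one_smul] at this
  omega

theorem isInfChar_of_mem {D : Type*} {φ : HTree K D →ₗ[K] K}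
    (h : φ ∈ infChar K D ⊓ gradedForms K D) : IsInfChar φ := h.1

/-- The restriction to `H_(S)` of the infinitesimal characters of the graded dual of `H_I`. -/
noncomputable def restrictLie (hH : F.IsHopf) :
    (infChar K I ⊓ gradedForms K I : Submodule K (HTree K I →ₗ[K] K)) →ₗ[K] F.lieAlg hH where
  toFun φ := ⟨WithConv.toConv (φ.1.comp (F.incl hH).toLinearMap), by
    refine ⟨fun x y => ?_, ?_⟩
    · exact (congrArg φ.1 (map_mul (F.incl hH) x y)).trans (φ.2.1 _ _)
    · obtain ⟨n, hn⟩ := φ.2.2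
      exact ⟨n, fun x hx => hn _ hx⟩⟩
  map_add' _ _ := rfl
  map_smul' _ _ := rfl

/-- Elements of `𝔤_(S)` are determined by their values on the generators of `H_(S)`. -/
theorem lieAlg_ext (hH : F.IsHopf) {f g : F.lieAlg hH}
    (h : ∀ x n, f.1 (solHS hH x n) = g.1 (solHS hH x n)) : f = g := by
  have h1 : ∀ f : F.lieAlg hH, f.1 1 = 0 := by
    intro f
    have := f.2.1 1 1
    simpa using this
  refine Subtype.ext (WithConv.ext (LinearMap.ext fun z => ?_))
  change f.1 z = g.1 z
  obtain ⟨z, hz⟩ := z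
  change z ∈ Algebra.adjoin K _ at hz
  induction hz using Algebra.adjoin_induction with
  | mem z hz =>
    obtain ⟨x, n, rfl⟩ := hz
    exact h x n
  | algebraMap r =>
    have h2 : ∀ f : F.lieAlg hH, f.1 (algebraMap K (F.HS hH) r) = 0 := by
      intro f
      have h3 : f.1.ofConv (r • 1) = r • f.1.ofConv 1 := map_smul _ _ _
      rw [← Algebra.algebraMap_eq_smul_one] at h3
      exact h3.trans (by rw [show f.1.ofConv 1 = 0 from h1 f, smul_zero])
    exact (h2 f).trans (h2 g).symm
  | add y z hy hz ihy ihz =>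
    have h2 : ∀ f : F.lieAlg hH, f.1 (⟨y, hy⟩ + ⟨z, hz⟩ : F.subalg) =
        f.1 (⟨y, hy⟩ : F.subalg) + f.1 (⟨z, hz⟩ : F.subalg) := fun f => map_add f.1.ofConv _ _
    exact (h2 f).trans ((congrArg₂ (· + ·) ihy ihz).trans (h2 g).symm)
  | mul y z hy hz ihy ihz =>
    have h2 := f.2.1 (⟨y, hy⟩ : F.subalg) (⟨z, hz⟩ : F.subalg)
    have h3 := g.2.1 (⟨y, hy⟩ : F.subalg) (⟨z, hz⟩ : F.subalg)
    rw [ihy, ihz] at h2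
    exact h2.trans h3.symm

/-- The bracket of `𝔤_(S)` is the commutator for the convolution product, and the coproduct of
`H_(S)` is the restriction of that of `H_I`. -/
theorem lie_restrictLie (hH : F.IsHopf)
    (φ ψ : (infChar K I ⊓ gradedForms K I : Submodule K (HTree K I →ₗ[K] K))) (x : F.HS hH) :
    (⁅restrictLie hH φ, restrictLie hH ψ⁆ : F.lieAlg hH).1 x =
      ψ.1 ((isInfChar_of_mem φ.2).derivation (F.incl hH x)) -
        φ.1 ((isInfChar_of_mem ψ.2).derivation (F.incl hH x)) := by
  have key : ∀ φ ψ : (infChar K I ⊓ gradedForms K I : Submodule K (HTree K I →ₗ[K] K)),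
      ((restrictLie hH φ).1 * (restrictLie hH ψ).1) x =
        ψ.1 ((isInfChar_of_mem φ.2).derivation (F.incl hH x)) := by
    intro φ ψ
    rw [SDSE.mul_apply, IsInfChar.derivation_apply, ← mul'_map_eq, ← SDSE.incl2_comulHS]
    change LinearMap.mul' K K (TensorProduct.map (φ.1.comp (F.incl hH).toLinearMap)
      (ψ.1.comp (F.incl hH).toLinearMap) _) = _
    rw [TensorProduct.map_comp]
    rfl
  have h : (⁅restrictLie hH φ, restrictLie hH ψ⁆ : F.lieAlg hH).1 x =
    ((restrictLie hH φ).1 * (restrictLie hH ψ).1) x -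
      ((restrictLie hH ψ).1 * (restrictLie hH φ).1) x := rfl
  rw [h, key, key]

end LieAlgebra

/-! ### Coordinates on the Lie algebra of the system -/

section LieCoordinates

variable {K : Type u} [Field K] {I : Type v} [Fintype I] {F : SDSE K I}

/-- The linear form on `H_I` with values `c_x(n)` on the `X_x(n)`, a linear combination of the
coefficients of trees `T x n` occurring in the `X_x(n)`. As `T x n` has root `x` and weight `n`, its
coefficient vanishes on the other `X_y(m)`. -/
noncomputable def coordForm (F : SDSE K I) (T : I → ℕ+ → RTree I) :
    (I → Seq K) →ₗ[K] (HTree K I →ₗ[K] K) :=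
  ∑ x, Finsupp.linearCombination K
    (fun n : ℕ+ => (treeCoeff (T x n) (F.sol x n))⁻¹ • treeCoeff (T x n)) ∘ₗ LinearMap.proj x

theorem coordForm_apply (T : I → ℕ+ → RTree I) (c : I → Seq K) (z : HTree K I) :
    coordForm F T c z =
      ∑ x, (c x).sum fun n a => a * ((treeCoeff (T x n) (F.sol x n))⁻¹ * treeCoeff (T x n) z) := by
  rw [coordForm, LinearMap.sum_apply, LinearMap.sum_apply]
  refine Finset.sum_congr rfl fun x _ => ?_
  rw [LinearMap.comp_apply, LinearMap.proj_apply, Finsupp.linearCombination_apply, Finsupp.sum,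
    LinearMap.sum_apply]
  rfl

theorem coordForm_mem (T : I → ℕ+ → RTree I) (c : I → Seq K) :
    coordForm F T c ∈ infChar K I ⊓ gradedForms K I := by
  rw [coordForm, LinearMap.sum_apply]
  refine Submodule.sum_mem _ fun x _ => ?_
  rw [LinearMap.comp_apply, Finsupp.linearCombination_apply]
  exact Submodule.sum_mem _ fun n _ => Submodule.smul_mem _ _ (Submodule.smul_mem _ _
    ⟨isInfChar_treeCoeff _, treeCoeff_mem_gradedForms _⟩)

theorem coordForm_sol {T : I → ℕ+ → RTree I} (hT : ∀ x n, treeCoeff (T x n) (F.sol x n) ≠ 0)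
    (c : I → Seq K) (x : I) (n : ℕ+) : coordForm F T c (F.sol x n) = c x n := by
  have hne : ∀ y m, ¬ (y = x ∧ m = n) → treeCoeff (T y m) (F.sol x n) = 0 := by
    intro y m h
    have h1 : (T y m).root = y ∧ (T y m).weight = m := by
      by_contra h'
      exact hT y m (treeCoeff_sol_of_ne (by tauto))
    refine treeCoeff_sol_of_ne ?_
    by_contra! h'
    exact h ⟨h1.1.symm.trans h'.1, PNat.coe_injective (h1.2.symm.trans h'.2)⟩
  rw [coordForm_apply, Finset.sum_eq_single x, Finsupp.sum, Finset.sum_eq_single n]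
  · rw [inv_mul_cancel₀ (hT x n), mul_one]
  · intro m _ hm
    rw [hne x m fun h => hm h.2, mul_zero, mul_zero]
  · intro hn
    rw [Finsupp.notMem_support_iff.1 hn, zero_mul]
  · intro y _ hy
    refine Finset.sum_eq_zero fun m _ => ?_
    dsimp only
    rw [hne y m fun h => hy h.1, mul_zero, mul_zero]
  · simp

theorem valSeries_coordForm {T : I → ℕ+ → RTree I} (hT : ∀ x n, treeCoeff (T x n) (F.sol x n) ≠ 0)
    (c : I → Seq K) (x : I) : valSeries F (coordForm F T c) x = seqSeries (c x) := by
  ext n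
  rw [valSeries, coeff_coeffMap, coeff_solSeries]
  rcases Nat.eq_zero_or_pos n with rfl | hn
  · rw [F.isSolution_sol.zero, map_zero, constantCoeff_seqSeries]
  · have h1 := coordForm_sol hT c x ⟨n, hn⟩
    have h2 := coeff_seqSeries (c x) ⟨n, hn⟩
    rw [PNat.mk_coe] at h1 h2
    rw [h1, h2]

/-- The element of `𝔤_(S)` with given values on the `X_x(n)`, `n ≥ 1`. -/
noncomputable def coordMap (F : SDSE K I) (hH : F.IsHopf) (T : I → ℕ+ → RTree I) :
    (I → Seq K) →ₗ[K] F.lieAlg hH :=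
  restrictLie hH ∘ₗ (coordForm F T).codRestrict _ (coordForm_mem T)

theorem coordMap_apply (hH : F.IsHopf) (T : I → ℕ+ → RTree I) (c : I → Seq K) (z : F.HS hH) :
    (coordMap F hH T c).1 z = coordForm F T c (F.incl hH z) := rfl

theorem coordMap_injective (hH : F.IsHopf) {T : I → ℕ+ → RTree I}
    (hT : ∀ x n, treeCoeff (T x n) (F.sol x n) ≠ 0) : Function.Injective (coordMap F hH T) := by
  intro c d h
  funext x
  ext n
  rw [← coordForm_sol hT c x n, ← coordForm_sol hT d x n, ← incl_solHS hH, ← coordMap_apply,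
    ← coordMap_apply, h]

/-- The elements of `𝔤_(S)` vanish in large degrees. -/
theorem lieAlg_finite_support (hH : F.IsHopf) (f : F.lieAlg hH) (x : I) :
    (Function.support fun n : ℕ+ => f.1 (solHS hH x n)).Finite := by
  obtain ⟨N, hN⟩ := f.2.2
  refine (Set.finite_Iio (N.succPNat)).subset fun n hn => ?_
  by_contra h
  refine hn (hN _ fun m hm => ?_)
  rw [incl_solHS] at hm
  rw [F.isSolution_sol.isHomog x n hm]
  have h1 : (N.succPNat : ℕ) ≤ n := not_lt.1 h
  rw [Nat.succPNat_coe] at h1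
  omega

theorem coordMap_surjective (hH : F.IsHopf) {T : I → ℕ+ → RTree I}
    (hT : ∀ x n, treeCoeff (T x n) (F.sol x n) ≠ 0) : Function.Surjective (coordMap F hH T) := by
  intro f
  refine ⟨fun x => Finsupp.ofSupportFinite _ (lieAlg_finite_support hH f x),
    lieAlg_ext hH fun x n => ?_⟩
  rw [coordMap_apply, incl_solHS]
  rcases Nat.eq_zero_or_pos n with rfl | hn
  · have h0 : solHS hH x 0 = 0 := F.incl_injective hH (by
      rw [incl_solHS, F.isSolution_sol.zero, map_zero])
    rw [F.isSolution_sol.zero, map_zero, h0]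
    exact (map_zero f.1.ofConv).symm
  · exact coordForm_sol hT _ x ⟨n, hn⟩

/-- In the coordinates given by the values on the `X_x(n)`, the bracket of `𝔤_(S)` is the
antisymmetrization of `star`. -/
theorem AbelianPresentation.exists_coordinates [CharZero K] {J : Type*} [DecidableEq J] [Fintype J]
    {D : FundamentalData K J} {π : I → J} {l : I → K} (P : AbelianPresentation F D π l)
    (hH : F.IsHopf) : ∃ Ψ : (I → Seq K) ≃ₗ[K] F.lieAlg hH,
      ∀ c d, ⁅Ψ c, Ψ d⁆ = Ψ (fun x => star D π l c d x - star D π l d c x) := by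
  have hex : ∀ x (n : ℕ+), ∃ t, treeCoeff t (F.sol x n) ≠ 0 := by
    intro x n
    have := P.exists_treeCoeff_sol_ne_zero n.natPred x
    rwa [PNat.natPred_add_one] at this
  choose T hT using hex
  have hbij : Function.Bijective (coordMap F hH T) :=
    ⟨coordMap_injective hH hT, coordMap_surjective hH hT⟩
  refine ⟨LinearEquiv.ofBijective (coordMap F hH T) hbij, fun c d => ?_⟩
  change ⁅coordMap F hH T c, coordMap F hH T d⁆ = coordMap F hH T _
  refine lieAlg_ext hH fun x n => ?_
  have key : ∀ c d : I → Seq K, coordForm F T d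
      ((isInfChar_of_mem (coordForm_mem (F := F) T c)).derivation (F.sol x n)) =
        PowerSeries.coeff n (seqSeries (star D π l c d x)) := by
    intro c d
    rw [← P.coeffMap_derivation_solSeries (isInfChar_of_mem (coordForm_mem T c))
      (isInfChar_of_mem (coordForm_mem T d)) (valSeries_coordForm hT c) (valSeries_coordForm hT d),
      coeff_coeffMap, coeff_seriesDerivation, coeff_solSeries]
  have h1 := lie_restrictLie hH ((coordForm F T).codRestrict _ (coordForm_mem T) c)
    ((coordForm F T).codRestrict _ (coordForm_mem T) d) (solHS hH x n)
  refine h1.trans ?_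
  rw [coordMap_apply, incl_solHS]
  refine (congrArg₂ (· - ·) (key c d) (key d c)).trans ?_
  have h2 := congrArg (PowerSeries.coeff n)
    (valSeries_coordForm hT (fun x => star D π l c d x - star D π l d c x) x)
  rw [valSeries, coeff_coeffMap, coeff_solSeries, map_sub, map_sub] at h2
  exact h2.symm

end LieCoordinates

/-! ### Coordinates on the semi-direct products -/

section TargetCoordinates

attribute [local instance] LieRing.ofAssociativeRing

variable {K : Type u} [Field K]

/-- Coordinates on a finite direct sum of representations on `Seq K`. -/
noncomputable def modOf {L : Type*} [LieRing L] [LieAlgebra K L] {P : ℕ}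
    (ρ : Fin P → (L →ₗ⁅K⁆ Module.End K (Seq K))) :
    (Fin P → Seq K) ≃ₗ[K] DirectSum (Fin P) fun p => RepModule (ρ p) :=
  (LinearEquiv.piCongrRight fun p => RepModule.of (ρ p)) ≪≫ₗ
    (DirectSum.linearEquivFunOnFintype K (Fin P) fun p => RepModule (ρ p)).symm

theorem modOf_apply {L : Type*} [LieRing L] [LieAlgebra K L] {P : ℕ}
    (ρ : Fin P → (L →ₗ⁅K⁆ Module.End K (Seq K))) (s : Fin P → Seq K) (p : Fin P) :
    modOf ρ s p = RepModule.of (ρ p) (s p) := by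
  have := LinearEquiv.apply_symm_apply
    (DirectSum.linearEquivFunOnFintype K (Fin P) fun p => RepModule (ρ p))
    (fun p => RepModule.of (ρ p) (s p))
  exact congrFun this p

theorem lie_modOf {L : Type*} [LieRing L] [LieAlgebra K L] {P : ℕ}
    (ρ : Fin P → (L →ₗ⁅K⁆ Module.End K (Seq K))) (x : L) (s : Fin P → Seq K) :
    ⁅x, modOf ρ s⁆ = modOf ρ fun p => ρ p x (s p) := by
  refine DFinsupp.ext fun p => ?_
  refine (DirectSum.lie_module_bracket_apply x (modOf ρ s) p).trans ?_
  rw [modOf_apply, modOf_apply]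
  rfl

/-- Coordinates on the semi-direct product by a finite direct sum of representations on `Seq K`. -/
noncomputable def semidirectOf {L : Type*} [LieRing L] [LieAlgebra K L] {P : ℕ}
    (ρ : Fin P → (L →ₗ⁅K⁆ Module.End K (Seq K))) :
    ((Fin P → Seq K) × L) ≃ₗ[K]
      ModuleSemidirect K L (DirectSum (Fin P) fun p => RepModule (ρ p)) :=
  (LinearEquiv.prodCongr (modOf ρ ≪≫ₗ TrivLie.of K _) (LinearEquiv.refl K L)) ≪≫ₗ
    (LieAlgebra.SemiDirectSum.toProdl _).symm

theorem lie_semidirectOf {L : Type*} [LieRing L] [LieAlgebra K L] {P : ℕ}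
    (ρ : Fin P → (L →ₗ⁅K⁆ Module.End K (Seq K))) (s s' : Fin P → Seq K) (x x' : L) :
    ⁅semidirectOf ρ (s, x), semidirectOf ρ (s', x')⁆ =
      semidirectOf ρ (fun p => ρ p x (s' p) - ρ p x' (s p), ⁅x, x'⁆) := by
  have h : ∀ s x, semidirectOf ρ (s, x) = ⟨TrivLie.of K _ (modOf ρ s), x⟩ := fun _ _ => rfl
  rw [h, h, h, LieAlgebra.SemiDirectSum.lie_eq_mk, TrivLie.lie_eq_zero, zero_add]
  congr 1
  change TrivLie.of K _ ⁅x, modOf ρ s'⁆ - TrivLie.of K _ ⁅x', modOf ρ s⁆ = _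
  rw [lie_modOf, lie_modOf, ← map_sub, ← map_sub]
  rfl

variable {M N P : ℕ}

/-- The families of finitely supported sequences, as finitely supported families. -/
noncomputable def uncurryFinsupp (K : Type u) [Field K] (M : ℕ) :
    (Fin M → Seq K) ≃ₗ[K] (Fin M × ℕ+ →₀ K) :=
  (Finsupp.linearEquivFunOnFinite K (Seq K) (Fin M)).symm ≪≫ₗ (Finsupp.curryLinearEquiv K).symm

theorem uncurryFinsupp_single (i : Fin M) (k : ℕ+) (a : K) :
    uncurryFinsupp K M (Pi.single i (Finsupp.single k a)) = Finsupp.single (i, k) a := by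
  rw [uncurryFinsupp, LinearEquiv.trans_apply, Finsupp.linearEquivFunOnFinite_symm_single]
  simp

theorem linearCombination_uncurryFinsupp (T : Fin M → ℕ+ → Module.End K (Seq K))
    (e : Fin M → Seq K) :
    Finsupp.linearCombination K (fun p : Fin M × ℕ+ => T p.1 p.2) (uncurryFinsupp K M e) =
      ∑ i, Finsupp.linearCombination K (T i) (e i) := by
  have h : Finsupp.linearCombination K (fun p : Fin M × ℕ+ => T p.1 p.2) ∘ₗ
      (uncurryFinsupp K M).toLinearMap =
      ∑ i, Finsupp.linearCombination K (T i) ∘ₗ LinearMap.proj i := by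
    refine LinearMap.pi_ext' fun i => Finsupp.lhom_ext fun k a => ?_
    rw [LinearMap.comp_apply, LinearMap.comp_apply, LinearMap.coe_single, LinearEquiv.coe_coe,
      uncurryFinsupp_single, LinearMap.comp_apply, LinearMap.sum_apply, Finset.sum_eq_single i]
    · rw [LinearMap.coe_single, LinearMap.comp_apply, LinearMap.proj_apply, Pi.single_eq_same,
        Finsupp.linearCombination_single, Finsupp.linearCombination_single]
    · intro j _ hj
      rw [LinearMap.coe_single, LinearMap.comp_apply, LinearMap.proj_apply,
        Pi.single_eq_of_ne hj, map_zero]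
    · simp
  have := LinearMap.congr_fun h e
  rw [LinearMap.sum_apply] at this
  exact this

/-- Coordinates on `𝔤_ab`. -/
noncomputable def gabOf (K : Type u) [Field K] (M : ℕ) : (Fin M → Seq K) ≃ₗ[K] GAb K M :=
  uncurryFinsupp K M ≪≫ₗ TrivLie.of K _

theorem gabLift_gabOf (T : Fin M → ℕ+ → Module.End K (Seq K)) (e : Fin M → Seq K) :
    GAb.lift T (gabOf K M e) = ∑ i, Finsupp.linearCombination K (T i) (e i) :=
  linearCombination_uncurryFinsupp T e

theorem vSumLift_modOf (υ : Fin N → Fin M → K) (U : Fin N → ℕ+ → Module.End K (Seq K))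
    (f : Fin N → Seq K) : VSum.lift υ U (modOf (fun j => repV (υ j)) f) =
      ∑ j, Finsupp.linearCombination K (U j) (f j) := by
  have h : VSum.lift υ U ∘ₗ (modOf fun j => repV (υ j)).toLinearMap =
      ∑ j, Finsupp.linearCombination K (U j) ∘ₗ LinearMap.proj j := by
    refine LinearMap.pi_ext' fun j => LinearMap.ext fun s => ?_
    have h1 : modOf (fun j => repV (υ j)) (Pi.single j s) =
        DirectSum.lof K (Fin N) (fun j => V (υ j)) j (RepModule.of (repV (υ j)) s) := by
      refine DFinsupp.ext fun k => ?_
      rw [modOf_apply]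
      by_cases hk : k = j
      · subst hk
        rw [Pi.single_eq_same]
        exact (DirectSum.lof_apply K (M := fun j => V (υ j)) k _).symm
      · rw [Pi.single_eq_of_ne hk, map_zero]
        exact (DirectSum.of_eq_of_ne (β := fun j => V (υ j)) j k _ hk).symm
    rw [LinearMap.comp_apply, LinearMap.comp_apply, LinearMap.coe_single, LinearEquiv.coe_coe, h1,
      VSum.lift_of, LinearMap.comp_apply, LinearMap.sum_apply, Finset.sum_eq_single j]
    · rw [LinearMap.coe_single, LinearMap.comp_apply, LinearMap.proj_apply, Pi.single_eq_same]
    · intro k _ hk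
      rw [LinearMap.coe_single, LinearMap.comp_apply, LinearMap.proj_apply,
        Pi.single_eq_of_ne hk, map_zero]
    · simp
  have := LinearMap.congr_fun h f
  rw [LinearMap.sum_apply] at this
  exact this

theorem linearCombination_smul_shift (c : K) (e s : Seq K) :
    Finsupp.linearCombination K (fun k : ℕ+ => c • shift K k) e s = c • seqMul e s := by
  induction e using Finsupp.induction_linear with
  | zero => simp
  | add e e' h h' =>
    rw [map_add, map_add, LinearMap.add_apply, LinearMap.add_apply, h, h', smul_add]
  | single k a =>
    rw [seqMul, Finsupp.linearCombination_single, Finsupp.linearCombination_single,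
      LinearMap.smul_apply, LinearMap.smul_apply, LinearMap.smul_apply, smul_comm]

theorem linearCombination_smul_shiftOne (c : K) (e s : Seq K) :
    Finsupp.linearCombination K (fun k : ℕ+ => c • shiftOne K k) e s =
      c • seqMul e (headPart s) := by
  have h1 : ∀ k : ℕ+, shiftOne K k = shift K k ∘ₗ headPart := by
    intro k
    refine Finsupp.lhom_ext fun l a => ?_
    rw [shiftOne_single, LinearMap.comp_apply, headPart_apply, Finsupp.single_apply]
    split_ifs
    · rw [shift_single]
    · simp
  induction e using Finsupp.induction_linear with
  | zero => simp
  | add e e' h h' =>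
    rw [map_add, map_add, LinearMap.add_apply, LinearMap.add_apply, h, h', smul_add]
  | single k a =>
    rw [seqMul, Finsupp.linearCombination_single, Finsupp.linearCombination_single, h1,
      LinearMap.smul_apply, LinearMap.smul_apply, LinearMap.smul_apply, smul_comm]
    rfl

theorem repV_gabOf (υ : Fin M → K) (e : Fin M → Seq K) (s : Seq K) :
    repV υ (gabOf K M e) s = seqMul (∑ i, υ i • e i) s := by
  have h : repV υ (gabOf K M e) = GAb.lift (fun i k => υ i • shift K k) (gabOf K M e) := rfl
  rw [h, gabLift_gabOf, LinearMap.sum_apply, map_sum, LinearMap.sum_apply]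
  refine Finset.sum_congr rfl fun i _ => ?_
  rw [linearCombination_smul_shift, map_smul, LinearMap.smul_apply]

/-- Coordinates on `(V_{υ^{(1)}} ⊕ ⋯ ⊕ V_{υ^{(N)}}) ⋊ 𝔤_ab`. -/
noncomputable def gvOf (υ : Fin N → Fin M → K) :
    ((Fin N → Seq K) × (Fin M → Seq K)) ≃ₗ[K] GV υ :=
  (LinearEquiv.prodCongr (LinearEquiv.refl K _) (gabOf K M)) ≪≫ₗ semidirectOf fun j => repV (υ j)

theorem lie_gvOf (υ : Fin N → Fin M → K) (f f' : Fin N → Seq K) (e e' : Fin M → Seq K) :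
    ⁅gvOf υ (f, e), gvOf υ (f', e')⁆ =
      gvOf υ (fun j => seqMul (∑ i, υ j i • e i) (f' j) - seqMul (∑ i, υ j i • e' i) (f j), 0) := by
  refine (lie_semidirectOf (fun j => repV (υ j)) f f' (gabOf K M e) (gabOf K M e')).trans ?_
  rw [TrivLie.lie_eq_zero]
  simp only [repV_gabOf]
  rw [gvOf, LinearEquiv.trans_apply, LinearEquiv.prodCongr_apply, map_zero]
  rfl

theorem gvRep_gvOf (υ : Fin N → Fin M → K) (T : Fin M → ℕ+ → Module.End K (Seq K))
    (U : Fin N → ℕ+ → Module.End K (Seq K)) (hT hU hTU) (f : Fin N → Seq K) (e : Fin M → Seq K) :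
    GV.rep υ T U hT hU hTU (gvOf υ (f, e)) =
      ∑ i, Finsupp.linearCombination K (T i) (e i) +
        ∑ j, Finsupp.linearCombination K (U j) (f j) := by
  rw [← gabLift_gabOf, ← vSumLift_modOf]
  rfl

/-- The action on `W_ν` or `W'_{ν, μ}` of the element with coordinates `(f, e)`. -/
noncomputable def wAct {υ : Fin N → Fin M → K} (f : Fin N → Seq K) (e : Fin M → Seq K) (s : Seq K) :
    WParam υ → Seq K
  | .W ν => seqMul (∑ i, ν i • e i) (headPart s)
  | .W' ν μ _ => seqMul (∑ i, ν i • e i) s + seqMul (∑ j, μ j • f j) (headPart s)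

theorem repW_gvOf {υ : Fin N → Fin M → K} (w : WParam υ) (f : Fin N → Seq K) (e : Fin M → Seq K)
    (s : Seq K) : repW w (gvOf υ (f, e)) s = wAct f e s w := by
  cases w with
  | W ν =>
    rw [repW, gvRep_gvOf, wAct]
    have h0 : ∀ f : Seq K, Finsupp.linearCombination K (fun _ : ℕ+ => (0 : Module.End K (Seq K))) f
        = 0 := fun f => by simp [Finsupp.linearCombination_apply]
    simp only [h0, Finset.sum_const_zero, add_zero, LinearMap.sum_apply,
      linearCombination_smul_shiftOne, map_sum, map_smul, LinearMap.smul_apply]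
  | W' ν μ h =>
    rw [repW, gvRep_gvOf, wAct]
    simp only [LinearMap.add_apply, LinearMap.sum_apply, linearCombination_smul_shift,
      linearCombination_smul_shiftOne, map_sum, map_smul, LinearMap.smul_apply]

/-- Coordinates on `W ⋊ ((V_{υ^{(1)}} ⊕ ⋯ ⊕ V_{υ^{(N)}}) ⋊ 𝔤_ab)`. -/
noncomputable def gwvOf {υ : Fin N → Fin M → K} (w : Fin P → WParam υ) :
    ((Fin P → Seq K) × (Fin N → Seq K) × (Fin M → Seq K)) ≃ₗ[K] GWV w :=
  (LinearEquiv.prodCongr (LinearEquiv.refl K _) (gvOf υ)) ≪≫ₗ semidirectOf fun p => repW (w p)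

theorem lie_gwvOf {υ : Fin N → Fin M → K} (w : Fin P → WParam υ) (g g' : Fin P → Seq K)
    (f f' : Fin N → Seq K) (e e' : Fin M → Seq K) :
    ⁅gwvOf w (g, f, e), gwvOf w (g', f', e')⁆ =
      gwvOf w (fun p => wAct f e (g' p) (w p) - wAct f' e' (g p) (w p),
        fun j => seqMul (∑ i, υ j i • e i) (f' j) - seqMul (∑ i, υ j i • e' i) (f j), 0) := by
  refine (lie_semidirectOf (fun p => repW (w p)) g g' (gvOf υ (f, e)) (gvOf υ (f', e'))).trans ?_
  rw [lie_gvOf]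
  simp only [repW_gvOf]
  rfl

end TargetCoordinates

/-! ### Twists in degree one -/

section Matching

variable {K : Type u} [Field K]

theorem sum_eq_sum_equiv {J V : Type*} [Fintype J] [AddCommMonoid V] {M : ℕ} {p : J → Prop}
    (ε : Fin M ≃ {j // p j}) (g : J → V) (hg : ∀ j, ¬ p j → g j = 0) :
    ∑ j, g j = ∑ i, g (ε i) := by
  refine (Fintype.sum_of_injective (fun i => (ε i : J))
    (Subtype.val_injective.comp ε.injective) _ g (fun j hj => hg j fun h => hj ?_)
    fun _ => rfl).symm
  exact ⟨ε.symm ⟨j, h⟩, congrArg Subtype.val (ε.apply_symm_apply _)⟩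

theorem seqMul_comm (s s' : Seq K) : seqMul s s' = seqMul s' s := by
  apply seqSeries_injective
  rw [seqSeries_seqMul, seqSeries_seqMul, mul_comm]

/-- The term of index `s j` of the sum over the fibre of `j`, split off. -/
theorem fibreSum_eq_add {K : Type u} [Field K] {I : Type v} [Fintype I] {J : Type*} [DecidableEq J]
    {π : I → J} {l : I → K} {s : J → I} (hs : ∀ j, π (s j) = j) (c c' : I → Seq K) (j : J)
    (h : ∀ x, π x = j → x ≠ s j → c x = c' x) (h' : c' (s j) = 0) :
    fibreSum π l c j = l (s j) • c (s j) + fibreSum π l c' j := by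
  classical
  have h1 : fibreSum π l c' j =
      ∑ y ∈ Finset.univ.erase (s j), if π y = j then l y • c y else 0 := by
    rw [fibreSum, ← Finset.add_sum_erase _ _ (Finset.mem_univ (s j)), if_pos (hs j), h', smul_zero,
      zero_add]
    refine Finset.sum_congr rfl fun y hy => ?_
    split_ifs with hyj
    · rw [h y hyj (Finset.ne_of_mem_erase hy)]
    · rfl
  rw [h1, fibreSum, ← Finset.add_sum_erase _ _ (Finset.mem_univ (s j)), if_pos (hs j)]

/-- The operator multiplying the first coordinate by `1 + κ` and fixing the others. -/
noncomputable def twist (κ : K) : Module.End K (Seq K) := LinearMap.id + κ • headPart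

theorem twist_apply (κ : K) (s : Seq K) : twist κ s = s + κ • headPart s := rfl

theorem headPart_headPart (s : Seq K) : headPart (headPart s) = headPart s := by
  rw [headPart_apply, headPart_apply, Finsupp.single_eq_same]

theorem headPart_twist (κ : K) (s : Seq K) : headPart (twist κ s) = (1 + κ) • headPart s := by
  rw [twist_apply, map_add, map_smul, headPart_headPart, add_smul, one_smul]

theorem twist_of_apply_one (κ : K) {s : Seq K} (h : s 1 = 0) : twist κ s = s := by
  rw [twist_apply, headPart_apply, h, Finsupp.single_zero, smul_zero, add_zero]

theorem twist_bijective {κ : K} (h : 1 + κ ≠ 0) : Function.Bijective (twist κ) := by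
  have h1 : κ + -(κ / (1 + κ)) * (1 + κ) = 0 := by field_simp; ring
  constructor
  · refine (injective_iff_map_eq_zero (twist κ)).2 fun s hs => ?_
    have h2 := headPart_twist κ s
    rw [hs, map_zero, eq_comm, smul_eq_zero, or_iff_right h] at h2
    rwa [twist_apply, h2, smul_zero, add_zero] at hs
  · intro s
    refine ⟨twist (-(κ / (1 + κ))) s, ?_⟩
    rw [twist_apply, headPart_twist, twist_apply, smul_smul, add_assoc, ← add_smul]
    have h2 : -(κ / (1 + κ)) + κ * (1 + -(κ / (1 + κ))) = 0 := by field_simp; ring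
    rw [h2, zero_smul, add_zero]

end Matching

/-! ### Weights of the vertices -/

namespace FundamentalData

variable {K : Type u} [Field K] {J : Type*}

/-- The vertices giving the modules `W_ν` (those of `I₁` with `ν_j = 0`) and `W'_{ν, μ}` (those of
`J₁`). -/
def IsModuleVertex (D : FundamentalData K J) (j : J) : Prop :=
  D.kind j = .I1 ∧ D.ν j = 0 ∨ D.kind j = .J1

open scoped Classical in
/-- The scalar `κ_j` such that the coordinate of degree one above `j` is multiplied by `1 + κ_j` in
the adapted coordinates. For `j ∈ J₁`, and for `j ∈ I₁` with `ν_j ≠ 0`, one has `1 + κ_j = ν_j⁻¹`.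
-/
noncomputable def twistFactor (D : FundamentalData K J) (j : J) : K :=
  if D.kind j = .J1 ∨ D.kind j = .I1 ∧ D.ν j ≠ 0 then (D.ν j)⁻¹ - 1 else 0

open scoped Classical in
/-- The scalars `υ` (or `ν`, for a module vertex) by which the generators of `𝔤_ab`, indexed by
`t ∈ I₀`, act on the coordinates above `j`. -/
noncomputable def weight (D : FundamentalData K J) (j t : J) : K :=
  match D.kind j with
  | .I0 => if t = j then 1 else 0
  | .I1 => if D.ν j = 0 then D.linA j t else D.ν j * D.linA j t
  | .J1 => D.expB j t
  | _ => 0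

variable {D : FundamentalData K J}

theorem kind_eq_I0_of_weight {j t : J} (h : D.weight j t ≠ 0) : D.kind t = .I0 := by
  unfold weight at h
  split at h
  · by_cases ht : t = j
    · rwa [ht]
    · rw [if_neg ht] at h
      exact absurd rfl h
  · split_ifs at h with h0
    · exact kind_eq_I0_of_linA h
    · exact kind_eq_I0_of_linA (right_ne_zero_of_mul h)
  · exact kind_eq_I0_of_expB h
  · exact absurd rfl h

theorem sum_weight_smul [Fintype J] {M : ℕ} (ε : Fin M ≃ {j // D.kind j = .I0}) (X : J → Seq K)
    (j : J) : ∑ t, D.weight j t • X t = ∑ i, D.weight j (ε i) • X (ε i) :=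
  sum_eq_sum_equiv ε _ fun t ht => by
    rw [not_imp_comm.1 kind_eq_I0_of_weight ht, zero_smul]

theorem IsReducedAbelian.one_add_twistFactor_ne_zero [Fintype J] [DecidableEq J]
    (h : D.IsReducedAbelian) (j : J) : 1 + D.twistFactor j ≠ 0 := by
  unfold twistFactor
  split_ifs with hj
  · rw [add_sub_cancel]
    refine inv_ne_zero ?_
    rcases hj with hj | hj
    · exact h.valid.ν_ne_zero j hj
    · exact hj.2
  · simp

end FundamentalData

/-! ### The product in terms of weights -/

section Star

open FundamentalData

variable {K : Type u} [Field K] {I : Type v} [Fintype I] {J : Type*} [Fintype J] [DecidableEq J]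
  {D : FundamentalData K J} (π : I → J) (l : I → K) (c d : I → Seq K) (x : I)

theorem star_apply_one : star D π l c d x 1 = 0 := by
  unfold star
  split
  · exact seqMul_apply_one _ _
  · exact seqMul_apply_one _ _
  · rw [Finsupp.add_apply, seqMul_apply_one, seqMul_apply_one, add_zero]
  · rfl

variable {x}

theorem star_of_I0 (hx : D.kind (π x) = .I0) :
    star D π l c d x = seqMul (fibreSum π l c (π x)) (d x) := by
  rw [star, hx]

/-- After the twist, the left multiplication by `c` is a multiplication operator, as on the modules
`V_υ`. -/
theorem star_of_not_isModuleVertex (hD : D.IsReducedAbelian) (hx : ¬ D.IsModuleVertex (π x)) :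
    star D π l c d x = seqMul (∑ j, D.weight (π x) j • fibreSum π l c j)
      (twist (D.twistFactor (π x)) (d x)) := by
  rcases hD.kind_cases (π x) with h | h | h
  · rw [star_of_I0 π l c d h, Finset.sum_eq_single (π x)]
    · simp [weight, twistFactor, h, twist_apply]
    · intro j _ hj
      simp [weight, h, hj]
    · simp
  · have hν : D.ν (π x) ≠ 0 := fun h0 => hx (Or.inl ⟨h, h0⟩)
    have h1 : ∑ j, D.weight (π x) j • fibreSum π l c j =
        D.ν (π x) • ∑ j, D.linA (π x) j • fibreSum π l c j := by
      rw [Finset.smul_sum]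
      refine Finset.sum_congr rfl fun j _ => ?_
      rw [weight, h]
      dsimp only
      rw [if_neg hν, mul_smul]
    have h2 : D.twistFactor (π x) = (D.ν (π x))⁻¹ - 1 := by
      rw [twistFactor, if_pos (Or.inr ⟨h, hν⟩)]
    rw [h1, h2, map_smul, LinearMap.smul_apply, ← map_smul, twist_apply, smul_add, smul_smul,
      mul_sub, mul_inv_cancel₀ hν, mul_one, star, h]
  · exact absurd (Or.inr h) hx

theorem star_of_I1_of_eq_zero (hx : D.kind (π x) = .I1) (hν : D.ν (π x) = 0) :
    star D π l c d x = seqMul (∑ j, D.weight (π x) j • fibreSum π l c j)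
      (headPart (twist (D.twistFactor (π x)) (d x))) := by
  have h2 : D.twistFactor (π x) = 0 := by simp [twistFactor, hx, hν]
  rw [headPart_twist, h2, add_zero, one_smul]
  simp [star, hx, weight, hν]

theorem star_of_J1 (hD : D.IsReducedAbelian) (hx : D.kind (π x) = .J1) :
    star D π l c d x = seqMul (∑ j, D.weight (π x) j • fibreSum π l c j)
      (twist (D.twistFactor (π x)) (d x)) +
      seqMul (∑ k, (D.ν (π x) * D.linU (π x) k) • fibreSum π l c k)
        (headPart (twist (D.twistFactor (π x)) (d x))) := by
  have hν := hD.valid.ν_ne_zero _ hx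
  have h2 : D.twistFactor (π x) = (D.ν (π x))⁻¹ - 1 := by simp [twistFactor, hx]
  have h3 : ∑ k, (D.ν (π x) * D.linU (π x) k) • fibreSum π l c k =
      D.ν (π x) • ∑ k, D.linU (π x) k • fibreSum π l c k := by
    rw [Finset.smul_sum]
    exact Finset.sum_congr rfl fun k _ => mul_smul _ _ _
  rw [headPart_twist, h3, map_smul, map_smul, LinearMap.smul_apply, smul_smul, h2, add_sub_cancel,
    inv_mul_cancel₀ hν, one_smul]
  simp [star, hx, weight, twist_apply]

/-- The coordinates of the bracket along `𝔤_ab` vanish. -/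
theorem fibreSum_star_sub_star {j : J} (hj : D.kind j = .I0) :
    fibreSum π l (fun x => star D π l c d x - star D π l d c x) j = 0 := by
  have h1 : ∀ c d : I → Seq K, fibreSum π l (fun x => star D π l c d x) j =
      seqMul (fibreSum π l c j) (fibreSum π l d j) := by
    intro c d
    rw [map_fibreSum]
    refine Finset.sum_congr rfl fun y _ => ?_
    split_ifs with hy
    · exact congrArg (l y • ·) ((star_of_I0 π l c d (hy ▸ hj)).trans (by rw [hy]))
    · rfl
  have h2 : fibreSum π l (fun x => star D π l c d x - star D π l d c x) j =
      fibreSum π l (fun x => star D π l c d x) j - fibreSum π l (fun x => star D π l d c x) j := by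
    rw [fibreSum, fibreSum, fibreSum, ← Finset.sum_sub_distrib]
    refine Finset.sum_congr rfl fun y _ => ?_
    split_ifs
    · rw [smul_sub]
    · rw [sub_zero]
  rw [h2, h1, h1, seqMul_comm, sub_self]

end Star

/-! ### Adapted coordinates -/

section Splitting

variable {K : Type u} [Field K] {I : Type v} [Fintype I] {J : Type*} [Fintype J] [DecidableEq J]

/-- The vertices of `I` giving the modules `V_υ`: those which do not give a module `W_ν` or
`W'_{ν, μ}` and are not the chosen vertex `s j` of the fibre of a vertex `j ∈ I₀`. -/
def IsAbelianModuleVertex (D : FundamentalData K J) (π : I → J) (s : J → I) (x : I) : Prop :=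
  ¬ D.IsModuleVertex (π x) ∧ ¬ (D.kind (π x) = .I0 ∧ s (π x) = x)

variable (D : FundamentalData K J) (π : I → J) (l : I → K) (s : J → I) {M N P : ℕ}
  (εM : Fin M ≃ {j // D.kind j = .I0}) (εN : Fin N ≃ {x // IsAbelianModuleVertex D π s x})
  (εP : Fin P ≃ {x // D.IsModuleVertex (π x)})

/-- The change of coordinates on `𝔤_(S)` adapted to the decomposition
`W ⋊ ((V_{υ^{(1)}} ⊕ ⋯ ⊕ V_{υ^{(N)}}) ⋊ 𝔤_ab)`: the coordinates above `j ∈ I₀` are the sum over the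
fibre of `j`, and the coordinates at its other vertices than `s j`; the other coordinates are
twisted in degree one. -/
noncomputable def splitMap : (I → Seq K) →ₗ[K]
    (Fin P → Seq K) × (Fin N → Seq K) × (Fin M → Seq K) where
  toFun c := (fun p => twist (D.twistFactor (π (εP p))) (c (εP p)),
    fun n => twist (D.twistFactor (π (εN n))) (c (εN n)), fun i => fibreSum π l c (εM i))
  map_add' c d := by
    refine Prod.ext (funext fun p => map_add _ _ _) (Prod.ext (funext fun n => map_add _ _ _)
      (funext fun i => ?_))
    change fibreSum π l (c + d) (εM i) = fibreSum π l c (εM i) + fibreSum π l d (εM i)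
    rw [fibreSum, fibreSum, fibreSum, ← Finset.sum_add_distrib]
    refine Finset.sum_congr rfl fun y _ => ?_
    split_ifs
    · rw [Pi.add_apply, smul_add]
    · rw [add_zero]
  map_smul' a c := by
    refine Prod.ext (funext fun p => map_smul (twist _) a (c (εP p)))
      (Prod.ext (funext fun n => map_smul (twist _) a (c (εN n)))
      (funext fun i => ?_))
    change fibreSum π l (a • c) (εM i) = a • fibreSum π l c (εM i)
    rw [fibreSum, fibreSum, Finset.smul_sum]
    refine Finset.sum_congr rfl fun y _ => ?_
    split_ifs
    · rw [Pi.smul_apply, smul_comm]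
    · rw [smul_zero]

variable {D π l s}

theorem splitMap_injective (hD : D.IsReducedAbelian) (hl : ∀ x, l x ≠ 0) (hs : ∀ j, π (s j) = j) :
    Function.Injective (splitMap D π l s εM εN εP) := by
  refine (injective_iff_map_eq_zero (splitMap D π l s εM εN εP)).2 fun c hc => ?_
  have hP : ∀ x, D.IsModuleVertex (π x) → c x = 0 := by
    intro x hx
    have h1 := congrFun (congrArg Prod.fst hc) (εP.symm ⟨x, hx⟩)
    change twist (D.twistFactor (π (εP (εP.symm ⟨x, hx⟩)))) (c (εP (εP.symm ⟨x, hx⟩))) = 0 at h1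
    rw [Equiv.apply_symm_apply] at h1
    exact (twist_bijective (hD.one_add_twistFactor_ne_zero _)).1 (h1.trans (map_zero _).symm)
  have hN : ∀ x, IsAbelianModuleVertex D π s x → c x = 0 := by
    intro x hx
    have h1 := congrFun (congrArg (fun z => z.2.1) hc) (εN.symm ⟨x, hx⟩)
    change twist (D.twistFactor (π (εN (εN.symm ⟨x, hx⟩)))) (c (εN (εN.symm ⟨x, hx⟩))) = 0 at h1
    rw [Equiv.apply_symm_apply] at h1
    exact (twist_bijective (hD.one_add_twistFactor_ne_zero _)).1 (h1.trans (map_zero _).symm)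
  funext x
  by_cases hx : D.IsModuleVertex (π x)
  · exact hP x hx
  by_cases hx' : D.kind (π x) = .I0 ∧ s (π x) = x
  · have h1 := congrFun (congrArg (fun z => z.2.2) hc) (εM.symm ⟨π x, hx'.1⟩)
    change fibreSum π l c (εM (εM.symm ⟨π x, hx'.1⟩)) = 0 at h1
    rw [Equiv.apply_symm_apply] at h1
    change fibreSum π l c (π x) = 0 at h1
    rw [fibreSum_eq_add hs c 0 (π x) (fun y hy hy' => ?_) rfl] at h1
    · have h2 : fibreSum π l (0 : I → Seq K) (π x) = 0 := by simp [fibreSum]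
      rw [h2, add_zero, hx'.2, smul_eq_zero] at h1
      exact h1.resolve_left (hl x)
    · refine hN y ⟨by rwa [hy], fun h => hy' ?_⟩
      rw [← h.2, hy]
  · exact hN x ⟨hx, hx'⟩

theorem splitMap_surjective (hD : D.IsReducedAbelian) (hl : ∀ x, l x ≠ 0) (hs : ∀ j, π (s j) = j) :
    Function.Surjective (splitMap D π l s εM εN εP) := by
  classical
  rintro ⟨g, f, e⟩
  have hinv : ∀ j (t : Seq K), ∃ t', twist (D.twistFactor j) t' = t := fun j =>
    (twist_bijective (hD.one_add_twistFactor_ne_zero j)).2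
  choose T hT using hinv
  -- The coordinates at the chosen vertices are determined last, from those at the other vertices.
  let c₀ : I → Seq K := fun x =>
    if h : D.IsModuleVertex (π x) then T (π x) (g (εP.symm ⟨x, h⟩))
    else if h' : IsAbelianModuleVertex D π s x then T (π x) (f (εN.symm ⟨x, h'⟩)) else 0
  let c : I → Seq K := fun x =>
    if h : D.kind (π x) = .I0 ∧ s (π x) = x then
      (l x)⁻¹ • (e (εM.symm ⟨π x, h.1⟩) - fibreSum π l c₀ (π x)) else c₀ x
  have hdisj : ∀ x, D.IsModuleVertex (π x) → ¬ (D.kind (π x) = .I0 ∧ s (π x) = x) := by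
    rintro x (hx | hx) h
    · rw [hx.1] at h
      exact absurd h.1 (by simp)
    · rw [hx] at h
      exact absurd h.1 (by simp)
  refine ⟨c, Prod.ext (funext fun p => ?_) (Prod.ext (funext fun n => ?_) (funext fun i => ?_))⟩
  · change twist (D.twistFactor (π (εP p))) (c (εP p)) = g p
    have h1 : c (εP p) = T (π (εP p)) (g p) := by
      have h2 : c (εP p) = c₀ (εP p) := dif_neg (hdisj _ (εP p).2)
      have h3 : c₀ (εP p) = T (π (εP p)) (g (εP.symm ⟨εP p, (εP p).2⟩)) := dif_pos (εP p).2
      rw [h2, h3, Subtype.coe_eta, Equiv.symm_apply_apply]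
    rw [h1, hT]
  · change twist (D.twistFactor (π (εN n))) (c (εN n)) = f n
    have h1 : c (εN n) = T (π (εN n)) (f n) := by
      have h2 : c (εN n) = c₀ (εN n) := dif_neg (εN n).2.2
      have h3 : c₀ (εN n) = T (π (εN n)) (f (εN.symm ⟨εN n, (εN n).2⟩)) :=
        (dif_neg (εN n).2.1).trans (dif_pos (εN n).2)
      rw [h2, h3, Subtype.coe_eta, Equiv.symm_apply_apply]
    rw [h1, hT]
  · change fibreSum π l c (εM i) = e i
    have hi : D.kind (π (s (εM i))) = .I0 ∧ s (π (s (εM i))) = s (εM i) := by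
      rw [hs]
      exact ⟨(εM i).2, rfl⟩
    have h0 : ¬ D.IsModuleVertex (π (s (εM i))) := fun h => hdisj _ h hi
    have h1 : c₀ (s (εM i)) = 0 := (dif_neg h0).trans (dif_neg fun h => h.2 hi)
    have h2 : c (s (εM i)) = (l (s (εM i)))⁻¹ • (e i - fibreSum π l c₀ (εM i)) := by
      have h3 : c (s (εM i)) = (l (s (εM i)))⁻¹ • (e (εM.symm ⟨π (s (εM i)), hi.1⟩) -
        fibreSum π l c₀ (π (s (εM i)))) := dif_pos hi
      have h4 : (⟨π (s (εM i)), hi.1⟩ : {j // D.kind j = .I0}) = εM i := Subtype.ext (hs _)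
      rw [h3, h4, Equiv.symm_apply_apply, hs]
    rw [fibreSum_eq_add hs c c₀ (εM i) (fun x hx hx' => dif_neg fun h => hx' ?_) h1, h2, smul_smul,
      mul_inv_cancel₀ (hl _), one_smul, sub_add_cancel]
    rw [← h.2, hx]

end Splitting

/-! ### The isomorphism -/

section Isomorphism

open FundamentalData

variable {K : Type u} [Field K] {I : Type v} [Fintype I] {J : Type*} [Fintype J] [DecidableEq J]
  {D : FundamentalData K J} {π : I → J} {l : I → K} {s : J → I} {M N P : ℕ}
  (εM : Fin M ≃ {j // D.kind j = .I0}) (εN : Fin N ≃ {x // IsAbelianModuleVertex D π s x})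

open scoped Classical in
/-- The modules `W_ν` and `W'_{ν, μ}` attached to the vertices of `I₁` with `ν_i = 0` and to the
vertices of `J₁`. -/
noncomputable def moduleParam (l : I → K) (hD : D.IsReducedAbelian) (x : I) :
    WParam fun (n : Fin N) (i : Fin M) => D.weight (π (εN n)) (εM i) :=
  if hx : D.kind (π x) = .J1 then
    .W' (fun i => D.weight (π x) (εM i))
      (fun n => D.ν (π x) * D.linU (π x) (π (εN n)) * l (εN n)) (by
        intro i n
        by_cases h : D.linU (π x) (π (εN n)) = 0
        · rw [h, mul_zero, zero_mul, zero_mul]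
        · -- The vertices have the same exponents, and `ν = 1` at the vertex of `I₁`.
          have h1 : D.weight (π x) (εM i) = D.weight (π (εN n)) (εM i) := by
            simp only [weight, hx, kind_eq_I1_of_linU h, hD.ν_eq_one hx h, hD.expB_eq hx h,
              one_ne_zero, if_false, one_mul]
          rw [h1, sub_self, mul_zero])
  else .W fun i => D.weight (π x) (εM i)

/-- The vertices of `I₁` on which a vertex of `J₁` depends have `ν = 1`: they give modules `V_υ`,
and their coordinates are not twisted. -/
theorem sum_linU_smul (hD : D.IsReducedAbelian) {x : I} (hx : D.kind (π x) = .J1) (c : I → Seq K) :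
    ∑ k, (D.ν (π x) * D.linU (π x) k) • fibreSum π l c k =
      ∑ n, (D.ν (π x) * D.linU (π x) (π (εN n)) * l (εN n)) •
        twist (D.twistFactor (π (εN n))) (c (εN n)) := by
  have h1 : ∑ k, (D.ν (π x) * D.linU (π x) k) • fibreSum π l c k =
      ∑ y, (D.ν (π x) * D.linU (π x) (π y) * l y) • twist (D.twistFactor (π y)) (c y) := by
    simp only [fibreSum, Finset.smul_sum]
    rw [Finset.sum_comm]
    refine Finset.sum_congr rfl fun y _ => ?_
    rw [Finset.sum_eq_single (π y), if_pos rfl, smul_smul]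
    · by_cases h : D.linU (π x) (π y) = 0
      · rw [h, mul_zero, zero_mul, zero_smul, zero_smul]
      · have h2 : D.twistFactor (π y) = 0 := by
          rw [twistFactor, hD.ν_eq_one hx h, inv_one, sub_self, ite_self]
        rw [h2, twist_apply, zero_smul, add_zero]
    · intro k _ hk
      rw [if_neg hk.symm, smul_zero]
    · simp
  rw [h1]
  refine sum_eq_sum_equiv εN _ fun y hy => ?_
  have h : D.linU (π x) (π y) = 0 := by
    by_contra h
    refine hy ⟨?_, fun h' => ?_⟩
    · have h2 := kind_eq_I1_of_linU h
      rintro (h' | h')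
      · rw [hD.ν_eq_one hx h] at h'
        exact one_ne_zero h'.2
      · rw [h2] at h'
        exact absurd h' (by simp)
    · have h2 := kind_eq_I1_of_linU h
      rw [h2] at h'
      exact absurd h'.1 (by simp)
  rw [h, mul_zero, zero_mul, zero_smul]

variable (εP : Fin P ≃ {x // D.IsModuleVertex (π x)})

theorem wAct_splitMap (hD : D.IsReducedAbelian) (c d : I → Seq K) (p : Fin P) :
    wAct (splitMap D π l s εM εN εP c).2.1 (splitMap D π l s εM εN εP c).2.2
      ((splitMap D π l s εM εN εP d).1 p) (moduleParam εM εN l hD (εP p)) =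
      star D π l c d (εP p) := by
  have hM : ∑ i, D.weight (π (εP p)) (εM i) • (splitMap D π l s εM εN εP c).2.2 i =
      ∑ j, D.weight (π (εP p)) j • fibreSum π l c j := (sum_weight_smul εM _ _).symm
  have hd : (splitMap D π l s εM εN εP d).1 p =
    twist (D.twistFactor (π (εP p))) (d (εP p)) := rfl
  by_cases hx : D.kind (π (εP p)) = .J1
  · have hN : ∑ n, (D.ν (π (εP p)) * D.linU (π (εP p)) (π (εN n)) * l (εN n)) •
        (splitMap D π l s εM εN εP c).2.1 n =
        ∑ k, (D.ν (π (εP p)) * D.linU (π (εP p)) k) • fibreSum π l c k :=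
      (sum_linU_smul εN hD hx c).symm
    rw [moduleParam, dif_pos hx, wAct, hM, hN, hd, star_of_J1 π l c d hD hx]
  · obtain ⟨h1, h2⟩ := (εP p).2.resolve_right hx
    rw [moduleParam, dif_neg hx, wAct, hM, hd, star_of_I1_of_eq_zero π l c d h1 h2]

theorem seqMul_splitMap (hD : D.IsReducedAbelian) (c d : I → Seq K) (n : Fin N) :
    seqMul (∑ i, D.weight (π (εN n)) (εM i) • (splitMap D π l s εM εN εP c).2.2 i)
      ((splitMap D π l s εM εN εP d).2.1 n) = star D π l c d (εN n) := by
  have hM : ∑ i, D.weight (π (εN n)) (εM i) • (splitMap D π l s εM εN εP c).2.2 i =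
      ∑ j, D.weight (π (εN n)) j • fibreSum π l c j := (sum_weight_smul εM _ _).symm
  rw [hM, star_of_not_isModuleVertex π l c d hD (εN n).2.1]
  rfl

theorem splitMap_star_sub_star (c d : I → Seq K) :
    splitMap D π l s εM εN εP (fun x => star D π l c d x - star D π l d c x) =
      (fun p => star D π l c d (εP p) - star D π l d c (εP p),
        fun n => star D π l c d (εN n) - star D π l d c (εN n), 0) := by
  have h : ∀ x, twist (D.twistFactor (π x)) (star D π l c d x - star D π l d c x) =
      star D π l c d x - star D π l d c x := fun x =>
    twist_of_apply_one _ (by rw [Finsupp.sub_apply, star_apply_one, star_apply_one, sub_zero])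
  exact Prod.ext (funext fun p => h _) (Prod.ext (funext fun n => h _)
    (funext fun i => fibreSum_star_sub_star π l c d (εM i).2))

/-- The adapted coordinates are compatible with the brackets of `𝔤_(S)` and of the semi-direct
product. -/
theorem gwvOf_splitMap_star_sub_star (hD : D.IsReducedAbelian) (c d : I → Seq K) :
    gwvOf (fun p => moduleParam εM εN l hD (εP p))
      (splitMap D π l s εM εN εP fun x => star D π l c d x - star D π l d c x) =
    ⁅gwvOf (fun p => moduleParam εM εN l hD (εP p)) (splitMap D π l s εM εN εP c),
      gwvOf (fun p => moduleParam εM εN l hD (εP p)) (splitMap D π l s εM εN εP d)⁆ := by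
  refine Eq.trans ?_ (lie_gwvOf (fun p => moduleParam εM εN l hD (εP p)) _ _ _ _ _ _).symm
  rw [splitMap_star_sub_star]
  refine congrArg _ (Prod.ext (funext fun p => ?_) (Prod.ext (funext fun n => ?_) rfl))
  · exact (congrArg₂ (· - ·) (wAct_splitMap εM εN εP hD c d p)
      (wAct_splitMap εM εN εP hD d c p)).symm
  · exact (congrArg₂ (· - ·) (seqMul_splitMap εM εN εP hD c d n)
      (seqMul_splitMap εM εN εP hD d c n)).symm

theorem nonempty_lieEquiv {L L' V : Type*} [LieRing L] [LieAlgebra K L] [LieRing L']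
    [LieAlgebra K L'] [AddCommGroup V] [Module K V] (Φ : V ≃ₗ[K] L) (G : V ≃ₗ[K] L')
    (b : V → V → V) (hΦ : ∀ c d, ⁅Φ c, Φ d⁆ = Φ (b c d)) (hG : ∀ c d, ⁅G c, G d⁆ = G (b c d)) :
    Nonempty (L ≃ₗ⁅K⁆ L') := by
  refine ⟨{ Φ.symm ≪≫ₗ G with map_lie' := ?_ }⟩
  intro x y
  obtain ⟨c, rfl⟩ := Φ.surjective x
  obtain ⟨d, rfl⟩ := Φ.surjective y
  change G (Φ.symm ⁅Φ c, Φ d⁆) = ⁅G (Φ.symm (Φ c)), G (Φ.symm (Φ d))⁆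
  rw [hΦ, Φ.symm_apply_apply, Φ.symm_apply_apply, Φ.symm_apply_apply, hG]

theorem AbelianPresentation.exists_lieEquiv [CharZero K] {F : SDSE K I}
    (hP : AbelianPresentation F D π l) (hH : F.IsHopf) :
    ∃ (M N P : ℕ) (υ : Fin N → Fin M → K) (w : Fin P → WParam υ),
      1 ≤ M ∧ Nonempty (F.lieAlg hH ≃ₗ⁅K⁆ GWV w) := by
  classical
  obtain ⟨Ψ, hΨ⟩ := hP.exists_coordinates hH
  have hD := hP.reduced
  have hs := Function.surjInv_eq hP.surjective
  obtain ⟨j, hj⟩ := hD.valid.nonempty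
  have hj0 : D.kind j = .I0 := by
    rcases hD.kind_cases j with h | h | h
    · exact h
    · simp [h] at hj
    · simp [h] at hj
  obtain ⟨M, ⟨εM⟩⟩ := Finite.exists_equiv_fin {j // D.kind j = .I0}
  obtain ⟨N, ⟨εN⟩⟩ := Finite.exists_equiv_fin
    {x // IsAbelianModuleVertex D π (Function.surjInv hP.surjective) x}
  obtain ⟨P, ⟨εP⟩⟩ := Finite.exists_equiv_fin {x // D.IsModuleVertex (π x)}
  refine ⟨M, N, P, _, fun p => moduleParam εM.symm εN.symm l hD (εP.symm p),
    (Nat.zero_le _).trans_lt (εM ⟨j, hj0⟩).isLt, ?_⟩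
  exact nonempty_lieEquiv Ψ (LinearEquiv.ofBijective _ ⟨splitMap_injective εM.symm εN.symm εP.symm
    hD hP.l_ne_zero hs, splitMap_surjective _ _ _ hD hP.l_ne_zero hs⟩ ≪≫ₗ gwvOf _) _ hΨ
    fun c d => (gwvOf_splitMap_star_sub_star εM.symm εN.symm εP.symm hD c d).symm

end Isomorphism

end HopfSDSE

open HopfSDSE in
/-- The Lie algebra of a Hopf system of abelian fundamental type without extension vertices. -/
theorem theorem69 {K : Type*} [Field K] [CharZero K] {I : Type*} [Fintype I] [Nonempty I]
    (F : SDSE K I) (hF : F.IsSDSE) (hHopf : F.IsHopf) (hab : F.IsExtendedFundamentalAbelian)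
    (hext : ∀ i, ¬ F.IsExtensionVertex i) :
    ∃ (M N P : ℕ) (υ : Fin N → Fin M → K) (w : Fin P → WParam υ),
      1 ≤ M ∧ Nonempty (F.lieAlg hHopf ≃ₗ⁅K⁆ GWV w) := by
  obtain ⟨_, _, _, _, hP⟩ := exists_abelianPresentation hab hext
  exact hP.exists_lieEquiv hHopf
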